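/- **Corollary (multiplication on the acyclic bar construction).** Let $R$ be a commutative ring with unit and $Y$ a topological space with base point $y$. Let $X=\mathrm{Sing}^1Y\subset \mathrm{Sing}\,Y$ be the simplicial subset of singular simplices that send the $1$-skeleton of $\Delta^n$ to $y$, and let $C^*(Y)=\bigoplus_n C^n(Y)$, where $C^n(Y)$ is the $R$-module of functions $X_n\to R$ that, for $n>0$, vanish on the constant simplex at $y$. It carries the coboundary $(da)(\sigma)=\sum_i(-1)^i a(\partial_i\sigma)$ and the cup product $(ab)(\sigma)=a(\text{front face})\,b(\text{back face})$. Write $\sigma(i_0,\dots,i_r)$ for the face of $\sigma$ on the indicated vertices, $\bar C=s^{-1}C^{>0}(Y)$, $|\bar a|=|a|-1$, and $BC^*(Y)=T(\bar C)$ with elements $[\bar a_1|\cdots|\bar a_n]$. *Operations.* For homogeneous $c_1,\dots,c_j$ with $|c_q|=m_q\ge 1$ and $|c_0|=j$, let $\tilde E_{j,1}(c_1,\dots,c_j;c_0)$ be the cochain of degree $n=m_1+\dots+m_j$ with value $$(-1)^{\sum_q (q-1)(m_q-1)}\,\Big(\prod_{q=1}^{j}c_q(\sigma(i_{q-1},i_{q-1}+1,\dots,i_q))\Big)\;c_0(\sigma(i_0,i_1,\dots,i_j)),\qquad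 i_q=m_1+\dots+m_q,$$ and let $\tilde E_{j,1}(c_1,\dots,c_j;c_0)=0$ if $|c_0|\neq j$. Let $\varepsilon$ be the $1$-cochain (not in $C^*(Y)$) with value $1$ on the constant $1$-simplex at $y$. For $a_i\in C^{>0}(Y)$, $a_0\in C^*(Y)$ and $k\ge0$ put $$E_{k,1}(a_1,\dots,a_k;a_0)=\sum_{j\ge k}\ \sum\tilde E_{j,1}(\varepsilon,\dots,\varepsilon,a_1,\varepsilon,\dots,\varepsilon,a_k,\varepsilon,\dots,\varepsilon;a_0),$$ the inner sum being over all ways of inserting $j-k$ copies of $\varepsilon$; thus $E_{0,1}=\mathrm{id}$. *Product on $BC^*(Y)$.* Let $\circ$ be the comultiplicative extension $BC^*(Y)\otimes BC^*(Y)\to BC^*(Y)$ of $E_{1,0}=\mathrm{id}$ and the $E_{k,1}$, $k\ge0$; explicitly $x\circ[\,]=x$ and $$x\circ[\bar b|y]=\sum(-1)^{|\bar b||x_3|}\,x_1\cdot[\overline{E_{\ast,1}(x_2;b)}]\cdot(x_3\circ y),$$ the sum over all ways of cutting the word $x$ into three consecutive (possibly empty) words $x_1,x_2,x_3$, where $\cdot$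 is concatenation and $E_{\ast,1}([\bar a_1|\cdots|\bar a_k];b)=E_{k,1}(a_1,\dots,a_k;b)$. *Acyclic bar construction.* $B(C^*(Y);C^*(Y))=C^*(Y)\otimes_R BC^*(Y)$, graded by $|a_0|+\sum|\bar a_i|$, with the differential $$d(a_0\otimes[\bar a_1|\cdots|\bar a_n])=da_0\otimes[\bar a_1|\cdots|\bar a_n]-(-1)^{|a_0|}a_0\otimes d_B[\bar a_1|\cdots|\bar a_n]+(-1)^{|a_0|+|a_1|}a_0a_1\otimes[\bar a_2|\cdots|\bar a_n]$$ (the last term being absent for $n=0$), where, with $\varepsilon_i=\sum_{j<i}|\bar a_j|$, $$d_B[\bar a_1|\cdots|\bar a_n]=-\sum_{i=1}^n(-1)^{\varepsilon_i}[\bar a_1|\cdots|\overline{da_i}|\cdots|\bar a_n]-\sum_{i=2}^n(-1)^{\varepsilon_i}[\bar a_1|\cdots|\overline{a_{i-1}a_i}|\cdots|\bar a_n].$$ **Statement.** There is exactly one $R$-bilinear multiplication on $B(C^*(Y);C^*(Y))$ such that, for all $n,m\ge0$ and all homogeneous $a_0,b_0\in C^*(Y)$, $\bar a_1,\dots,\bar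 a_n,\bar b_1,\dots,\bar b_m\in\bar C$, $a=a_0\otimes[\bar a_1|\cdots|\bar a_n]$ and $b=b_0\otimes[\bar b_1|\cdots|\bar b_m]$ have the product $$ab=\sum_{k=0}^{n}(-1)^{|b_0|(|\bar a_{k+1}|+\cdots+|\bar a_n|)}\,a_0E_{k,1}(a_1,\dots,a_k;b_0)\otimes[\bar a_{k+1}|\cdots|\bar a_n]\circ[\bar b_1|\cdots|\bar b_m].$$ This multiplication is strictly associative, has the unit $1\otimes[\,]$, adds degrees, and together with $d$ makes $B(C^*(Y);C^*(Y))$ a differential graded algebra: $d$ has degree $1$, $d^2=0$ and $d(ab)=(da)b+(-1)^{|a|}a\,(db)$. -/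

import Mathlib

open CategoryTheory Opposite
open scoped Simplicial TensorProduct

noncomputable section

namespace AcyclicBar

universe u v

/-! ### Simplicial sets and the Eilenberg subcomplex -/

/-- The `n`-simplex of `X` that is degenerate on the vertex `x`. -/
def constSimplex (X : SSet.{u}) (x : X _⦋0⦌) (n : ℕ) : X _⦋n⦌ :=
  X.map (SimplexCategory.const ⦋n⦌ ⦋0⦌ 0).op x

lemma map_constSimplex (X : SSet.{u}) (x : X _⦋0⦌) {m n : ℕ} (f : ⦋m⦌ ⟶ ⦋n⦌) :
    X.map f.op (constSimplex X x n) = constSimplex X x m := by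
  unfold constSimplex
  rw [← Functor.map_comp_apply, ← op_comp]
  congr 1

/-- The subcomplex of all simplices that send the `1`-skeleton of `Δⁿ` (the union of the images
of all simplicial maps `Δ¹ → Δⁿ`) to the vertex `x`. -/
def eilenbergOne (S : SSet.{u}) (x : S _⦋0⦌) : S.Subcomplex where
  obj n := {σ | ∀ f : ⦋1⦌ ⟶ n.unop, S.map f.op σ = constSimplex S x 1}
  map {n m} g σ hσ := by
    intro f
    have h := hσ (f ≫ g.unop)
    rwa [op_comp, Quiver.Hom.op_unop, Functor.map_comp_apply] at h

/-- The singular `0`-simplex at the point `y`. -/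
def singVertex (Y : Type u) [TopologicalSpace Y] (y : Y) :
    (TopCat.toSSet.obj (TopCat.of Y)) _⦋0⦌ :=
  (TopCat.toSSetObjEquiv (TopCat.of Y) (op ⦋0⦌)).symm (ContinuousMap.const _ y)

/-- `Sing¹ Y`: the singular simplices of `Y` that send the `1`-skeleton to the base point. -/
def singOne (Y : Type u) [TopologicalSpace Y] (y : Y) : SSet.{u} :=
  (eilenbergOne (TopCat.toSSet.obj (TopCat.of Y)) (singVertex Y y)).toSSet

/-- The unique vertex of `Sing¹ Y`. -/
def singOneBase (Y : Type u) [TopologicalSpace Y] (y : Y) : (singOne Y y) _⦋0⦌ :=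
  ⟨singVertex Y y, fun f => by
    have h := map_constSimplex (TopCat.toSSet.obj (TopCat.of Y)) (singVertex Y y) f
    have h0 : constSimplex (TopCat.toSSet.obj (TopCat.of Y)) (singVertex Y y) 0
        = singVertex Y y := by
      unfold constSimplex
      rw [Subsingleton.elim (SimplexCategory.const ⦋0⦌ ⦋0⦌ 0) (𝟙 ⦋0⦌), op_id,
        Functor.map_id_apply]
    rw [h0] at h
    exact h⟩

/-! ### Cochains -/

variable (R : Type v) [CommRing R] (X : SSet.{u}) (x : X _⦋0⦌)

/-- Families of functions on the simplices of `X`, one in each dimension. -/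
abbrev Coch : Type (max u v) := ∀ n : ℕ, X _⦋n⦌ → R

variable {R X}

/-- The face of `σ` spanned by the vertices `s, s + 1, …, s + l`. -/
def segment {n : ℕ} (σ : X _⦋n⦌) (s l : ℕ) (h : s + l ≤ n) : X _⦋l⦌ :=
  X.map (SimplexCategory.subinterval s l h).op σ

/-- The face of `σ` spanned by the vertices `g 0 < g 1 < … < g j`. -/
def subface {n j : ℕ} (σ : X _⦋n⦌) (g : Fin (j + 1) ↪o Fin (n + 1)) : X _⦋j⦌ :=
  X.map (SimplexCategory.mkHom g.toOrderHom).op σ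

lemma segment_const {n : ℕ} (s l : ℕ) (h : s + l ≤ n) :
    segment (constSimplex X x n) s l h = constSimplex X x l := map_constSimplex X x _

lemma subface_const {n j : ℕ} (g : Fin (j + 1) ↪o Fin (n + 1)) :
    subface (constSimplex X x n) g = constSimplex X x j := map_constSimplex X x _

/-- `a` is homogeneous of degree `q`. -/
def IsHomog (q : ℕ) (a : Coch R X) : Prop := ∀ n, n ≠ q → a n = 0

variable (R)

/-- The cochain module `C^*(X) = ⨁ C^n(X)`, where `C^n(X)` is dual to the quotient of the ordinary
(not normalized) chain module of `X` by the positive-dimensional chains of the base point. Elements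
of the direct sum are families that vanish in all large degrees. -/
def cochains : Submodule R (Coch R X) where
  carrier := {a | (∃ N, ∀ n, N ≤ n → a n = 0) ∧ ∀ n, 0 < n → a n (constSimplex X x n) = 0}
  add_mem' := by
    rintro a b ⟨⟨N, hN⟩, ha⟩ ⟨⟨M, hM⟩, hb⟩
    refine ⟨⟨max N M, fun n hn => ?_⟩, fun n hn => ?_⟩
    · simp [hN n (le_trans (le_max_left _ _) hn), hM n (le_trans (le_max_right _ _) hn)]
    · simp [ha n hn, hb n hn]
  zero_mem' := ⟨⟨0, fun n _ => rfl⟩, fun n _ => rfl⟩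
  smul_mem' := by
    rintro r a ⟨⟨N, hN⟩, ha⟩
    exact ⟨⟨N, fun n hn => by simp [hN n hn]⟩, fun n hn => by simp [ha n hn]⟩

/-- The submodule of cochains of positive degree. -/
def posCochains : Submodule R (Coch R X) :=
  cochains R x ⊓ LinearMap.ker (LinearMap.proj (R := R) (φ := fun n : ℕ => X _⦋n⦌ → R) 0)

/-- The cochain module `C^*(X)`. -/
abbrev C : Type (max u v) := ↥(cochains R x)

/-- The desuspension `s⁻¹ C^{>0}(X)`: a cochain of degree `n + 1` has degree `n` here. -/
abbrev Cbar : Type (max u v) := ↥(posCochains R x)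

instance : AddCommGroup (C R x) := (cochains R x).addCommGroup

instance : AddCommGroup (Cbar R x) := (posCochains R x).addCommGroup

/-- The underlying module of the bar construction, `T(s⁻¹ C^{>0}(X))`; the element
`[ā₁|…|āₙ]` is `TensorAlgebra.tprod R (Cbar R x) n a`. -/
abbrev Bar : Type (max u v) := TensorAlgebra R (Cbar R x)

/-- The underlying module `C^*(X) ⊗ B C^*(X)` of the acyclic bar construction. -/
abbrev ABar : Type (max u v) := C R x ⊗[R] Bar R x

/-- The inclusion of the cochains of positive degree. -/
def incl : Cbar R x →ₗ[R] C R x := Submodule.inclusion inf_le_left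

variable {R x}

lemma mem_posCochains {a : Coch R X} : a ∈ posCochains R x ↔ a ∈ cochains R x ∧ a 0 = 0 :=
  Iff.rfl

/-! ### Unit, sign involution, coboundary and cup product -/

variable (R x)

/-- The unit cochain. -/
def one : C R x :=
  ⟨fun n _ => if n = 0 then 1 else 0,
    ⟨1, fun n hn => by funext σ; simp [Nat.one_le_iff_ne_zero.mp hn]⟩,
    fun n hn => by simp [hn.ne']⟩

/-- `a ↦ (-1)^|a| a` on `C^*(X)`. -/
def inv : C R x →ₗ[R] C R x where
  toFun a := ⟨fun n σ => (-1) ^ n * a.1 n σ, by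
    obtain ⟨a, ⟨N, hN⟩, ha⟩ := a
    exact ⟨⟨N, fun n hn => by funext σ; simp [hN n hn]⟩, fun n hn => by simp [ha n hn]⟩⟩
  map_add' a b := by ext n σ; simp [mul_add]
  map_smul' r a := by ext n σ; simp [mul_left_comm]

/-- `ā ↦ (-1)^|ā| ā` on `s⁻¹ C^{>0}(X)`, where `|ā| = |a| - 1`. -/
def invBar : Cbar R x →ₗ[R] Cbar R x where
  toFun a := ⟨fun n σ => -((-1) ^ n * a.1 n σ), by
    obtain ⟨a, ⟨⟨N, hN⟩, ha⟩, h0⟩ := a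
    have h0' : a 0 = 0 := h0
    exact ⟨⟨⟨N, fun n hn => by funext σ; simp [hN n hn]⟩, fun n hn => by simp [ha n hn]⟩,
      by rw [SetLike.mem_coe, LinearMap.mem_ker, LinearMap.proj_apply]; funext σ; simp [h0']⟩⟩
  map_add' a b := by ext n σ; simp [mul_add]; ring
  map_smul' r a := by ext n σ; simp [mul_left_comm]

variable {R}

/-- The coboundary `(da)(σ) = ∑ (-1)^i a(∂ᵢ σ)`. -/
def coboundary (a : Coch R X) : Coch R X := fun n =>
  match n with
  | 0 => 0
  | n + 1 => fun σ => ∑ i : Fin (n + 2), (-1) ^ (i : ℕ) * a n (X.δ i σ)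

/-- The cup product `(ab)(σ) = ∑ a(front p-face) b(back (n-p)-face)`. -/
def cupFun (a b : Coch R X) : Coch R X := fun n σ =>
  ∑ p : Fin (n + 1), a p (segment σ 0 p (by omega)) * b (n - p) (segment σ p (n - p) (by omega))

lemma delta_const (n : ℕ) (i : Fin (n + 2)) :
    X.δ i (constSimplex X x (n + 1)) = constSimplex X x n := map_constSimplex X x _

variable {x}

lemma coboundary_mem {a : Coch R X} (ha : a ∈ cochains R x) : coboundary a ∈ cochains R x := by
  obtain ⟨⟨N, hN⟩, ha⟩ := ha
  refine ⟨⟨N + 1, fun n hn => ?_⟩, fun n hn => ?_⟩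
  · obtain ⟨n, rfl⟩ : ∃ k, n = k + 1 := ⟨n - 1, by omega⟩
    funext σ
    simp [coboundary, hN n (by omega)]
  · obtain ⟨n, rfl⟩ : ∃ k, n = k + 1 := ⟨n - 1, by omega⟩
    simp only [coboundary, delta_const]
    rcases Nat.eq_zero_or_pos n with rfl | h
    · simp [Fin.sum_univ_two]
    · simp [ha n h]

lemma coboundary_zero (a : Coch R X) : coboundary a 0 = 0 := rfl

lemma coboundary_add (a b : Coch R X) : coboundary (a + b) = coboundary a + coboundary b := by
  funext n σ
  cases n <;> simp [coboundary, mul_add, Finset.sum_add_distrib]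

lemma coboundary_smul (r : R) (a : Coch R X) : coboundary (r • a) = r • coboundary a := by
  funext n σ
  cases n <;> simp [coboundary, Finset.mul_sum, mul_left_comm]

lemma cupFun_mem {a b : Coch R X} (ha : a ∈ cochains R x) (hb : b ∈ cochains R x) :
    cupFun a b ∈ cochains R x := by
  obtain ⟨⟨N, hN⟩, ha⟩ := ha
  obtain ⟨⟨M, hM⟩, hb⟩ := hb
  refine ⟨⟨N + M, fun n hn => ?_⟩, fun n hn => ?_⟩
  · funext σ
    refine Finset.sum_eq_zero fun p _ => ?_
    rcases le_or_gt N p with h | h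
    · simp [hN _ h]
    · simp [hM (n - p) (by omega)]
  · refine Finset.sum_eq_zero fun p _ => ?_
    rw [segment_const, segment_const]
    rcases Nat.eq_zero_or_pos (p : ℕ) with h | h
    · rw [hb (n - p) (by omega), mul_zero]
    · rw [ha _ h, zero_mul]

lemma cupFun_zero {a b : Coch R X} (ha : a 0 = 0) : cupFun a b 0 = 0 := by
  funext σ
  refine Finset.sum_eq_zero fun p _ => ?_
  obtain ⟨p, hp⟩ := p
  obtain rfl : p = 0 := by omega
  simp [ha]

lemma cupFun_add_left (a a' b : Coch R X) : cupFun (a + a') b = cupFun a b + cupFun a' b := by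
  funext n σ; simp [cupFun, add_mul, Finset.sum_add_distrib]

lemma cupFun_add_right (a b b' : Coch R X) : cupFun a (b + b') = cupFun a b + cupFun a b' := by
  funext n σ; simp [cupFun, mul_add, Finset.sum_add_distrib]

lemma cupFun_smul_left (r : R) (a b : Coch R X) : cupFun (r • a) b = r • cupFun a b := by
  funext n σ; simp [cupFun, Finset.mul_sum, mul_assoc]

lemma cupFun_smul_right (r : R) (a b : Coch R X) : cupFun a (r • b) = r • cupFun a b := by
  funext n σ; simp [cupFun, Finset.mul_sum, mul_left_comm]

variable (R x)

/-- The differential of `C^*(X)`. -/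
def dC : C R x →ₗ[R] C R x where
  toFun a := ⟨coboundary a.1, coboundary_mem a.2⟩
  map_add' a b := Subtype.ext (coboundary_add a.1 b.1)
  map_smul' r a := Subtype.ext (coboundary_smul r a.1)

/-- The differential of `C^*(X)` on cochains of positive degree. -/
def dCbar : Cbar R x →ₗ[R] Cbar R x where
  toFun a := ⟨coboundary a.1, coboundary_mem a.2.1, coboundary_zero a.1⟩
  map_add' a b := Subtype.ext (coboundary_add a.1 b.1)
  map_smul' r a := Subtype.ext (coboundary_smul r a.1)

/-- The product of `C^*(X)`. -/
def cup : C R x →ₗ[R] C R x →ₗ[R] C R x :=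
  LinearMap.mk₂ R (fun a b => ⟨cupFun a.1 b.1, cupFun_mem a.2 b.2⟩)
    (fun _ _ _ => Subtype.ext (cupFun_add_left _ _ _))
    (fun _ _ _ => Subtype.ext (cupFun_smul_left _ _ _))
    (fun _ _ _ => Subtype.ext (cupFun_add_right _ _ _))
    (fun _ _ _ => Subtype.ext (cupFun_smul_right _ _ _))

/-- The product of `C^*(X)` on cochains of positive degree. -/
def cupBar : Cbar R x →ₗ[R] Cbar R x →ₗ[R] Cbar R x :=
  LinearMap.mk₂ R (fun a b => ⟨cupFun a.1 b.1, cupFun_mem a.2.1 b.2.1, cupFun_zero a.2.2⟩)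
    (fun _ _ _ => Subtype.ext (cupFun_add_left _ _ _))
    (fun _ _ _ => Subtype.ext (cupFun_smul_left _ _ _))
    (fun _ _ _ => Subtype.ext (cupFun_add_right _ _ _))
    (fun _ _ _ => Subtype.ext (cupFun_smul_right _ _ _))

/-! ### The operations `E_{k,1}` -/

variable {R}

/-- The `1`-cochain that is `1` on the constant `1`-simplex at the base point and `0` on all other
simplices. -/
def eps : Coch R X := fun n σ =>
  open Classical in if n = 1 ∧ σ = constSimplex X x n then 1 else 0

variable {x}

lemma gap_pos {n j : ℕ} (g : Fin (j + 1) ↪o Fin (n + 1)) (i : Fin j) :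
    (g i.castSucc : ℕ) < g i.succ := g.strictMono Fin.castSucc_lt_succ

lemma gap_le {n j : ℕ} (g : Fin (j + 1) ↪o Fin (n + 1)) (i : Fin j) :
    (g i.castSucc : ℕ) + ((g i.succ : ℕ) - g i.castSucc) ≤ n := by
  have := gap_pos g i
  omega

/-- The operation `Ẽ_{j,1}(c₁, …, c_j; c₀)`: the sum over all `0 = i₀ < i₁ < … < i_j = n` of the
terms `± c₁(σ(i₀, …, i₁)) ⋯ c_j(σ(i_{j-1}, …, i_j)) c₀(σ(i₀, i₁, …, i_j))`, with sign exponent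
`∑ (q - 1)(m_q - 1)` where `m_q = i_q - i_{q-1}`. On homogeneous cochains the only term that can be
non-zero has `m_q = |c_q|`, and `|c₀| = j`. -/
def opTilde (j : ℕ) (c : Fin j → Coch R X) (c₀ : Coch R X) : Coch R X := fun n σ =>
  ∑ g : Fin (j + 1) ↪o Fin (n + 1),
    if g 0 = 0 ∧ g (Fin.last j) = Fin.last n then
      (-1) ^ (∑ q : Fin j, (q : ℕ) * ((g q.succ : ℕ) - g q.castSucc - 1)) *
        (∏ q : Fin j, c q ((g q.succ : ℕ) - g q.castSucc)
          (segment σ (g q.castSucc) ((g q.succ : ℕ) - g q.castSucc) (gap_le g q))) *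
        c₀ j (subface σ g)
    else 0

variable (x)

/-- The operation `E_{k,1}(a₁, …, a_k; a₀) = ∑_j Ẽ_{j,1}(ε, …, ε, a₁, ε, …, ε, a_k, ε, …, ε; a₀)`,
the sum over all ways of inserting copies of `ε` around the `a_i`. Only `j ≤ n` contribute in
dimension `n`. -/
def opFun (k : ℕ) (a : Fin k → Coch R X) (a₀ : Coch R X) : Coch R X := fun n σ =>
  ∑ j ∈ Finset.range (n + 1), ∑ f : Fin k ↪o Fin j,
    opTilde j (Function.extend f a fun _ => eps x) a₀ n σ

variable {x}

lemma opTilde_update_add {j : ℕ} (c : Fin j → Coch R X) (c₀ : Coch R X) (i : Fin j)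
    (u v : Coch R X) :
    opTilde j (Function.update c i (u + v)) c₀
      = opTilde j (Function.update c i u) c₀ + opTilde j (Function.update c i v) c₀ := by
  funext n σ
  simp only [opTilde, Pi.add_apply, ← Finset.sum_add_distrib]
  refine Finset.sum_congr rfl fun g _ => ?_
  split_ifs
  · rw [← add_mul, ← mul_add]
    congr 2
    rw [← Finset.mul_prod_erase _ _ (Finset.mem_univ i),
      ← Finset.mul_prod_erase _ _ (Finset.mem_univ i),
      ← Finset.mul_prod_erase _ _ (Finset.mem_univ i)]
    simp only [Function.update_self, Pi.add_apply, add_mul]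
    congr 2 <;>
    · refine Finset.prod_congr rfl fun q hq => ?_
      simp [Function.update_of_ne (Finset.ne_of_mem_erase hq)]
  · simp

lemma opTilde_update_smul {j : ℕ} (c : Fin j → Coch R X) (c₀ : Coch R X) (i : Fin j)
    (r : R) (u : Coch R X) :
    opTilde j (Function.update c i (r • u)) c₀
      = r • opTilde j (Function.update c i u) c₀ := by
  funext n σ
  simp only [opTilde, Pi.smul_apply, Finset.smul_sum]
  refine Finset.sum_congr rfl fun g _ => ?_
  split_ifs
  · rw [← Finset.mul_prod_erase _ _ (Finset.mem_univ i),
      ← Finset.mul_prod_erase _ _ (Finset.mem_univ i)]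
    have h : ∀ w : Coch R X, ∏ q ∈ Finset.univ.erase i, Function.update c i w q
          ((g q.succ : ℕ) - g q.castSucc)
          (segment σ (g q.castSucc) ((g q.succ : ℕ) - g q.castSucc) (gap_le g q))
        = ∏ q ∈ Finset.univ.erase i, c q ((g q.succ : ℕ) - g q.castSucc)
          (segment σ (g q.castSucc) ((g q.succ : ℕ) - g q.castSucc) (gap_le g q)) := fun w =>
      Finset.prod_congr rfl fun q hq => by
        simp [Function.update_of_ne (Finset.ne_of_mem_erase hq)]
    rw [h, h]
    simp only [Function.update_self, Pi.smul_apply, smul_eq_mul]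
    ring
  · simp

lemma extend_update {k j : ℕ} {A : Type*} (f : Fin k ↪o Fin j) (a : Fin k → A) (e : Fin j → A)
    (i : Fin k) (u : A) :
    Function.extend f (Function.update a i u) e
      = Function.update (Function.extend f a e) (f i) u := by
  funext q
  by_cases hq : ∃ l, f l = q
  · obtain ⟨l, rfl⟩ := hq
    rw [f.injective.extend_apply]
    rcases eq_or_ne l i with rfl | h
    · simp
    · rw [Function.update_of_ne h, Function.update_of_ne (f.injective.ne h),
        f.injective.extend_apply]
  · rw [Function.extend_apply' _ _ _ hq, Function.update_of_ne, Function.extend_apply' _ _ _ hq]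
    rintro rfl
    exact hq ⟨i, rfl⟩

lemma opFun_update_add {k : ℕ} (a : Fin k → Coch R X) (a₀ : Coch R X) (i : Fin k)
    (u v : Coch R X) :
    opFun x k (Function.update a i (u + v)) a₀
      = opFun x k (Function.update a i u) a₀ + opFun x k (Function.update a i v) a₀ := by
  funext n σ
  simp only [opFun, extend_update, opTilde_update_add, Pi.add_apply, Finset.sum_add_distrib]

lemma opFun_update_smul {k : ℕ} (a : Fin k → Coch R X) (a₀ : Coch R X) (i : Fin k)
    (r : R) (u : Coch R X) :
    opFun x k (Function.update a i (r • u)) a₀ = r • opFun x k (Function.update a i u) a₀ := by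
  funext n σ
  simp only [opFun, extend_update, opTilde_update_smul, Pi.smul_apply, Finset.smul_sum]

lemma opTilde_add_right {j : ℕ} (c : Fin j → Coch R X) (u v : Coch R X) :
    opTilde j c (u + v) = opTilde j c u + opTilde j c v := by
  funext n σ
  simp only [opTilde, Pi.add_apply, ← Finset.sum_add_distrib]
  refine Finset.sum_congr rfl fun g _ => ?_
  split_ifs
  · rw [mul_add]
  · simp

lemma opTilde_smul_right {j : ℕ} (c : Fin j → Coch R X) (r : R) (u : Coch R X) :
    opTilde j c (r • u) = r • opTilde j c u := by
  funext n σ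
  simp only [opTilde, Pi.smul_apply, Finset.smul_sum]
  refine Finset.sum_congr rfl fun g _ => ?_
  split_ifs
  · simp only [smul_eq_mul]; ring
  · simp

lemma opFun_add_right {k : ℕ} (a : Fin k → Coch R X) (u v : Coch R X) :
    opFun x k a (u + v) = opFun x k a u + opFun x k a v := by
  funext n σ
  simp only [opFun, opTilde_add_right, Pi.add_apply, Finset.sum_add_distrib]

lemma opFun_smul_right {k : ℕ} (a : Fin k → Coch R X) (r : R) (u : Coch R X) :
    opFun x k a (r • u) = r • opFun x k a u := by
  funext n σ
  simp only [opFun, opTilde_smul_right, Pi.smul_apply, Finset.smul_sum]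

lemma eps_of_ne {n : ℕ} (h : n ≠ 1) : (eps x : Coch R X) n = 0 := by
  funext σ
  simp [eps, h]

/-- A sequence with short gaps cannot reach far. -/
lemma gap_bound {n j L : ℕ} (g : Fin (j + 1) ↪o Fin (n + 1)) (h0 : g 0 = 0)
    (hg : ∀ q : Fin j, (g q.succ : ℕ) - g q.castSucc ≤ L) (i : Fin (j + 1)) :
    (g i : ℕ) ≤ i * L := by
  induction i using Fin.induction with
  | zero => simp [h0]
  | succ q ih =>
    have h1 := hg q
    have h2 : (q.castSucc : ℕ) = q := rfl
    have h3 : (q.succ : ℕ) = q + 1 := rfl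
    rw [h2] at ih
    rw [h3, Nat.succ_mul]
    omega

lemma opFun_mem {k : ℕ} {a : Fin k → Coch R X} {a₀ : Coch R X} (ha : ∀ i, a i ∈ posCochains R x)
    (h₀ : a₀ ∈ cochains R x) : opFun x k a a₀ ∈ cochains R x := by
  constructor
  · obtain ⟨⟨N, hN⟩, -⟩ := h₀
    choose M hM using fun i => (ha i).1.1
    set L := 1 + ∑ i, M i with hL
    refine ⟨N * L + 1, fun n hn => ?_⟩
    funext σ
    refine Finset.sum_eq_zero fun j _ => Finset.sum_eq_zero fun f _ =>
      Finset.sum_eq_zero fun g _ => ?_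
    split_ifs with hg
    swap
    · rfl
    rcases le_or_gt N j with hj | hj
    · rw [hN j hj, Pi.zero_apply, mul_zero]
    · by_cases hgap : ∀ q : Fin j, (g q.succ : ℕ) - g q.castSucc ≤ L
      · have h1 := gap_bound g hg.1 hgap (Fin.last j)
        rw [hg.2, Fin.val_last, Fin.val_last] at h1
        have h2 : j * L ≤ N * L := Nat.mul_le_mul_right L hj.le
        omega
      · push Not at hgap
        obtain ⟨q, hq⟩ := hgap
        rw [Finset.prod_eq_zero (Finset.mem_univ q), mul_zero, zero_mul]
        by_cases hl : ∃ l, f l = q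
        · obtain ⟨l, rfl⟩ := hl
          rw [f.injective.extend_apply, hM l, Pi.zero_apply]
          have : M l ≤ ∑ i, M i := Finset.single_le_sum (fun _ _ => Nat.zero_le _)
            (Finset.mem_univ l)
          omega
        · rw [Function.extend_apply' _ _ _ hl, eps_of_ne (by omega), Pi.zero_apply]
  · intro n hn
    refine Finset.sum_eq_zero fun j _ => Finset.sum_eq_zero fun f _ =>
      Finset.sum_eq_zero fun g _ => ?_
    split_ifs with hg
    swap
    · rfl
    rcases Nat.eq_zero_or_pos j with rfl | hj
    · exfalso
      have h1 := hg.1.symm.trans hg.2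
      have := congrArg Fin.val h1
      simp at this
      omega
    · rw [subface_const, h₀.2 j hj, mul_zero]

lemma opFun_mem_pos {k : ℕ} {a : Fin k → Coch R X} {a₀ : Coch R X}
    (ha : ∀ i, a i ∈ posCochains R x) (h₀ : a₀ ∈ posCochains R x) :
    opFun x k a a₀ ∈ posCochains R x := by
  refine ⟨opFun_mem ha h₀.1, ?_⟩
  rw [SetLike.mem_coe, LinearMap.mem_ker, LinearMap.proj_apply]
  funext σ
  refine Finset.sum_eq_zero fun j hj => Finset.sum_eq_zero fun f _ =>
    Finset.sum_eq_zero fun g _ => ?_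
  obtain rfl : j = 0 := by simpa using hj
  have h0 : a₀ 0 = 0 := h₀.2
  simp [h0]

variable (R x)

/-- The operation `E_{k,1}` with last argument in `C^*(X)`. -/
def opE (k : ℕ) : MultilinearMap R (fun _ : Fin k => Cbar R x) (C R x →ₗ[R] C R x) where
  toFun a :=
    { toFun := fun b => ⟨opFun x k (fun i => (a i).1) b.1, opFun_mem (fun i => (a i).2) b.2⟩
      map_add' := fun _ _ => Subtype.ext (opFun_add_right _ _ _)
      map_smul' := fun _ _ => Subtype.ext (opFun_smul_right _ _ _) }
  map_update_add' {inst} a i u v := by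
    obtain rfl := Subsingleton.elim inst (instDecidableEqFin k)
    refine LinearMap.ext fun b => Subtype.ext ?_
    have h : ∀ w : Cbar R x, (fun l => (Function.update a i w l).1)
        = Function.update (fun l => (a l).1) i w.1 := fun w => by
      funext l; rcases eq_or_ne l i with rfl | h <;> simp [*]
    simp only [LinearMap.coe_mk, AddHom.coe_mk, LinearMap.add_apply, Submodule.coe_add, h,
      opFun_update_add]
  map_update_smul' {inst} a i r u := by
    obtain rfl := Subsingleton.elim inst (instDecidableEqFin k)
    refine LinearMap.ext fun b => Subtype.ext ?_
    have h : ∀ w : Cbar R x, (fun l => (Function.update a i w l).1)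
        = Function.update (fun l => (a l).1) i w.1 := fun w => by
      funext l; rcases eq_or_ne l i with rfl | h <;> simp [*]
    simp only [LinearMap.coe_mk, AddHom.coe_mk, LinearMap.smul_apply, Submodule.coe_smul, h,
      opFun_update_smul]

/-- The operation `E_{k,1}` with all arguments of positive degree. -/
def opEBar (k : ℕ) : MultilinearMap R (fun _ : Fin k => Cbar R x) (Cbar R x →ₗ[R] Cbar R x) where
  toFun a :=
    { toFun := fun b => ⟨opFun x k (fun i => (a i).1) b.1, opFun_mem_pos (fun i => (a i).2) b.2⟩
      map_add' := fun _ _ => Subtype.ext (opFun_add_right _ _ _)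
      map_smul' := fun _ _ => Subtype.ext (opFun_smul_right _ _ _) }
  map_update_add' {inst} a i u v := by
    obtain rfl := Subsingleton.elim inst (instDecidableEqFin k)
    refine LinearMap.ext fun b => Subtype.ext ?_
    have h : ∀ w : Cbar R x, (fun l => (Function.update a i w l).1)
        = Function.update (fun l => (a l).1) i w.1 := fun w => by
      funext l; rcases eq_or_ne l i with rfl | h <;> simp [*]
    simp only [LinearMap.coe_mk, AddHom.coe_mk, LinearMap.add_apply, Submodule.coe_add, h,
      opFun_update_add]
  map_update_smul' {inst} a i r u := by
    obtain rfl := Subsingleton.elim inst (instDecidableEqFin k)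
    refine LinearMap.ext fun b => Subtype.ext ?_
    have h : ∀ w : Cbar R x, (fun l => (Function.update a i w l).1)
        = Function.update (fun l => (a l).1) i w.1 := fun w => by
      funext l; rcases eq_or_ne l i with rfl | h <;> simp [*]
    simp only [LinearMap.coe_mk, AddHom.coe_mk, LinearMap.smul_apply, Submodule.coe_smul, h,
      opFun_update_smul]

/-! ### Linear maps out of a tensor algebra, defined by recursion on words -/

section WordRec

variable {R} {M W : Type*} [AddCommGroup M] [Module R M] [AddCommGroup W] [Module R W]

/-- Auxiliary operator for `wordRec`. -/
def wordRecStep (step : M →ₗ[R] (TensorAlgebra R M × W →ₗ[R] W)) :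
    M →ₗ[R] Module.End R (TensorAlgebra R M × W) where
  toFun v := LinearMap.prod
    (LinearMap.mulLeft R (TensorAlgebra.ι R v) ∘ₗ LinearMap.fst R _ _) (step v)
  map_add' u v := by ext <;> simp [add_mul]
  map_smul' r v := by ext <;> simp

/-- The linear map `F` on `T(M)` with `F [] = w₀` and `F [v|y] = step v (y, F y)`. -/
def wordRec (w₀ : W) (step : M →ₗ[R] (TensorAlgebra R M × W →ₗ[R] W)) :
    TensorAlgebra R M →ₗ[R] W where
  toFun y := (TensorAlgebra.lift R (wordRecStep step) y (1, w₀)).2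
  map_add' y z := by simp
  map_smul' r y := by simp

lemma wordRec_one (w₀ : W) (step : M →ₗ[R] (TensorAlgebra R M × W →ₗ[R] W)) :
    wordRec w₀ step 1 = w₀ := by
  simp [wordRec]

lemma lift_wordRecStep_fst (step : M →ₗ[R] (TensorAlgebra R M × W →ₗ[R] W))
    (y : TensorAlgebra R M) :
    ∀ s, (TensorAlgebra.lift R (wordRecStep step) y s).1 = y * s.1 := by
  induction y using TensorAlgebra.induction with
  | algebraMap r => intro s; simp [Algebra.smul_def]
  | ι v => intro s; simp [wordRecStep]
  | mul a b ha hb => intro s; simp [ha, hb, mul_assoc]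
  | add a b ha hb => intro s; simp [ha, hb, add_mul]

lemma wordRec_cons (w₀ : W) (step : M →ₗ[R] (TensorAlgebra R M × W →ₗ[R] W)) (v : M)
    (y : TensorAlgebra R M) :
    wordRec w₀ step (TensorAlgebra.ι R v * y) = step v (y, wordRec w₀ step y) := by
  have h : TensorAlgebra.lift R (wordRecStep step) y (1, w₀) = (y, wordRec w₀ step y) :=
    Prod.ext (by simp [lift_wordRecStep_fst]) rfl
  change (TensorAlgebra.lift R (wordRecStep step) (TensorAlgebra.ι R v * y) (1, w₀)).2 = _
  rw [map_mul, Module.End.mul_apply, h, TensorAlgebra.lift_ι_apply]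
  rfl

variable (R M)

/-- Deconcatenation `[v₁|…|vₙ] ↦ ∑ [v₁|…|v_i] ⊗ [v_{i+1}|…|vₙ]`. -/
def deconcat : TensorAlgebra R M →ₗ[R] TensorAlgebra R M ⊗[R] TensorAlgebra R M :=
  wordRec (1 ⊗ₜ 1)
    { toFun := fun v => LinearMap.coprod
        (TensorProduct.mk R _ _ 1 ∘ₗ LinearMap.mulLeft R (TensorAlgebra.ι R v))
        (LinearMap.rTensor _ (LinearMap.mulLeft R (TensorAlgebra.ι R v)))
      map_add' := fun u v => by
        ext <;> simp [add_mul, TensorProduct.add_tmul, TensorProduct.tmul_add]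
      map_smul' := fun r v => by ext <;> simp [TensorProduct.smul_tmul'] }

/-- Splitting off the first letter: `[] ↦ 0` and `[v|y] ↦ v ⊗ y`. -/
def uncons : TensorAlgebra R M →ₗ[R] M ⊗[R] TensorAlgebra R M :=
  wordRec 0
    { toFun := fun v => TensorProduct.mk R _ _ v ∘ₗ LinearMap.fst R _ _
      map_add' := fun u v => by ext <;> simp
      map_smul' := fun r v => by ext <;> simp [TensorProduct.smul_tmul'] }

variable {R M}

lemma deconcat_one : deconcat R M 1 = 1 ⊗ₜ 1 := wordRec_one _ _

lemma deconcat_cons (v : M) (y : TensorAlgebra R M) :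
    deconcat R M (TensorAlgebra.ι R v * y) = 1 ⊗ₜ (TensorAlgebra.ι R v * y)
      + LinearMap.rTensor _ (LinearMap.mulLeft R (TensorAlgebra.ι R v)) (deconcat R M y) := by
  unfold deconcat
  rw [wordRec_cons]
  simp

lemma deconcat_word (l : List M) :
    deconcat R M (l.map (TensorAlgebra.ι R)).prod = ∑ i ∈ Finset.range (l.length + 1),
      ((l.take i).map (TensorAlgebra.ι R)).prod ⊗ₜ ((l.drop i).map (TensorAlgebra.ι R)).prod := by
  induction l with
  | nil => simp [deconcat_one]
  | cons v l ih =>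
    rw [List.map_cons, List.prod_cons, deconcat_cons, ih, List.length_cons,
      Finset.sum_range_succ' _ (l.length + 1), map_sum, add_comm]
    simp

lemma uncons_one : uncons R M 1 = 0 := wordRec_one _ _

lemma uncons_cons (v : M) (y : TensorAlgebra R M) :
    uncons R M (TensorAlgebra.ι R v * y) = v ⊗ₜ y := by
  unfold uncons
  rw [wordRec_cons]
  rfl

end WordRec

/-! ### The product on the bar construction -/

/-- `x ↦ (-1)^|x| x` on the bar construction. -/
def signBar : Bar R x →ₐ[R] Bar R x :=
  TensorAlgebra.lift R (TensorAlgebra.ι R ∘ₗ invBar R x)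

/-- The components of `ā` with `|ā|` even if `e = 0`, and with `|ā|` odd if `e = 1`. -/
def parityPart (e : Fin 2) : Cbar R x →ₗ[R] Cbar R x where
  toFun a := ⟨fun n => if n % 2 = e then 0 else a.1 n, by
    obtain ⟨a, ⟨⟨N, hN⟩, ha⟩, h0⟩ := a
    have h0' : a 0 = 0 := h0
    refine ⟨⟨⟨N, fun n hn => ?_⟩, fun n hn => ?_⟩, ?_⟩
    · simp [hN n hn]
    · by_cases h : n % 2 = e
      · simp [h]
      · simp [h, ha n hn]
    · rw [SetLike.mem_coe, LinearMap.mem_ker, LinearMap.proj_apply]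
      simp [h0']⟩
  map_add' a b := by ext n σ; by_cases h : n % 2 = e <;> simp [h]
  map_smul' r a := by ext n σ; by_cases h : n % 2 = e <;> simp [h]

/-- `E([ā₁|…|ā_k] ⊗ [b̄]) = E_{k,1}(a₁, …, a_k; b)`, as a linear map on the bar construction. -/
def opBar : Bar R x →ₗ[R] Cbar R x →ₗ[R] Cbar R x :=
  DirectSum.toModule R ℕ _ (fun k => PiTensorProduct.lift (opEBar R x k)) ∘ₗ
    TensorAlgebra.toDirectSum.toLinearMap

lemma opBar_tprod (k : ℕ) (a : Fin k → Cbar R x) :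
    opBar R x (TensorAlgebra.tprod R _ k a) = opEBar R x k a := by
  unfold opBar
  rw [LinearMap.comp_apply, AlgHom.toLinearMap_apply,
    TensorAlgebra.toDirectSum_tensorPower_tprod]
  erw [DirectSum.toModule_lof]
  exact PiTensorProduct.lift.tprod a

/-- Convolution `(f ⋆ g)(x) = ∑ f(x') g(x'')` over the deconcatenations of `x`. -/
def conv : (Bar R x →ₗ[R] Bar R x) →ₗ[R] (Bar R x →ₗ[R] Bar R x) →ₗ[R] (Bar R x →ₗ[R] Bar R x) :=
  LinearMap.mk₂ R (fun f g => LinearMap.mul' R _ ∘ₗ TensorProduct.map f g ∘ₗ deconcat R _)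
    (fun f f' g => by rw [TensorProduct.map_add_left]; ext; simp)
    (fun r f g => by rw [TensorProduct.map_smul_left]; ext; simp)
    (fun f g g' => by rw [TensorProduct.map_add_right]; ext; simp)
    (fun r f g => by rw [TensorProduct.map_smul_right]; ext; simp)

/-- `u ↦ [E(u ⊗ [b̄])]`. -/
def opBarι : Cbar R x →ₗ[R] (Bar R x →ₗ[R] Bar R x) :=
  LinearMap.llcomp R _ _ _ (TensorAlgebra.ι R) ∘ₗ (opBar R x).flip

/-- The product on the bar construction, i.e. the comultiplicative extension
`BC^*(X) ⊗ BC^*(X) → BC^*(X)` of the operations `E_{1,0} = id` and `E_{k,1}`, in recursive form: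
`x ∘ [] = x` and
`x ∘ [b̄|y] = ∑ (-1)^{|b̄||x₃|} x₁ · [E(x₂ ⊗ [b̄])] · (x₃ ∘ y)`,
the sum over all deconcatenations of `x` into three words `x₁, x₂, x₃`. -/
def barMul : Bar R x →ₗ[R] Bar R x →ₗ[R] Bar R x :=
  (wordRec (W := Bar R x →ₗ[R] Bar R x) LinearMap.id
    (LinearMap.mk₂ R (fun (b : Cbar R x) s =>
        conv R x LinearMap.id (conv R x (opBarι R x (parityPart R x 0 b)) s.2)
        + conv R x LinearMap.id
            (conv R x (opBarι R x (parityPart R x 1 b)) (s.2 ∘ₗ (signBar R x).toLinearMap)))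
      (fun b b' s => by simp only [map_add, LinearMap.add_apply]; abel)
      (fun r b s => by simp only [map_smul, LinearMap.smul_apply, smul_add])
      (fun b s s' => by
        simp only [Prod.snd_add, LinearMap.add_comp, map_add]; abel)
      (fun r b s => by
        simp only [Prod.smul_snd, LinearMap.smul_comp, map_smul, smul_add]))).flip

/-! ### The differential of the acyclic bar construction -/

/-- The differential of the bar construction,
`[ā₁|…|āₙ] ↦ -∑ᵢ (-1)^{εᵢ} [ā₁|…|\overline{daᵢ}|…|āₙ]
  - ∑_{i ≥ 2} (-1)^{εᵢ} [ā₁|…|\overline{aᵢ₋₁aᵢ}|…|āₙ]` with `εᵢ = ∑_{j<i} |āⱼ|`,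
in recursive form. -/
def barD : Bar R x →ₗ[R] Bar R x :=
  wordRec 0
    (LinearMap.mk₂ R (fun (v : Cbar R x) s =>
        -(TensorAlgebra.ι R (dCbar R x v) * s.1) + TensorAlgebra.ι R (invBar R x v) * s.2
        - LinearMap.mul' R _ (LinearMap.rTensor _
            (TensorAlgebra.ι R ∘ₗ cupBar R x (invBar R x v)) (uncons R _ s.1)))
      (fun v v' s => by
        simp only [map_add, LinearMap.comp_add, LinearMap.rTensor_add,
          LinearMap.add_apply, add_mul]
        abel)
      (fun r v s => by
        simp only [map_smul, LinearMap.comp_smul, LinearMap.rTensor_smul,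
          LinearMap.smul_apply, smul_mul_assoc, smul_sub, smul_add, smul_neg])
      (fun v s s' => by
        simp only [Prod.fst_add, Prod.snd_add, map_add, mul_add]
        abel)
      (fun r v s => by
        simp only [Prod.smul_fst, Prod.smul_snd, map_smul, mul_smul_comm, smul_sub, smul_add,
          smul_neg]))

/-- The differential of the acyclic bar construction `C^*(X) ⊗ B C^*(X)`: the tensor differential
twisted by the universal twisting cochain, with the signs
`d(a₀ ⊗ [ā₁|…|āₙ]) = da₀ ⊗ [ā₁|…|āₙ] - (-1)^{|a₀|} a₀ ⊗ d[ā₁|…|āₙ]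
  + (-1)^{|a₀| + |a₁|} a₀a₁ ⊗ [ā₂|…|āₙ]`. -/
def dABar : ABar R x →ₗ[R] ABar R x :=
  TensorProduct.map (dC R x) LinearMap.id - TensorProduct.map (inv R x) (barD R x)
    + TensorProduct.lift (LinearMap.mk₂ R
        (fun a y => LinearMap.rTensor (Bar R x)
          (cup R x (inv R x a) ∘ₗ inv R x ∘ₗ incl R x) (uncons R (Cbar R x) y))
        (fun a a' y => by
          simp only [map_add, LinearMap.add_comp, LinearMap.rTensor_add, LinearMap.add_apply])
        (fun r a y => by
          simp only [map_smul, LinearMap.smul_comp, LinearMap.rTensor_smul, LinearMap.smul_apply])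
        (fun a y y' => by simp only [map_add])
        (fun r a y => by simp only [map_smul]))

/-- The elements of total degree `N` in the acyclic bar construction. -/
def gradeABar (N : ℕ) : Submodule R (ABar R x) :=
  Submodule.span R {z | ∃ (q n : ℕ) (p : Fin n → ℕ) (a₀ : C R x) (a : Fin n → Cbar R x),
    IsHomog q a₀.1 ∧ (∀ i, IsHomog (p i + 1) (a i).1) ∧ q + ∑ i, p i = N ∧
    z = a₀ ⊗ₜ TensorAlgebra.tprod R _ n a}

/-- The axioms of a differential graded algebra for a bilinear product `μ` with unit `e` and a
linear map `d` on a module `B` with homogeneous parts `deg N`. -/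
structure IsDGA {R B : Type*} [CommRing R] [AddCommGroup B] [Module R B]
    (deg : ℕ → Submodule R B) (d : B →ₗ[R] B) (e : B) (μ : B →ₗ[R] B →ₗ[R] B) : Prop where
  one_mem : e ∈ deg 0
  mul_mem : ∀ {i j : ℕ} {a b : B}, a ∈ deg i → b ∈ deg j → μ a b ∈ deg (i + j)
  one_mul : ∀ a, μ e a = a
  mul_one : ∀ a, μ a e = a
  mul_assoc : ∀ a b c, μ (μ a b) c = μ a (μ b c)
  d_mem : ∀ {i : ℕ} {a : B}, a ∈ deg i → d a ∈ deg (i + 1)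
  d_d : ∀ a, d (d a) = 0
  leibniz : ∀ {i : ℕ} {a : B} (b : B), a ∈ deg i → d (μ a b) = μ (d a) b + (-1 : R) ^ i • μ a (d b)

variable {R x}

lemma conv_word (f g : Bar R x →ₗ[R] Bar R x) (l : List (Cbar R x)) :
    conv R x f g (l.map (TensorAlgebra.ι R)).prod = ∑ i ∈ Finset.range (l.length + 1),
      f ((l.take i).map (TensorAlgebra.ι R)).prod * g ((l.drop i).map (TensorAlgebra.ι R)).prod := by
  simp [conv, deconcat_word]

lemma signBar_signBar (y : Bar R x) : signBar R x (signBar R x y) = y := by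
  have h : (signBar R x).comp (signBar R x) = AlgHom.id R _ := by
    refine TensorAlgebra.hom_ext (LinearMap.ext fun v => ?_)
    have hv : invBar R x (invBar R x v) = v := by
      ext n σ
      simp [invBar, ← mul_assoc, ← mul_pow]
    simp [signBar, hv]
  exact DFunLike.congr_fun h y

/-- The recursion for the product with a homogeneous `b̄` of degree `q`; note that
`signBar^[q]` multiplies an element of degree `d` by `(-1)^(q * d)`. -/
lemma barMul_cons {q : ℕ} {b : Cbar R x} (hb : IsHomog (q + 1) b.1) (l : List (Cbar R x))
    (y : Bar R x) :
    barMul R x (l.map (TensorAlgebra.ι R)).prod (TensorAlgebra.ι R b * y) =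
      ∑ i ∈ Finset.range (l.length + 1), ∑ j ∈ Finset.range ((l.drop i).length + 1),
        ((l.take i).map (TensorAlgebra.ι R)).prod *
        (TensorAlgebra.ι R (opBar R x (((l.drop i).take j).map (TensorAlgebra.ι R)).prod b) *
        barMul R x ((signBar R x)^[q] (((l.drop i).drop j).map (TensorAlgebra.ι R)).prod) y) := by
  have key : barMul R x (l.map (TensorAlgebra.ι R)).prod (TensorAlgebra.ι R b * y) =
      conv R x LinearMap.id (conv R x (opBarι R x (parityPart R x 0 b)) ((barMul R x).flip y))
        (l.map (TensorAlgebra.ι R)).prod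
      + conv R x LinearMap.id (conv R x (opBarι R x (parityPart R x 1 b))
          ((barMul R x).flip y ∘ₗ (signBar R x).toLinearMap)) (l.map (TensorAlgebra.ι R)).prod := by
    rw [barMul, LinearMap.flip_apply, wordRec_cons]
    rfl
  have h0 : ∀ n, n ≠ q + 1 → b.1 n = 0 := hb
  rw [key]
  simp only [conv_word, ← Finset.sum_add_distrib, ← mul_add]
  refine Finset.sum_congr rfl fun i _ => ?_
  rw [← Finset.mul_sum]
  simp only [LinearMap.id_apply]
  congr 1
  refine Finset.sum_congr rfl fun j _ => ?_
  rcases Nat.even_or_odd q with hq | hq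
  · have he : parityPart R x 0 b = b := by
      refine Subtype.ext (funext fun n => ?_)
      rcases eq_or_ne n (q + 1) with rfl | hn
      · have : (q + 1) % 2 = 1 := by rcases hq with ⟨k, rfl⟩; omega
        simp [parityPart, this]
      · simp [parityPart, h0 n hn]
    have ho : parityPart R x 1 b = 0 := by
      refine Subtype.ext (funext fun n => ?_)
      rcases eq_or_ne n (q + 1) with rfl | hn
      · have : (q + 1) % 2 = 1 := by rcases hq with ⟨k, rfl⟩; omega
        simp [parityPart, this]
      · simp [parityPart, h0 n hn]
    obtain ⟨k, rfl⟩ := hq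
    have hs : ∀ z, (signBar R x)^[k + k] z = z := fun z => by
      rw [← two_mul, Function.iterate_mul]
      have : (signBar R x)^[2] = id := funext fun z => signBar_signBar z
      rw [this, Function.iterate_id, id]
    rw [he, ho, hs]
    simp [opBarι]
  · have he : parityPart R x 0 b = 0 := by
      refine Subtype.ext (funext fun n => ?_)
      rcases eq_or_ne n (q + 1) with rfl | hn
      · have : (q + 1) % 2 = 0 := by rcases hq with ⟨k, rfl⟩; omega
        simp [parityPart, this]
      · simp [parityPart, h0 n hn]
    have ho : parityPart R x 1 b = b := by
      refine Subtype.ext (funext fun n => ?_)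
      rcases eq_or_ne n (q + 1) with rfl | hn
      · have : (q + 1) % 2 = 0 := by rcases hq with ⟨k, rfl⟩; omega
        simp [parityPart, this]
      · simp [parityPart, h0 n hn]
    obtain ⟨k, rfl⟩ := hq
    have hs : ∀ z, (signBar R x)^[2 * k + 1] z = signBar R x z := fun z => by
      rw [Function.iterate_succ_apply, Function.iterate_mul]
      have : (signBar R x)^[2] = id := funext fun z => signBar_signBar z
      rw [this, Function.iterate_id, id]
    rw [he, ho, hs]
    simp [opBarι]

lemma barMul_nil (z : Bar R x) : barMul R x z 1 = z := by
  rw [barMul, LinearMap.flip_apply, wordRec_one, LinearMap.id_apply]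

lemma barD_cons (v : Cbar R x) (y : Bar R x) :
    barD R x (TensorAlgebra.ι R v * y) =
      -(TensorAlgebra.ι R (dCbar R x v) * y) + TensorAlgebra.ι R (invBar R x v) * barD R x y
        - LinearMap.mul' R _ (LinearMap.rTensor _
            (TensorAlgebra.ι R ∘ₗ cupBar R x (invBar R x v)) (uncons R _ y)) := by
  rw [barD, wordRec_cons]
  rfl

lemma dABar_cons (a : C R x) (v : Cbar R x) (y : Bar R x) :
    dABar R x (a ⊗ₜ (TensorAlgebra.ι R v * y)) =
      dC R x a ⊗ₜ (TensorAlgebra.ι R v * y) - inv R x a ⊗ₜ barD R x (TensorAlgebra.ι R v * y)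
        + cup R x (inv R x a) (inv R x (incl R x v)) ⊗ₜ y := by
  simp [dABar, uncons_cons]

end AcyclicBar

end

/-! Every cochain is evaluated on the faces of one simplex σ, a face being recorded by its list of
vertices. On functionals of lists the coboundary becomes `ldel` and the cup product `lcup`
(`ev_coboundary`, `ev_cup`), and identities are proved by peeling off the first vertex.

In this language the operations are expansions. `lexp ψ f l` sums, over all sublists S of l that
contain both ends, the ordered product of ψ over the gaps of S, times f S. For ψ = `psi σ` the
values are operators on the bar construction: a gap either consumes the next letter of the word,
evaluating it on the gap, or, if it is an edge, is filled with ε. A sign involution on the remaining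
word then produces the exponents (q-1)(m_q-1). The cochain ε counts every edge with weight 1 because
all 1-simplices of Sing¹ are constant. With this choice E_{k,1} is the augmentation of an expansion
(`ev_opFun`, `ev_opC`).

Three properties of expansions give three identities for the operations. Cutting a chosen sublist is
the same as choosing sublists of two pieces (`lexp_lcup`); hence E(x; bc) = ∑ ± E(x'; b) E(x''; c),
which is `opF_cup`. An expansion of an expansion is an expansion over a product of words
(`augAt_rmul`); hence E(z ∘ y; c) = E(z; E(y; c)), which is `opC_barMul`. The bar differential can
be moved through the gaps (`lexp_comm`); this gives the coboundary of E(x; b) in `dC_opF`, with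
terms for db, for the differential of x, and for the first and the last letter of x.

For the product on the bar construction, the first letter of x ∘ [b|y] is either an operation on b
or the first letter of x. This is a recursion for right multiplication (`rmul_letter_rec`), and such
recursions have unique solutions (`cv_letter_unique`). Associativity (`rmul_comp_rmul`) and the
Leibniz rule for the bar differential (`barD_comp_rmul_hword`) hold since both sides solve the same
recursion. The inputs are comultiplicativity of the product (`deconcat_rmul`) and the three
identities above.

On C ⊗ BC product and differential are compatible with the left action of C, so the first factor may
be taken to be 1 ⊗ t. Associativity then follows from `opF_cup`, `opC_barMul` and associativity of ∘
(`mulA_comp_wordMul`). The Leibniz rule follows from `dC_opF`, where the first-letter term comes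
from the twist of the left factor and the last-letter term cancels against the twist of the product
(`dABar_wordMul`). Uniqueness holds because tensors of homogeneous cochains and words span. -/

noncomputable section

namespace AcyclicBar

/-! ### Functionals on vertex lists -/

section ListCalculus

variable {V A S : Type*} [Ring A] [CommRing S] [Algebra S A]

/-- The functional `l ↦ F (v :: l)`. -/
def lder (v : V) {B : Type*} (F : List V → B) : List V → B := fun l => F (v :: l)

@[simp] lemma lder_apply {B : Type*} (v : V) (F : List V → B) (l : List V) :
    lder v F l = F (v :: l) := rfl

/-- The cup product of functionals on vertex lists: the sum over all ways to cut a list at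
one of its members, which then belongs to both pieces. -/
def lcup (F G : List V → A) (l : List V) : A :=
  match l with
  | [] => 0
  | v :: l => F [v] * G (v :: l) + lcup (lder v F) G l

/-- The alternating sum over the removal of one member of a list. -/
def ldel (F : List V → A) (l : List V) : A :=
  match l with
  | [] => 0
  | v :: l => F l - ldel (lder v F) l

/-- The functional that is `1` on lists of length `n`. -/
def lunit (n : ℕ) : List V → A := fun l => if l.length = n then 1 else 0

/-- The sign twist `l ↦ (-1)^(length l) F l`. -/
def lsgn (F : List V → A) : List V → A := fun l => (-1 : ℤ) ^ l.length • F l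

@[simp] lemma lcup_nil (F G : List V → A) : lcup F G [] = 0 := by rw [lcup]
lemma lcup_cons (F G : List V → A) (v : V) (l : List V) :
    lcup F G (v :: l) = F [v] * G (v :: l) + lcup (lder v F) G l := by rw [lcup]
@[simp] lemma ldel_nil (F : List V → A) : ldel F [] = 0 := by rw [ldel]
lemma ldel_cons (F : List V → A) (v : V) (l : List V) :
    ldel F (v :: l) = F l - ldel (lder v F) l := by rw [ldel]

/-- The cut member belongs to both pieces, so the factors only see non-empty initial and non-empty
final pieces. -/
lemma lcup_congr {F F' G G' : List V → A} {l : List V}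
    (hF : ∀ m, m <+: l → m ≠ [] → F m = F' m) (hG : ∀ m, m <:+ l → m ≠ [] → G m = G' m) :
    lcup F G l = lcup F' G' l := by
  induction l generalizing F F' with
  | nil => simp
  | cons v l ih =>
    rw [lcup_cons, lcup_cons, hF [v] (by simp) (by simp), hG _ List.suffix_rfl (by simp)]
    congr 1
    refine ih (fun m hm hm' => hF _ (by simpa using hm) (by simp))
      (fun m hm hm' => hG m (hm.trans (List.suffix_cons v l)) hm')

lemma lcup_add_left (F F' G : List V → A) : lcup (F + F') G = lcup F G + lcup F' G := by
  funext l
  induction l generalizing F F' with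
  | nil => simp
  | cons v l ih =>
    have h : lder v (F + F') = lder v F + lder v F' := rfl
    simp only [lcup_cons, Pi.add_apply, h, ih]
    noncomm_ring

lemma lcup_add_right (F G G' : List V → A) : lcup F (G + G') = lcup F G + lcup F G' := by
  funext l
  induction l generalizing F with
  | nil => simp
  | cons v l ih =>
    simp only [lcup_cons, Pi.add_apply, ih]
    noncomm_ring

lemma lcup_mul_left (a : A) (F G : List V → A) :
    lcup (fun m => a * F m) G = fun l => a * lcup F G l := by
  funext l
  induction l generalizing F with
  | nil => simp
  | cons v l ih =>
    have h : lder v (fun m => a * F m) = fun m => a * lder v F m := rfl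
    simp only [lcup_cons, h, ih, mul_add, mul_assoc]

lemma lcup_mul_right (a : A) (F G : List V → A) :
    lcup F (fun m => G m * a) = fun l => lcup F G l * a := by
  funext l
  induction l generalizing F with
  | nil => simp
  | cons v l ih =>
    simp only [lcup_cons, ih, add_mul, mul_assoc]

/-- The values do not commute; this is how an operator that has passed the first factor is handed on
to the second. -/
lemma lcup_mul_mid (a : A) (F G : List V → A) :
    lcup (fun m => F m * a) G = lcup F (fun m => a * G m) := by
  funext l
  induction l generalizing F with
  | nil => simp
  | cons v l ih =>
    have h : lder v (fun m => F m * a) = fun m => lder v F m * a := rfl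
    simp only [lcup_cons, h, ih, mul_assoc]

lemma lcup_smul_left (r : S) (F G : List V → A) : lcup (r • F) G = r • lcup F G := by
  have := lcup_mul_left (algebraMap S A r) F G
  simp only [← Algebra.smul_def] at this
  exact this

lemma lcup_smul_right (r : S) (F G : List V → A) : lcup F (r • G) = r • lcup F G := by
  have := lcup_mul_right (algebraMap S A r) F G
  simp only [← Algebra.commutes, ← Algebra.smul_def] at this
  exact this

lemma lcup_neg_left (F G : List V → A) : lcup (-F) G = -lcup F G := by
  have := lcup_smul_left (-1 : ℤ) F G
  simpa using this

lemma lcup_neg_right (F G : List V → A) : lcup F (-G) = -lcup F G := by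
  have := lcup_smul_right (-1 : ℤ) F G
  simpa using this

lemma lcup_sub_left (F F' G : List V → A) : lcup (F - F') G = lcup F G - lcup F' G := by
  rw [sub_eq_add_neg, lcup_add_left, lcup_neg_left, sub_eq_add_neg]

lemma lcup_sub_right (F G G' : List V → A) : lcup F (G - G') = lcup F G - lcup F G' := by
  rw [sub_eq_add_neg, lcup_add_right, lcup_neg_right, sub_eq_add_neg]

lemma lcup_zero_left (G : List V → A) : lcup 0 G = 0 := by
  have := lcup_smul_left (0 : ℤ) 0 G
  simpa using this

lemma lder_lcup (v : V) (F G : List V → A) :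
    lder v (lcup F G) = (fun m => F [v] * lder v G m) + lcup (lder v F) G := by
  funext m
  simp [lcup_cons]

lemma lcup_assoc (F G H : List V → A) : lcup (lcup F G) H = lcup F (lcup G H) := by
  funext l
  induction l generalizing F with
  | nil => simp
  | cons v l ih =>
    rw [lcup_cons, lder_lcup, lcup_add_left, lcup_mul_left, Pi.add_apply, ih, lcup_cons F,
      lcup_cons F, lcup_cons G]
    simp only [lcup_nil, add_zero, mul_add, mul_assoc, add_assoc]

lemma lder_lunit (v : V) (n : ℕ) : lder v (lunit (n + 1) : List V → A) = lunit n := by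
  funext l
  simp [lunit]

lemma lunit_one_lcup (F : List V → A) {l : List V} (hl : l ≠ []) :
    lcup (lunit 1) F l = F l := by
  obtain ⟨v, l, rfl⟩ := List.exists_cons_of_ne_nil hl
  rw [lcup_cons, show (1 : ℕ) = 0 + 1 from rfl, lder_lunit]
  have h : lcup (lunit 0) F l = lcup 0 F l :=
    lcup_congr (fun m _ hm => by simp [lunit, hm]) (fun _ _ _ => rfl)
  rw [h, lcup_zero_left]
  simp [lunit]

/-- `lunit 2` is the list form of ε. The only cut that leaves a first piece with two members is at
w, so cupping with it removes the first vertex. -/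
lemma lunit_two_lcup (F : List V → A) (v w : V) (l : List V) :
    lcup (lunit 2) F (v :: w :: l) = F (w :: l) := by
  rw [lcup_cons, show (2 : ℕ) = 1 + 1 from rfl, lder_lunit, lunit_one_lcup _ (by simp)]
  simp [lunit]

lemma lsgn_cons (F : List V → A) (v : V) (l : List V) :
    lsgn F (v :: l) = -lsgn (lder v F) l := by
  simp [lsgn, pow_succ]

lemma lder_lsgn (F : List V → A) (v : V) : lder v (lsgn F) = -lsgn (lder v F) := by
  funext l
  exact lsgn_cons F v l

lemma lsgn_add (F G : List V → A) : lsgn (F + G) = lsgn F + lsgn G := by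
  funext l; simp [lsgn]

lemma lsgn_neg (F : List V → A) : lsgn (-F) = -lsgn F := by
  funext l; simp [lsgn]

lemma lsgn_sub (F G : List V → A) : lsgn (F - G) = lsgn F - lsgn G := by
  rw [sub_eq_add_neg, lsgn_add, lsgn_neg, sub_eq_add_neg]

lemma lsgn_lsgn (F : List V → A) : lsgn (lsgn F) = F := by
  funext l
  rw [lsgn, lsgn, smul_smul, ← mul_pow]
  simp

lemma lsgn_lunit_two : lsgn (lunit 2 : List V → A) = lunit 2 := by
  funext l
  by_cases h : l.length = 2 <;> simp [lsgn, lunit, h]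

lemma lsgn_mul_right (F : List V → A) (a : A) :
    lsgn (fun l => F l * a) = fun l => lsgn F l * a := by
  funext l; simp only [lsgn, smul_mul_assoc]

lemma lsgn_singleton (F : List V → A) (v : V) : lsgn F [v] = -F [v] := by
  simp [lsgn]

/-- The two pieces share the cut member, so their lengths add up to one more than the length of the
list. -/
lemma lcup_lsgn (F G : List V → A) : lcup (lsgn F) (lsgn G) = -lsgn (lcup F G) := by
  funext l
  induction l generalizing F with
  | nil => simp [lsgn]
  | cons v l ih =>
    rw [lcup_cons, lder_lsgn, lcup_neg_left, Pi.neg_apply, ih, Pi.neg_apply, neg_neg,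
      Pi.neg_apply, lsgn_cons (lcup F G), lder_lcup, lsgn_add, Pi.add_apply, lsgn_singleton,
      lsgn_cons G]
    simp only [lsgn, lder_apply, mul_smul_comm, neg_mul, mul_neg, smul_neg, neg_neg]

lemma ldel_add (F G : List V → A) : ldel (F + G) = ldel F + ldel G := by
  funext l
  induction l generalizing F G with
  | nil => simp
  | cons v l ih =>
    have h : lder v (F + G) = lder v F + lder v G := rfl
    simp only [ldel_cons, h, ih, Pi.add_apply]
    abel

lemma ldel_mul_left (a : A) (F : List V → A) :
    ldel (fun l => a * F l) = fun l => a * ldel F l := by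
  funext l
  induction l generalizing F with
  | nil => simp
  | cons v l ih =>
    have h : lder v (fun l => a * F l) = fun l => a * lder v F l := rfl
    simp only [ldel_cons, h, ih, mul_sub]

/-- Removing one member of a list with at least two members never leaves the empty list. -/
lemma ldel_congr {F G : List V → A} {l : List V} (hl : 2 ≤ l.length)
    (h : ∀ m, m.Sublist l → m ≠ [] → F m = G m) : ldel F l = ldel G l := by
  have aux : ∀ (l : List V) (F G : List V → A), (∀ m, m.Sublist l → m.length + 1 = l.length →
      F m = G m) → ldel F l = ldel G l := by
    intro l
    induction l with
    | nil => intros; simp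
    | cons v l ih =>
      intro F G h
      rw [ldel_cons, ldel_cons, h l (List.sublist_cons_self v l) rfl]
      congr 1
      exact ih _ _ fun m hm hm' => h _ (hm.cons_cons v) (by simp [hm'])
  refine aux l F G fun m hm hm' => h m hm ?_
  rintro rfl
  simp at hm'
  omega

lemma ldel_ldel (F : List V → A) : ldel (ldel F) = 0 := by
  funext l
  induction l generalizing F with
  | nil => simp
  | cons v l ih =>
    have h : lder v (ldel F) = F + -ldel (lder v F) := by
      funext m; simp [ldel_cons, sub_eq_add_neg]
    have h' : ∀ G : List V → A, ldel (-G) = -ldel G := fun G => by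
      have := ldel_mul_left (-1) G
      simp only [neg_mul, one_mul] at this
      exact this
    rw [ldel_cons, h, ldel_add, h', Pi.add_apply, Pi.neg_apply, ih]
    simp

/-- The Leibniz rule. -/
lemma ldel_lcup (F G : List V → A) (hG : G [] = 0) :
    ldel (lcup F G) = lcup (ldel F) G - lcup (lsgn F) (ldel G) - fun l => F [] * G l := by
  funext l
  induction l generalizing F with
  | nil => simp [hG]
  | cons v l ih =>
    have h : lder v (ldel F) = F - ldel (lder v F) := by
      funext m; simp [ldel_cons]
    rw [ldel_cons, lder_lcup, ldel_add, Pi.add_apply, ldel_mul_left, ih]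
    simp only [Pi.sub_apply, lcup_cons, h, lcup_sub_left, lder_lsgn, lcup_neg_left, Pi.neg_apply,
      ldel_cons, ldel_nil, sub_zero, lder_apply]
    simp only [lsgn, List.length_cons, List.length_nil]
    noncomm_ring

/-- The part of the coboundary that involves only interior members of a list, if `F [] = 0`. -/
def ldelInt (F : List V → A) : List V → A :=
  ldel F - lcup (lunit 2) F - lcup (lsgn F) (lunit 2) - fun l => F [] * lunit 1 l

/-- A removed interior member is interior to one of the two pieces, or would be the cut itself. The
latter never arises, so no correction with `F []` is left over from the Leibniz rule. -/
lemma ldelInt_lcup (F G : List V → A) (hG : G [] = 0) :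
    ldelInt (lcup F G) = lcup (ldelInt F) G - lcup (lsgn F) (ldelInt G) := by
  funext l
  rcases eq_or_ne l [] with rfl | hl
  · simp [ldelInt, lunit]
  have h1 : lcup (fun l => F [] * lunit 1 l) G l = F [] * G l := by
    rw [lcup_mul_left]
    simp only [lunit_one_lcup _ hl]
  have h2 : lcup (lsgn (lcup F G)) (lunit 2) = -lcup (lsgn F) (lcup (lsgn G) (lunit 2)) := by
    have := lcup_lsgn F G
    rw [← neg_eq_iff_eq_neg] at this
    rw [← this, lcup_neg_left, lcup_assoc]
  have h3 : (fun l : List V => G [] * (lunit 1 l : A)) = 0 := by funext l; simp [hG]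
  -- The last face of the first piece and the first face of the second piece meet at the cut and
  -- cancel.
  have h4 : lcup (lcup (lsgn F) (lunit 2)) G = lcup (lsgn F) (lcup (lunit 2) G) := lcup_assoc _ _ _
  simp only [ldelInt, ldel_lcup F G hG, lcup_sub_left, lcup_sub_right, h2, h3, h4, Pi.sub_apply,
    h1, lcup_nil, zero_mul, sub_zero, lcup_assoc, Pi.neg_apply]
  abel

/-- Behind v the first member of l becomes interior; its removal is the extra term with `lunit 2`.
-/
lemma lder_ldelInt (F : List V → A) (v : V) {l : List V} (hl : l ≠ []) :
    lder v (ldelInt F) l = -(ldelInt (lder v F) + lcup (lunit 2) (lder v F)) l := by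
  simp only [lder_apply, ldelInt, Pi.sub_apply, Pi.add_apply, ldel_cons, lcup_cons, lder_lsgn,
    lcup_neg_left, Pi.neg_apply]
  rw [show (2 : ℕ) = 1 + 1 from rfl, lder_lunit, lunit_one_lcup _ hl]
  simp [lunit, lsgn, hl]
  split_ifs <;> abel

end ListCalculus

end AcyclicBar

end

/-! ### Expansions over sublists -/

noncomputable section

namespace AcyclicBar

section Expansion

variable {V A S : Type*} [Ring A] [CommRing S] [Algebra S A]

/-- Auxiliary recursion for `lexp`. -/
def lexpAux (ψ φ : List V → A) (f : List V → S) (l : List V) : A :=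
  match l with
  | [] => 0
  | w :: l => φ [w] * ((if l = [] then algebraMap S A (f [w]) else 0)
      + lexpAux ψ (lder w ψ) (lder w f) l) + lexpAux ψ (lder w φ) f l

/-- The sum over all sublists `S` of `l` that contain both ends of `l`, of the ordered product of
the values of `ψ` on the gaps of `S`, times `f S`. -/
def lexp (ψ : List V → A) (f : List V → S) (l : List V) : A :=
  match l with
  | [] => 0
  | w :: l => (if l = [] then algebraMap S A (f [w]) else 0)
      + lexpAux ψ (lder w ψ) (lder w f) l

variable (ψ : List V → A)

/-- `lexpAux` is a cup product unrolled so that `lexp` can be defined by structural recursion; this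
undoes the unrolling. -/
lemma lexpAux_eq (φ : List V → A) (f : List V → S) : lexpAux ψ φ f = lcup φ (lexp ψ f) := by
  funext l
  induction l generalizing φ with
  | nil => rw [lexpAux, lcup_nil]
  | cons w l ih =>
    rw [lexpAux, lcup_cons, ih, lexp]

@[simp] lemma lexp_nil (f : List V → S) : lexp ψ f [] = 0 := by rw [lexp]

lemma lexp_cons' (f : List V → S) (v : V) (l : List V) :
    lexp ψ f (v :: l) = (if l = [] then algebraMap S A (f [v]) else 0)
      + lcup (lder v ψ) (lexp ψ (lder v f)) l := by
  rw [lexp, lexpAux_eq]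

@[simp] lemma lexp_singleton (f : List V → S) (v : V) :
    lexp ψ f [v] = algebraMap S A (f [v]) := by
  simp [lexp_cons']

/-- Induction over lists where the hypothesis covers all non-empty proper suffixes. -/
lemma list_suffix_induction {P : List V → Prop} (nil : P [])
    (cons : ∀ v l, (∀ m, m <:+ l → P m) → P (v :: l)) (l : List V) : P l := by
  induction h : l.length using Nat.strong_induction_on generalizing l with
  | _ n ih =>
    cases l with
    | nil => exact nil
    | cons v l =>
      refine cons v l fun m hm => ih _ ?_ m rfl
      have := hm.length_le
      simp at h
      omega

lemma lexp_congr {f g : List V → S} {l : List V} (h : ∀ m, m.Sublist l → m ≠ [] → f m = g m) :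
    lexp ψ f l = lexp ψ g l := by
  induction l using list_suffix_induction generalizing f g with
  | nil => simp
  | cons v l ih =>
    rw [lexp_cons', lexp_cons', h [v] (by simp) (by simp)]
    congr 1
    refine lcup_congr (fun _ _ _ => rfl) fun m hm _ => ih m hm fun m' hm' _ => ?_
    exact h _ ((hm'.trans hm.sublist).cons_cons v) (by simp)

lemma lexp_add (f g : List V → S) : lexp ψ (f + g) = lexp ψ f + lexp ψ g := by
  funext l
  induction l using list_suffix_induction generalizing f g with
  | nil => simp
  | cons v l ih =>
    have h : lder v (f + g) = lder v f + lder v g := rfl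
    have h' : lcup (lder v ψ) (lexp ψ (lder v f + lder v g)) l
        = lcup (lder v ψ) (lexp ψ (lder v f) + lexp ψ (lder v g)) l :=
      lcup_congr (fun _ _ _ => rfl) fun m hm _ => ih m hm _ _
    rw [Pi.add_apply, lexp_cons', lexp_cons', lexp_cons', h, h', lcup_add_right]
    split_ifs
    · simp
      abel
    · simp

lemma lexp_mul_left (r : S) (f : List V → S) :
    lexp ψ (fun l => r * f l) = r • lexp ψ f := by
  funext l
  induction l using list_suffix_induction generalizing f with
  | nil => simp
  | cons v l ih =>
    have h : lder v (fun l => r * f l) = fun l => r * lder v f l := rfl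
    have h' : lcup (lder v ψ) (lexp ψ (fun l => r * lder v f l)) l
        = lcup (lder v ψ) (r • lexp ψ (lder v f)) l :=
      lcup_congr (fun _ _ _ => rfl) fun m hm _ => ih m hm _
    rw [Pi.smul_apply, lexp_cons', lexp_cons', h, h', lcup_smul_right]
    split_ifs <;> simp [Algebra.smul_def, mul_add]

lemma lexp_neg (f : List V → S) : lexp ψ (-f) = -lexp ψ f := by
  have := lexp_mul_left ψ (-1) f
  simp only [neg_mul, one_mul, neg_smul, one_smul] at this
  exact this

lemma lexp_sub (f g : List V → S) : lexp ψ (f - g) = lexp ψ f - lexp ψ g := by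
  rw [sub_eq_add_neg, lexp_add, lexp_neg, sub_eq_add_neg]

lemma lder_lexp (f : List V → S) (v : V) {l : List V} (hl : l ≠ []) :
    lder v (lexp ψ f) l = lcup (lder v ψ) (lexp ψ (lder v f)) l := by
  rw [lder_apply, lexp_cons', if_neg hl, zero_add]

/-- Choosing a sublist and cutting it at a member amounts to cutting the list there and choosing
sublists of both pieces. The values of f are scalars, so they may be moved past the gaps of the
second piece. -/
lemma lexp_lcup (f g : List V → S) : lexp ψ (lcup f g) = lcup (lexp ψ f) (lexp ψ g) := by
  funext l
  induction l using list_suffix_induction generalizing f g with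
  | nil => simp
  | cons v l ih =>
    -- The sublist is cut at its first member v, which gives the scalar `f [v]`, or at a later
    -- member, where the induction hypothesis for suffixes applies.
    have h : lcup (lder v ψ) (lexp ψ (lder v (lcup f g))) l
        = lcup (lder v ψ) (f [v] • lexp ψ (lder v g) + lcup (lexp ψ (lder v f)) (lexp ψ g)) l := by
      refine lcup_congr (fun _ _ _ => rfl) fun m hm _ => ?_
      rw [lder_lcup, lexp_add, lexp_mul_left, Pi.add_apply, Pi.add_apply, ih m hm]
    have h' : lcup (lder v (lexp ψ f)) (lexp ψ g) l
        = lcup (lcup (lder v ψ) (lexp ψ (lder v f))) (lexp ψ g) l :=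
      lcup_congr (fun m _ hm => lder_lexp ψ f v hm) fun _ _ _ => rfl
    rw [lexp_cons', h, lcup_cons (lexp ψ f), h', lcup_assoc, lcup_add_right, lcup_smul_right, Pi.add_apply,
      Pi.smul_apply, lexp_singleton, lexp_cons' ψ g, mul_add, ← Algebra.smul_def,
      ← Algebra.smul_def, ← add_assoc]
    congr 2
    split_ifs with hl
    · subst hl
      rw [lcup_cons]
      simp [Algebra.smul_def]
    · simp

variable {ψ}

lemma lexp_lunit_zero {l : List V} : lexp ψ (lunit 0 : List V → S) l = 0 := by
  have : lexp ψ (lunit 0 : List V → S) l = lexp ψ (fun m => 0 * (0 : S)) l :=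
    lexp_congr ψ fun m _ hm => by simp [lunit, hm]
  rw [this, lexp_mul_left]
  simp

lemma lexp_lunit_one {l : List V} : lexp ψ (lunit 1 : List V → S) l = lunit 1 l := by
  cases l with
  | nil => simp [lunit]
  | cons v l =>
    rw [lexp_cons', show (1 : ℕ) = 0 + 1 from rfl, lder_lunit]
    have : lcup (lder v ψ) (lexp ψ (lunit 0 : List V → S)) l = lcup (lder v ψ) (fun _ => 0 * 0) l :=
      lcup_congr (fun _ _ _ => rfl) fun m _ _ => by rw [lexp_lunit_zero, mul_zero]
    rw [this, lcup_mul_right]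
    simp [lunit]

lemma lcup_lunit_one (F : List V → A) {l : List V} (hl : l ≠ []) : lcup F (lunit 1) l = F l := by
  induction l generalizing F with
  | nil => simp at hl
  | cons v l ih =>
    rw [lcup_cons]
    rcases eq_or_ne l [] with rfl | h
    · simp [lunit]
    · rw [ih _ h]
      simp [lunit, h]

/-- A sublist with two members that contains both ends has a single gap, the whole list. -/
lemma lexp_lunit_two (h0 : ψ [] = 0) (h1 : ∀ v, ψ [v] = 0) :
    lexp ψ (lunit 2 : List V → S) = ψ := by
  funext l
  cases l with
  | nil => simp [h0]
  | cons v l =>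
    rw [lexp_cons', show (2 : ℕ) = 1 + 1 from rfl, lder_lunit]
    have : lcup (lder v ψ) (lexp ψ (lunit 1 : List V → S)) l = lcup (lder v ψ) (lunit 1) l :=
      lcup_congr (fun _ _ _ => rfl) fun m _ _ => lexp_lunit_one
    rw [this]
    rcases eq_or_ne l [] with rfl | hl
    · simp [lunit, h1]
    · rw [lcup_lunit_one _ hl]
      simp [hl]

/-- The recursion for `lexp`, in the form of a cup product. -/
lemma lexp_cons (h1 : ∀ v, ψ [v] = 0) (f : List V → S) (v : V) {l : List V} (hl : l ≠ []) :
    lexp ψ f (v :: l) = lcup ψ (lexp ψ (lder v f)) (v :: l) := by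
  rw [lexp_cons', lcup_cons, h1, if_neg hl, zero_mul]

/-- Moving s through all gaps collects the sum of their lengths. Modulo 2 this is the length of l
plus the length of the sublist, whence the two sign twists. -/
lemma lexp_sign {s : A} (h1 : ∀ v, ψ [v] = 0) (hs : ∀ l, s * ψ l = lsgn ψ l * s) (f : List V → S)
    (l : List V) : s * lexp ψ f l = lsgn (lexp ψ (lsgn f)) l * s := by
  induction l using list_suffix_induction generalizing f with
  | nil => simp [lsgn]
  | cons v l ih =>
    rcases eq_or_ne l [] with rfl | hl
    · simp [lsgn, Algebra.commutes]
    · have e : lsgn (lexp ψ (lsgn f)) (v :: l)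
          = lsgn (lcup ψ (lexp ψ (lder v (lsgn f)))) (v :: l) :=
        congrArg (fun z => (-1 : ℤ) ^ (v :: l).length • z) (lexp_cons h1 _ v hl)
      rw [lexp_cons h1 f v hl, e]
      change (fun m => s * lcup ψ _ m) _ = lsgn (lcup _ _) _ * s
      rw [← lcup_mul_left, lder_lsgn, lexp_neg, lcup_neg_right, lsgn_neg, ← lcup_lsgn]
      have : (fun m => s * ψ m) = fun m => lsgn ψ m * s := funext hs
      rw [this, lcup_mul_mid, lcup_cons, lsgn_singleton, h1, neg_zero, zero_mul, zero_add]
      have : lcup (lder v (lsgn ψ)) (fun m => s * lexp ψ (lder v f) m) l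
          = lcup (lder v (lsgn ψ)) (fun m => lsgn (lexp ψ (lsgn (lder v f))) m * s) l :=
        lcup_congr (fun _ _ _ => rfl) fun m hm _ => ih m hm _
      rw [this, lcup_mul_right, lcup_cons, lsgn_singleton, h1, neg_zero, zero_mul, zero_add]

/-- On a singleton the value at the empty list enters `ldel`, but the last term of `ldelInt` takes
it out again. -/
lemma ldelInt_congr {F G : List V → A} (h : ∀ m, m ≠ [] → F m = G m) {l : List V} (hl : l ≠ []) :
    ldelInt F l = ldelInt G l := by
  have h1 : lcup (lunit 2) F l = lcup (lunit 2) G l :=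
    lcup_congr (fun _ _ _ => rfl) fun m _ hm => h m hm
  have h2 : lcup (lsgn F) (lunit 2) l = lcup (lsgn G) (lunit 2) l :=
    lcup_congr (fun m _ hm => by simp only [lsgn, h m hm]) fun _ _ _ => rfl
  simp only [ldelInt, Pi.sub_apply, h1, h2]
  match l, hl with
  | [w], _ => simp [ldel_cons, lunit]; abel
  | u :: w :: l, _ =>
    rw [ldel_congr (by simp) fun m _ hm => h m hm]
    simp [lunit]

lemma lcup_cons_congr {F G G' : List V → A} {v : V} {l : List V} (hF : F [v] = 0)
    (hG : ∀ m, m <:+ l → G m = G' m) : lcup F G (v :: l) = lcup F G' (v :: l) := by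
  rw [lcup_cons, lcup_cons, hF, zero_mul, zero_mul]
  congr 1
  exact lcup_congr (fun _ _ _ => rfl) fun m hm _ => hG m hm

/-- Commutation of `lexp` with an element `D`, given such a relation for `ψ`. -/
lemma lexp_comm {s D : A} (h0 : ψ [] = 0) (h1 : ∀ v, ψ [v] = 0)
    (hs : ∀ l, s * ψ l = lsgn ψ l * s)
    {l : List V} (hD : ∀ m, m.Sublist l → m ≠ [] →
      D * ψ m = -lsgn ψ m * D - ldelInt ψ m + lsgn (lcup ψ ψ) m * s) (f : List V → S) :
    D * lexp ψ f l = -lsgn (lexp ψ f) l * D - ldelInt (lexp ψ f) l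
      + lsgn (lexp ψ (lsgn (ldelInt f))) l * s := by
  induction l using list_suffix_induction generalizing f with
  | nil => simp [lsgn, ldelInt, lunit]
  | cons v l ih =>
    rcases eq_or_ne l [] with rfl | hl
    · simp [lsgn, ldelInt, lunit, ldel_cons, lcup_cons, Algebra.commutes]
    set H := lexp ψ (lder v f) with hH
    have e1 : lexp ψ f (v :: l) = lcup ψ H (v :: l) := lexp_cons h1 f v hl
    -- Removing interior members keeps v and never leaves v alone, so the recursion for `lexp` may
    -- be used under `ldelInt`.
    have e2 : ldelInt (lexp ψ f) (v :: l) = ldelInt (lcup ψ H) (v :: l) := by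
      change lder v (ldelInt _) l = lder v (ldelInt _) l
      rw [lder_ldelInt _ _ hl,
        lder_ldelInt _ _ hl]
      have h : ∀ m, m ≠ [] → lder v (lexp ψ f) m = lder v (lcup ψ H) m :=
        fun m hm => lexp_cons h1 f v hm
      rw [Pi.add_apply, Pi.add_apply, ldelInt_congr h hl,
        lcup_congr (fun _ _ _ => rfl) fun m _ hm => h m hm]
    -- The member removed before f is applied is either the one chosen right after v, which leaves
    -- two successive gaps in front of the rest, or a later one.
    have e3 : lexp ψ (lsgn (ldelInt f)) (v :: l)
        = lcup ψ (lexp ψ (lsgn (ldelInt (lder v f))) - lcup ψ (lexp ψ (lsgn (lder v f))))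
          (v :: l) := by
      rw [lexp_cons h1 _ v hl]
      refine lcup_cons_congr (h1 v) fun m hm => ?_
      have : lexp ψ (lder v (lsgn (ldelInt f))) m
        = lexp ψ (lsgn (ldelInt (lder v f)) - lcup (lunit 2) (lsgn (lder v f))) m := by
        refine lexp_congr ψ fun m' _ hm' => ?_
        have h2 := congrFun (lcup_lsgn (lunit 2) (lder v f)) m'
        rw [lsgn_lunit_two] at h2
        rw [lder_lsgn, Pi.neg_apply, Pi.sub_apply, h2, lsgn, lder_ldelInt _ _ hm']
        simp only [lsgn, Pi.add_apply, Pi.neg_apply, smul_neg, smul_add]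
        abel
      rw [this, lexp_sub, lexp_lcup, lexp_lunit_two h0 h1]
    -- Pushing D through the first gap may split it in two: a new chosen member, which f does not
    -- see.
    have hψ : lcup (fun m => D * ψ m) H (v :: l) = lcup
        (-(fun m => lsgn ψ m * D) - ldelInt ψ + fun m => lsgn (lcup ψ ψ) m * s) H (v :: l) := by
      refine lcup_congr (fun m hm hm' => ?_) fun _ _ _ => rfl
      rw [hD m hm.sublist hm']
      simp
    have hsH : (fun m => s * H m) = fun m => lsgn (lexp ψ (lsgn (lder v f))) m * s :=
      funext fun m => lexp_sign h1 hs _ _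
    -- Behind the first gap D meets an expansion over a suffix, where the induction hypothesis is
    -- available.
    have k1 : lcup (lsgn ψ) (fun m => D * H m) (v :: l)
        = lcup (lsgn ψ) (-(fun m => lsgn H m * D) - ldelInt H
          + fun m => lsgn (lexp ψ (lsgn (ldelInt (lder v f)))) m * s) (v :: l) :=
      lcup_cons_congr (by rw [lsgn_singleton, h1, neg_zero]) fun m hm => by
        rw [ih m hm (fun m' h => hD m' (h.trans (hm.sublist.trans (List.sublist_cons_self v l)))), hH]
        simp
    have key : D * lcup ψ H (v :: l) = (-(fun m => lsgn (lcup ψ H) m * D) - ldelInt (lcup ψ H)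
        + fun m => lsgn (lcup ψ (lexp ψ (lsgn (ldelInt (lder v f)))
            - lcup ψ (lexp ψ (lsgn (lder v f))))) m * s) (v :: l) := by
      have k0 : D * lcup ψ H (v :: l) = lcup (fun m => D * ψ m) H (v :: l) := by
        rw [lcup_mul_left]
      have k2 : ∀ F G : List V → A, lsgn (lcup F G) = -lcup (lsgn F) (lsgn G) := fun F G => by
        rw [lcup_lsgn, neg_neg]
      rw [k0, hψ, lcup_add_left, lcup_sub_left, lcup_neg_left, lcup_mul_mid, lcup_mul_mid, hsH,
        ldelInt_lcup _ _ (lexp_nil _ _)]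
      simp only [Pi.add_apply, Pi.sub_apply, Pi.neg_apply, k1]
      simp only [lcup_add_right, lcup_sub_right, lcup_neg_right, lcup_mul_right, k2, lsgn_sub,
        Pi.add_apply, Pi.sub_apply, Pi.neg_apply, lcup_neg_left, lcup_assoc]
      noncomm_ring
    have e4 : ∀ {F G : List V → A} {m}, F m = G m → lsgn F m = lsgn G m := fun h => by
      simp only [lsgn, h]
    rw [e1, key, Pi.add_apply, Pi.sub_apply, Pi.neg_apply, ← e2, ← e4 e1, ← e4 e3, neg_mul]

end Expansion

end AcyclicBar

end

/-! ### Explicit sums, and evaluation of cochains on vertex lists -/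

noncomputable section

namespace AcyclicBar

universe u v

section Sums

variable {V A : Type*} [Ring A]

lemma ldel_eq_sum (F : List V → A) (l : List V) :
    ldel F l = ∑ i : Fin l.length, (-1) ^ (i : ℕ) * F (l.eraseIdx i) := by
  induction l generalizing F with
  | nil => simp
  | cons v l ih =>
    rw [ldel_cons, ih, List.length_cons, Fin.sum_univ_succ]
    simp [pow_succ, sub_eq_add_neg]

lemma lcup_eq_sum (F G : List V → A) (l : List V) :
    lcup F G l = ∑ p : Fin l.length, F (l.take (p + 1)) * G (l.drop p) := by
  induction l generalizing F with
  | nil => simp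
  | cons v l ih =>
    rw [lcup_cons, ih, List.length_cons, Fin.sum_univ_succ]
    simp

lemma map_ldel {B : Type*} [Ring B] (φ : A →+ B) (F : List V → A) (l : List V) :
    φ (ldel F l) = ldel (fun m => φ (F m)) l := by
  induction l generalizing F with
  | nil => simp
  | cons v l ih =>
    rw [ldel_cons, ldel_cons, map_sub, ih]
    rfl

end Sums

variable {R : Type v} [CommRing R] {X : SSet.{u}} {x : X _⦋0⦌} {N : ℕ}

/-- The face of `σ` on the vertices `g 0 ≤ … ≤ g n`. -/
def face (σ : X _⦋N⦌) {n : ℕ} (g : Fin (n + 1) → Fin (N + 1)) (hg : Monotone g) : X _⦋n⦌ :=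
  X.map (SimplexCategory.mkHom ⟨g, hg⟩).op σ

/-- The value of a cochain on the face of `σ` with a given weakly increasing list of vertices. -/
def ev (σ : X _⦋N⦌) (a : Coch R X) (l : List (Fin (N + 1))) : R :=
  match l with
  | [] => 0
  | v :: l =>
    if h : (v :: l).Pairwise (· ≤ ·) then
      a l.length (face σ (fun i : Fin (l.length + 1) => (v :: l).get i)
        (fun i j hij => by
          rcases hij.eq_or_lt with rfl | hij
          · exact le_rfl
          · exact List.pairwise_iff_get.mp h i j hij))
    else 0

@[simp] lemma ev_nil (σ : X _⦋N⦌) (a : Coch R X) : ev σ a [] = 0 := rfl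

lemma ev_eq (σ : X _⦋N⦌) (a : Coch R X) {l : List (Fin (N + 1))} {n : ℕ} (hl : l.length = n + 1)
    {g : Fin (n + 1) → Fin (N + 1)} (hg : Monotone g)
    (h : ∀ i : Fin (n + 1), l.get (i.cast hl.symm) = g i) :
    ev σ a l = a n (face σ g hg) := by
  cases l with
  | nil => simp at hl
  | cons v l =>
    obtain rfl : l.length = n := by simpa using hl
    obtain rfl : (fun i : Fin (l.length + 1) => (v :: l).get i) = g := funext h
    have hp : (v :: l).Pairwise (· ≤ ·) := List.pairwise_iff_get.mpr fun i j hij => hg hij.le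
    unfold ev
    exact dif_pos hp

lemma ev_add (σ : X _⦋N⦌) (a b : Coch R X) : ev σ (a + b) = ev σ a + ev σ b := by
  funext l
  cases l with
  | nil => simp
  | cons v l =>
    simp only [ev, Pi.add_apply]
    split_ifs <;> simp

lemma ev_smul (σ : X _⦋N⦌) (r : R) (a : Coch R X) : ev σ (r • a) = fun l => r * ev σ a l := by
  funext l
  cases l with
  | nil => simp
  | cons v l =>
    simp only [ev, Pi.smul_apply, smul_eq_mul]
    split_ifs <;> simp

/-- The list of all vertices. -/
lemma ev_finRange (σ : X _⦋N⦌) (a : Coch R X) : ev σ a (List.finRange (N + 1)) = a N σ := by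
  rw [ev_eq σ a (n := N) (by simp) (g := id) monotone_id (by simp)]
  congr 1
  unfold face
  have : SimplexCategory.mkHom ⟨id, monotone_id⟩ = 𝟙 (⦋N⦌) := rfl
  rw [this]
  simp

lemma coch_ext {a b : Coch R X}
    (h : ∀ (N : ℕ) (σ : X _⦋N⦌), ev σ a (List.finRange (N + 1)) = ev σ b (List.finRange (N + 1))) :
    a = b := by
  funext N σ
  rw [← ev_finRange σ a, h, ev_finRange]

lemma pairwise_finRange (n : ℕ) : (List.finRange n).Pairwise (· ≤ ·) :=
  (List.pairwise_lt_finRange n).imp le_of_lt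

/-- A weakly increasing list of vertices comes from a monotone map. -/
lemma monotone_get {l : List (Fin (N + 1))} (h : l.Pairwise (· ≤ ·)) {n : ℕ}
    (hl : l.length = n + 1) : Monotone fun i : Fin (n + 1) => l.get (i.cast hl.symm) := by
  intro i j hij
  rcases hij.eq_or_lt with rfl | hij
  · exact le_rfl
  · exact List.pairwise_iff_get.mp h _ _ (by simpa using hij)

lemma map_face (σ : X _⦋N⦌) {n m : ℕ} (g : Fin (n + 1) → Fin (N + 1)) (hg : Monotone g)
    (f : ⦋m⦌ ⟶ ⦋n⦌) :
    X.map f.op (face σ g hg) = face σ (g ∘ f.toOrderHom) (hg.comp f.toOrderHom.monotone) := by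
  unfold face
  rw [← Functor.map_comp_apply, ← op_comp]
  rfl

/-- Removing a member is a face map. On singletons both sides vanish because `ev` is 0 on the empty
list. Lists out of order are excluded, since they can become ordered when a member is removed. -/
lemma ev_coboundary (σ : X _⦋N⦌) (a : Coch R X) {l : List (Fin (N + 1))}
    (h : l.Pairwise (· ≤ ·)) : ev σ (coboundary a) l = ldel (ev σ a) l := by
  match l, h with
  | [], _ => simp
  | [v], h => simp [ev, coboundary, ldel_cons]
  | v :: w :: l, h =>
    rw [ev_eq σ _ (n := l.length + 1) rfl (monotone_get h rfl) (fun _ => rfl), ldel_eq_sum]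
    refine Finset.sum_congr rfl fun i _ => ?_
    congr 1
    have hlen : ((v :: w :: l).eraseIdx i).length = l.length + 1 := by
      rw [List.length_eraseIdx_of_lt i.2]; rfl
    refine Eq.trans ?_ (ev_eq σ a (n := l.length) hlen ((monotone_get h rfl).comp
      (Fin.strictMono_succAbove i).monotone) fun k => ?_).symm
    · exact congrArg (a l.length) (map_face σ _ _ (SimplexCategory.δ i))
    · simp only [List.get_eq_getElem, Fin.val_cast, Function.comp_apply, List.getElem_eraseIdx]
      split_ifs with hk
      · rw! (castMode := .all) [Fin.succAbove_of_castSucc_lt _ _ (by simpa [Fin.lt_def] using hk)]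
        rfl
      · rw! (castMode := .all) [Fin.succAbove_of_le_castSucc _ _ (by simpa [Fin.le_def] using hk)]
        rfl

lemma segment_face (σ : X _⦋N⦌) {n : ℕ} (g : Fin (n + 1) → Fin (N + 1)) (hg : Monotone g)
    (s l : ℕ) (h : s + l ≤ n) :
    segment (face σ g hg) s l h = face σ (fun i : Fin (l + 1) => g ⟨i + s, by omega⟩)
      (fun i j hij => hg (Fin.mk_le_mk.mpr (Nat.add_le_add_right (Fin.le_def.mp hij) s))) := by
  unfold segment
  rw [map_face]
  rfl

lemma ev_cup (σ : X _⦋N⦌) (a b : Coch R X) {l : List (Fin (N + 1))}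
    (h : l.Pairwise (· ≤ ·)) : ev σ (cupFun a b) l = lcup (ev σ a) (ev σ b) l := by
  match l, h with
  | [], _ => simp
  | v :: l, h =>
    rw [ev_eq σ _ (n := l.length) rfl (monotone_get h rfl) (fun _ => rfl), lcup_eq_sum]
    refine Finset.sum_congr rfl fun p _ => ?_
    obtain ⟨p, hp⟩ := p
    congr 1
    · rw [segment_face]
      refine (ev_eq σ a ?_ _ fun i => ?_).symm
      · rw [List.length_take]
        exact Nat.min_eq_left hp
      · simp only [List.get_eq_getElem, Fin.val_cast, List.getElem_take, add_zero]
    · rw [segment_face]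
      refine (ev_eq σ b ?_ _ fun i => ?_).symm
      · rw [List.length_drop]
        change l.length + 1 - p = l.length - p + 1
        omega
      · simp [add_comm]

end AcyclicBar

end

/-! ### Sums over increasing maps, and the closed form of an expansion -/

noncomputable section

namespace AcyclicBar

section EmbSums

variable {A : Type*} [AddCommMonoid A]

/-- The sum over all strictly increasing maps. -/
def sumEmb (k n : ℕ) (F : (Fin k → Fin n) → A) : A := ∑ f : Fin k ↪o Fin n, F f

lemma sumEmb_zero_left (n : ℕ) (F : (Fin 0 → Fin n) → A) : sumEmb 0 n F = F finZeroElim := by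
  unfold sumEmb
  rw [Fintype.sum_eq_single (OrderEmbedding.ofIsEmpty (α := Fin 0) (β := Fin n))]
  · congr 1
  · intro f hf
    exact absurd (RelEmbedding.ext fun i => i.elim0) hf

lemma sumEmb_of_lt {k n : ℕ} (h : n < k) (F : (Fin k → Fin n) → A) : sumEmb k n F = 0 := by
  unfold sumEmb
  have : IsEmpty (Fin k ↪o Fin n) := ⟨fun f => by
    have := Fintype.card_le_of_injective f f.injective
    simp at this
    omega⟩
  simp

/-- Prolongation of an increasing map by `0 ↦ 0`. -/
def consEmb {k n : ℕ} (f : Fin k ↪o Fin n) : Fin (k + 1) ↪o Fin (n + 1) :=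
  OrderEmbedding.ofStrictMono (Fin.cons 0 fun i => (f i).succ) (by
    intro i j hij
    induction i using Fin.cases with
    | zero =>
      induction j using Fin.cases with
      | zero => exact absurd hij (lt_irrefl _)
      | succ j => simp
    | succ i =>
      induction j using Fin.cases with
      | zero => simp at hij
      | succ j => simpa using hij)

lemma coe_consEmb {k n : ℕ} (f : Fin k ↪o Fin n) :
    ⇑(consEmb f) = Fin.cons 0 fun i => (f i).succ := rfl

/-- An increasing map either starts at 0 or avoids 0 altogether. -/
lemma sumEmb_succ (k n : ℕ) (F : (Fin (k + 1) → Fin (n + 1)) → A) :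
    sumEmb (k + 1) (n + 1) F = sumEmb k n (fun f => F (Fin.cons 0 fun i => (f i).succ))
      + sumEmb (k + 1) n (fun f => F fun i => (f i).succ) := by
  unfold sumEmb
  rw [← Fintype.sum_sumElim]
  symm
  refine Fintype.sum_bijective
    (Sum.elim consEmb fun f : Fin (k + 1) ↪o Fin n => f.trans (Fin.succOrderEmb n)) ⟨?_, ?_⟩ _ _ ?_
  · rintro (f | f) (g | g) h <;> simp only [Sum.elim_inl, Sum.elim_inr] at h
    · congr 1
      ext i
      have := DFunLike.congr_fun h i.succ
      simp only [coe_consEmb, Fin.cons_succ, Fin.succ_inj] at this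
      rw [this]
    · have := DFunLike.congr_fun h 0
      simp [coe_consEmb, Fin.ext_iff] at this
    · have := DFunLike.congr_fun h 0
      simp [coe_consEmb, Fin.ext_iff] at this
    · congr 1
      ext i
      have := DFunLike.congr_fun h i
      simp only [RelEmbedding.coe_trans, Function.comp_apply, Fin.coe_succOrderEmb,
        Fin.succ_inj] at this
      rw [this]
  · intro f
    by_cases h0 : f 0 = 0
    · have hpos : ∀ i : Fin k, f i.succ ≠ 0 := fun i h => by
        have := f.injective (h.trans h0.symm)
        exact Fin.succ_ne_zero i this
      refine ⟨Sum.inl (OrderEmbedding.ofStrictMono (fun i => (f i.succ).pred (hpos i)) ?_), ?_⟩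
      · intro i j hij
        simpa using hij
      · ext i
        induction i using Fin.cases with
        | zero => simp [coe_consEmb, h0]
        | succ i => exact congrArg Fin.val (Fin.succ_pred (f i.succ) (hpos i))
    · have hpos : ∀ i, f i ≠ 0 := fun i h => h0 (by
        have : f 0 ≤ f i := f.monotone (Fin.zero_le i)
        rw [h] at this
        exact le_antisymm this (Fin.zero_le _))
      refine ⟨Sum.inr (OrderEmbedding.ofStrictMono (fun i => (f i).pred (hpos i)) ?_), ?_⟩
      · intro i j hij
        simpa using hij
      · ext i
        exact congrArg Fin.val (Fin.succ_pred (f i) (hpos i))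
  · rintro (f | f) <;> rfl

lemma sumEmb_congr {k n : ℕ} {F G : (Fin k → Fin n) → A}
    (h : ∀ f : Fin k → Fin n, StrictMono f → F f = G f) : sumEmb k n F = sumEmb k n G :=
  Finset.sum_congr rfl fun f _ => h f f.strictMono

lemma map_sumEmb {B F' : Type*} [AddCommMonoid B] [FunLike F' A B] [AddMonoidHomClass F' A B]
    (φ : F') {k n : ℕ} (F : (Fin k → Fin n) → A) :
    φ (sumEmb k n F) = sumEmb k n fun f => φ (F f) := map_sum φ _ _

end EmbSums

section ExpansionSum

variable {V A S : Type*} [Ring A] [CommRing S] [Algebra S A]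

/-- The contiguous piece of a list from position `s` to position `t`. -/
def lseg (l : List V) (s t : ℕ) : List V := (l.drop s).take (t - s + 1)

/-- Here the first chosen position `g 0` is free, and φ weighs the piece up to it. The two summands
in the recursion are the cases `g 0 = 0` and `g 0 > 0` of `sumEmb_succ`. -/
lemma lexpAux_eq_sum (ψ φ : List V → A) (f : List V → S) (l : List V) :
    lexpAux ψ φ f l = ∑ j ∈ Finset.range l.length, sumEmb (j + 1) l.length fun g =>
      if (g (Fin.last j) : ℕ) + 1 = l.length then
        φ (l.take (g 0 + 1)) *
          (List.ofFn fun q : Fin j => ψ (lseg l (g q.castSucc) (g q.succ))).prod *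
          algebraMap S A (f (List.ofFn fun i => l.get (g i)))
      else 0 := by
  induction l generalizing φ f with
  | nil => simp [lexpAux]
  | cons w l ih =>
    rw [lexpAux, ih, ih]
    change _ = ∑ j ∈ Finset.range (l.length + 1), sumEmb (j + 1) (l.length + 1)
      fun g : Fin (j + 1) → Fin (l.length + 1) =>
      if (g (Fin.last j) : ℕ) + 1 = l.length + 1 then
        φ ((w :: l).take (g 0 + 1)) *
          (List.ofFn fun q : Fin j => ψ (lseg (w :: l) (g q.castSucc) (g q.succ))).prod *
          algebraMap S A (f (List.ofFn fun i => (w :: l).get (g i)))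
      else 0
    simp only [sumEmb_succ, Finset.sum_add_distrib]
    congr 1
    · rw [Finset.sum_range_succ', mul_add, Finset.mul_sum, add_comm]
      congr 1
      · refine Finset.sum_congr rfl fun j _ => ?_
        change AddMonoidHom.mulLeft (φ [w]) _ = _
        rw [map_sumEmb]
        refine sumEmb_congr fun g hg => ?_
        simp only [AddMonoidHom.coe_mulLeft]
        rw [mul_ite, mul_zero]
        have e : (List.ofFn fun q : Fin (j + 1) => ψ (lseg (w :: l)
            ((Fin.cons 0 fun i => (g i).succ : Fin (j + 2) → Fin (l.length + 1)) q.castSucc)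
            ((Fin.cons 0 fun i => (g i).succ : Fin (j + 2) → Fin (l.length + 1)) q.succ)))
            = ψ (w :: l.take (g 0 + 1))
              :: List.ofFn fun q : Fin j => ψ (lseg l (g q.castSucc) (g q.succ)) := by
          rw [List.ofFn_succ]
          simp [lseg]
        rw [e, List.prod_cons]
        simp [mul_assoc]
      · rw [sumEmb_zero_left]
        simp
    -- More positions cannot be chosen than there are members in l, so the top value of j
    -- contributes nothing.
    · rw [Finset.sum_range_succ, sumEmb_of_lt (Nat.lt_succ_self _), add_zero]
      refine Finset.sum_congr rfl fun j _ => sumEmb_congr fun g hg => ?_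
      simp [lseg]

lemma lexp_eq_sum (ψ : List V → A) (f : List V → S) (v : V) (l : List V) :
    lexp ψ f (v :: l) = ∑ j ∈ Finset.range (l.length + 1), sumEmb (j + 1) (l.length + 1)
      fun g : Fin (j + 1) → Fin (l.length + 1) =>
      if g 0 = 0 ∧ g (Fin.last j) = Fin.last l.length then
          (List.ofFn fun q : Fin j => ψ (lseg (v :: l) (g q.castSucc) (g q.succ))).prod *
          algebraMap S A (f (List.ofFn fun i => (v :: l).get (g i)))
      else 0 := by
  rw [lexp, lexpAux_eq_sum]
  simp only [sumEmb_succ, Finset.sum_add_distrib]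
  have h : ∀ (j : ℕ) (F : (Fin (j + 1) → Fin (l.length + 1)) → A),
      (sumEmb (j + 1) l.length fun g : Fin (j + 1) → Fin l.length =>
        if (g 0).succ = 0 ∧ (g (Fin.last j)).succ = Fin.last l.length then
          F (fun i => (g i).succ) else 0) = 0 :=
    fun j F => Finset.sum_eq_zero fun g _ => by simp
  rw [Finset.sum_range_succ', add_comm]
  simp only [sumEmb_zero_left]
  -- Choices that avoid position 0 violate the condition on the front end.
  rw [Finset.sum_eq_zero (s := Finset.range (l.length + 1)) fun j _ => ?_, add_zero]
  swap
  · exact Finset.sum_eq_zero fun g _ => by simp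
  congr 1
  · refine Finset.sum_congr rfl fun j _ => sumEmb_congr fun g hg => ?_
    have e : (List.ofFn fun q : Fin (j + 1) => ψ (lseg (v :: l)
        ((Fin.cons 0 fun i => (g i).succ : Fin (j + 2) → Fin (l.length + 1)) q.castSucc)
        ((Fin.cons 0 fun i => (g i).succ : Fin (j + 2) → Fin (l.length + 1)) q.succ)))
        = ψ (v :: l.take (g 0 + 1))
          :: List.ofFn fun q : Fin j => ψ (lseg l (g q.castSucc) (g q.succ)) := by
      rw [List.ofFn_succ]
      simp [lseg]
    rw [e, List.prod_cons]
    have e' : (Fin.cons 0 (fun i => (g i).succ) : Fin (j + 2) → Fin (l.length + 1))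
        (Fin.last (j + 1)) = (g (Fin.last j)).succ := by
      rw [← Fin.succ_last, Fin.cons_succ]
    rw [e']
    simp [mul_assoc, Fin.ext_iff]
  · rcases l with _ | ⟨w, l⟩
    · simp
    · simp [Fin.ext_iff]

end ExpansionSum

end AcyclicBar

end

/-! ### Words, and the gap operators on the bar construction -/

noncomputable section

namespace AcyclicBar

universe u v

section Words

variable {R M : Type*} [CommRing R] [AddCommGroup M] [Module R M]

/-- P need not be stable under products, so the induction over the algebra runs for the statement
that left multiplication preserves P. -/
lemma word_induction {P : TensorAlgebra R M → Prop} (one : P 1)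
    (cons : ∀ m y, P y → P (TensorAlgebra.ι R m * y)) (add : ∀ y z, P y → P z → P (y + z))
    (smul : ∀ (r : R) y, P y → P (r • y)) (y : TensorAlgebra R M) : P y := by
  have h : ∀ z : TensorAlgebra R M, ∀ y, P y → P (z * y) := by
    intro z
    induction z using TensorAlgebra.induction with
    | algebraMap r => intro y hy; rw [← Algebra.smul_def]; exact smul r y hy
    | ι m => exact cons m
    | mul a b ha hb => intro y hy; rw [mul_assoc]; exact ha _ (hb y hy)
    | add a b ha hb => intro y hy; rw [add_mul]; exact add _ _ (ha y hy) (hb y hy)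
  simpa using h y 1 one

/-- Linear maps on the tensor algebra that agree on words are equal. -/
lemma word_ext {B : Type*} [AddCommGroup B] [Module R B] {f g : TensorAlgebra R M →ₗ[R] B}
    (h1 : f 1 = g 1)
    (hc : ∀ m y, f y = g y → f (TensorAlgebra.ι R m * y) = g (TensorAlgebra.ι R m * y)) :
    f = g := by
  refine LinearMap.ext fun y => ?_
  induction y using word_induction with
  | one => exact h1
  | cons m y ih => exact hc m y ih
  | add y z hy hz => rw [map_add, map_add, hy, hz]
  | smul r y hy => rw [map_smul, map_smul, hy]

lemma word_ext' {B : Type*} [AddCommGroup B] [Module R B] {f g : TensorAlgebra R M →ₗ[R] B}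
    (h1 : f 1 = g 1) (hc : ∀ m y, f (TensorAlgebra.ι R m * y) = g (TensorAlgebra.ι R m * y)) :
    f = g := word_ext h1 fun m y _ => hc m y

/-- Evaluation of a functional on the first letter of a word. -/
def contr (φ : M →ₗ[R] R) : TensorAlgebra R M →ₗ[R] TensorAlgebra R M :=
  (TensorProduct.lid R _).toLinearMap ∘ₗ φ.rTensor _ ∘ₗ uncons R M

lemma contr_one (φ : M →ₗ[R] R) : contr φ 1 = 0 := by simp [contr, uncons_one]

lemma contr_cons (φ : M →ₗ[R] R) (m : M) (y : TensorAlgebra R M) :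
    contr φ (TensorAlgebra.ι R m * y) = φ m • y := by simp [contr, uncons_cons]

end Words

variable {R : Type v} [CommRing R] {X : SSet.{u}} {x : X _⦋0⦌} {N : ℕ}

/-- `ev` as a functional on `Cbar`. -/
def evBar (σ : X _⦋N⦌) (l : List (Fin (N + 1))) : Cbar R x →ₗ[R] R where
  toFun a := ev σ a.1 l
  map_add' a b := by rw [Submodule.coe_add, ev_add]; rfl
  map_smul' r a := by rw [Submodule.coe_smul, ev_smul]; rfl

variable (R x) in
/-- The algebra of operators on the bar construction, with the order of composition reversed. -/
abbrev Op : Type (max u v) := (Module.End R (Bar R x))ᵐᵒᵖ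

/-- Evaluation of the first letter on a face of `σ`, as an operator. -/
def kap (σ : X _⦋N⦌) (l : List (Fin (N + 1))) : Op R x := MulOpposite.op (contr (evBar σ l))

variable (R x) in
/-- The sign involution as an operator. -/
def opS : Op R x := MulOpposite.op (signBar R x).toLinearMap

variable (R x) in
/-- The differential of the bar construction as an operator. -/
def opD : Op R x := MulOpposite.op (barD R x)

/-- The operator attached to a gap, without sign. -/
def gapOp (σ : X _⦋N⦌) : List (Fin (N + 1)) → Op R x := kap σ + lunit 2

/-- The operator attached to a gap. -/
def psi (σ : X _⦋N⦌) (l : List (Fin (N + 1))) : Op R x := gapOp σ l * opS R x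

lemma signBar_one : signBar R x 1 = 1 := map_one _

lemma signBar_cons (m : Cbar R x) (y : Bar R x) : signBar R x (TensorAlgebra.ι R m * y)
    = TensorAlgebra.ι R (invBar R x m) * signBar R x y := by
  simp [signBar]

lemma opS_opS : opS R x * opS R x = 1 := by
  refine MulOpposite.unop_injective (LinearMap.ext fun y => ?_)
  exact signBar_signBar y

lemma op_ext {P Q : Op R x} (h1 : P.unop 1 = Q.unop 1)
    (hc : ∀ m y, P.unop (TensorAlgebra.ι R m * y) = Q.unop (TensorAlgebra.ι R m * y)) : P = Q :=
  MulOpposite.unop_injective (word_ext' h1 hc)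

lemma ev_zero (σ : X _⦋N⦌) (l : List (Fin (N + 1))) : ev σ (0 : Coch R X) l = 0 := by
  cases l with
  | nil => rfl
  | cons v l => simp [ev]

lemma evBar_invBar (σ : X _⦋N⦌) (a : Cbar R x) (l : List (Fin (N + 1))) :
    evBar σ l (invBar R x a) = (-1) ^ l.length * evBar σ l a := by
  cases l with
  | nil => simp [evBar]
  | cons v l =>
    simp only [evBar, LinearMap.coe_mk, AddHom.coe_mk, ev]
    split_ifs
    · simp [invBar, pow_succ]
    · simp

lemma kap_nil (σ : X _⦋N⦌) : (kap σ [] : Op R x) = 0 := by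
  refine op_ext ?_ fun m y => ?_
  · exact contr_one _
  · exact (contr_cons _ _ _).trans (zero_smul R y)

lemma evBar_singleton (σ : X _⦋N⦌) (v : Fin (N + 1)) (m : Cbar R x) : evBar σ [v] m = 0 := by
  have h : m.1 0 = 0 := m.2.2
  simp [evBar, ev, h]

lemma kap_singleton (σ : X _⦋N⦌) (v : Fin (N + 1)) : (kap σ [v] : Op R x) = 0 := by
  refine op_ext ?_ fun m y => ?_
  · exact contr_one _
  · exact (contr_cons _ _ _).trans (by rw [evBar_singleton, zero_smul]; rfl)

lemma psi_nil (σ : X _⦋N⦌) : (psi σ [] : Op R x) = 0 := by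
  simp [psi, gapOp, kap_nil, lunit]

lemma psi_singleton (σ : X _⦋N⦌) (v : Fin (N + 1)) : (psi σ [v] : Op R x) = 0 := by
  simp [psi, gapOp, kap_singleton, lunit]

/-- A letter is non-zero only on lists with length its bar degree plus 2, so consuming it changes
the degree sign by that of the length. -/
lemma opS_kap (σ : X _⦋N⦌) (l : List (Fin (N + 1))) :
    opS R x * kap σ l = lsgn (kap σ) l * opS R x := by
  refine op_ext ?_ fun m y => ?_
  · simp only [opS, kap, lsgn, MulOpposite.unop_mul, MulOpposite.unop_op, MulOpposite.unop_smul,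
      Module.End.mul_apply, AlgHom.toLinearMap_apply, signBar_one, contr_one, LinearMap.smul_apply,
      map_zero, smul_zero]
  · simp only [opS, kap, lsgn, MulOpposite.unop_mul, MulOpposite.unop_op, MulOpposite.unop_smul,
      Module.End.mul_apply, AlgHom.toLinearMap_apply, signBar_cons, contr_cons, evBar_invBar,
      LinearMap.smul_apply, map_smul, map_zsmul]
    rw [mul_smul]
    have : ((-1 : R) ^ l.length) = (((-1 : ℤ) ^ l.length : ℤ) : R) := by push_cast; rfl
    rw [this, Int.cast_smul_eq_zsmul]

lemma opS_gap (σ : X _⦋N⦌) (l : List (Fin (N + 1))) :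
    opS R x * gapOp σ l = lsgn (gapOp σ) l * opS R x := by
  rw [gapOp, lsgn_add, lsgn_lunit_two, Pi.add_apply, Pi.add_apply, mul_add, add_mul, opS_kap]
  congr 1
  simp only [lunit]
  split_ifs <;> simp

lemma opS_psi (σ : X _⦋N⦌) (l : List (Fin (N + 1))) :
    opS R x * psi σ l = lsgn (psi σ) l * opS R x := by
  have h : (psi σ : _ → Op R x) = fun l => gapOp σ l * opS R x := rfl
  rw [h, lsgn_mul_right]
  simp only [← mul_assoc, opS_gap]

lemma barD_one : barD R x 1 = 0 := wordRec_one _ _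

lemma barD_single (a : Cbar R x) : barD R x (TensorAlgebra.ι R a * 1)
    = -(TensorAlgebra.ι R (dCbar R x a) * 1) := by
  rw [barD_cons, barD_one, uncons_one]
  simp

lemma barD_cons_cons (a b : Cbar R x) (y : Bar R x) :
    barD R x (TensorAlgebra.ι R a * (TensorAlgebra.ι R b * y)) =
      -(TensorAlgebra.ι R (dCbar R x a) * (TensorAlgebra.ι R b * y))
        + TensorAlgebra.ι R (invBar R x a) * barD R x (TensorAlgebra.ι R b * y)
        - TensorAlgebra.ι R (cupBar R x (invBar R x a) b) * y := by
  rw [barD_cons, uncons_cons]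
  simp

lemma invBar_invBar (a : Cbar R x) : invBar R x (invBar R x a) = a := by
  ext n σ
  simp [invBar, ← mul_assoc, ← mul_pow]

lemma invBar_dCbar (a : Cbar R x) : invBar R x (dCbar R x a) = -dCbar R x (invBar R x a) := by
  ext n σ
  cases n with
  | zero => simp [invBar, dCbar, coboundary]
  | succ n =>
    simp [invBar, dCbar, coboundary, pow_succ, Finset.mul_sum]
    refine Finset.sum_congr rfl fun i _ => ?_
    ring

lemma invBar_cupBar (a b : Cbar R x) :
    invBar R x (cupBar R x a b) = -cupBar R x (invBar R x a) (invBar R x b) := by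
  ext n σ
  simp only [invBar, cupBar, cupFun, LinearMap.mk₂_apply, LinearMap.coe_mk, AddHom.coe_mk,
    Submodule.coe_neg, Pi.neg_apply, Finset.mul_sum]
  congr 1
  refine Finset.sum_congr rfl fun p _ => ?_
  have : (-1 : R) ^ n = (-1) ^ (p : ℕ) * (-1) ^ (n - p) := by
    rw [← pow_add]; congr 1; omega
  rw [this]
  ring

/-- The differential has odd degree. -/
lemma signBar_barD (y : Bar R x) : signBar R x (barD R x y) = -barD R x (signBar R x y) := by
  have h : (signBar R x).toLinearMap ∘ₗ barD R x = -(barD R x ∘ₗ (signBar R x).toLinearMap) := by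
    refine word_ext ?_ fun m y ih => ?_
    · simp [barD_one, signBar_one]
    · simp only [LinearMap.comp_apply, AlgHom.toLinearMap_apply, LinearMap.neg_apply] at ih ⊢
      -- The summand that multiplies the first two letters needs the second letter to be exposed.
      have key : ∀ z : Bar R x, signBar R x (LinearMap.mul' R _ (LinearMap.rTensor _
          (TensorAlgebra.ι R ∘ₗ cupBar R x (invBar R x m)) (uncons R _ z)))
          = -LinearMap.mul' R _ (LinearMap.rTensor _
          (TensorAlgebra.ι R ∘ₗ cupBar R x (invBar R x (invBar R x m)))
            (uncons R _ (signBar R x z))) := by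
        intro z
        induction z using word_induction with
        | one => simp [uncons_one]
        | cons b z _ => simp [uncons_cons, signBar_cons, invBar_cupBar]
        | add y z hy hz => simp only [map_add, hy, hz, neg_add]
        | smul r y hy => simp only [map_smul, hy, smul_neg]
      rw [barD_cons, signBar_cons, barD_cons, map_sub, map_add, map_neg, signBar_cons,
        signBar_cons, key, ih, invBar_dCbar]
      simp
      abel
  exact LinearMap.congr_fun h y

end AcyclicBar

end

/-! ### Commuting the bar differential with the gap operators -/

noncomputable section

namespace AcyclicBar

universe u v

section

variable {V A : Type*} [Ring A]

lemma ldelInt_mul_right (a : A) (F : List V → A) :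
    ldelInt (fun l => F l * a) = fun l => ldelInt F l * a := by
  have h1 : ldel (fun l => F l * a) = fun l => ldel F l * a :=
    funext fun l => (map_ldel (AddMonoidHom.mulRight a) F l).symm
  have h2 : (fun l : List V => (lunit 2 l : A) * a) = fun l => a * lunit 2 l := by
    funext l; simp only [lunit]; split_ifs <;> simp
  have h4 : (fun l : List V => a * (lunit 2 l : A)) = fun l => lunit 2 l * a := h2.symm
  have h3 : ∀ l : List V, (lunit 1 l : A) * a = a * lunit 1 l := fun l => by
    simp only [lunit]; split_ifs <;> simp
  funext l
  simp only [ldelInt, h1, lcup_mul_right, lsgn_mul_right, lcup_mul_mid, h4, Pi.sub_apply, sub_mul,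
    mul_assoc, h3]

lemma sub_mul_of_anticomm {D s : A} (h : D * s = -(s * D)) (P Q K : A) :
    (P * D - Q - K) * s = -(P * s) * D - Q * s + -K * s := by
  rw [sub_mul, sub_mul, mul_assoc, h]
  noncomm_ring

/-- The equation dε = εε: both sides are supported on lists with three members, where they are 1 - 1
+ 1 and 1. -/
lemma ldel_lunit_two : ldel (lunit 2 : List V → A) = lcup (lunit 2) (lunit 2) := by
  funext l
  match l with
  | [] => simp
  | [v] => simp [ldel_cons, lcup_cons, lunit]
  | v :: w :: l =>
    rw [lunit_two_lcup]
    simp only [ldel_cons]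
    have h0 : ∀ (l : List V) (F : List V → A), (∀ l, F l = 0) → ldel F l = 0 := by
      intro l
      induction l with
      | nil => simp
      | cons v l ih => intro F hF; rw [ldel_cons, hF, ih (lder v F) fun l => hF _, sub_zero]
    rcases l with _ | ⟨z, l⟩
    · simp [lunit]
    · rw [ldel_cons, h0 l _ fun l => by simp [lunit]]
      simp [lunit]

end

variable {R : Type v} [CommRing R] {X : SSet.{u}} {x : X _⦋0⦌} {N : ℕ}

/-- Exposing two letters suits the bar differential, which multiplies the first two. -/
lemma op_ext_two {P Q : Op R x} (h0 : P.unop 1 = Q.unop 1)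
    (h1 : ∀ a, P.unop (TensorAlgebra.ι R a * 1) = Q.unop (TensorAlgebra.ι R a * 1))
    (h2 : ∀ a b z, P.unop (TensorAlgebra.ι R a * (TensorAlgebra.ι R b * z))
      = Q.unop (TensorAlgebra.ι R a * (TensorAlgebra.ι R b * z))) : P = Q := by
  refine op_ext h0 fun a y => ?_
  have : P.unop ∘ₗ LinearMap.mulLeft R (TensorAlgebra.ι R a)
      = Q.unop ∘ₗ LinearMap.mulLeft R (TensorAlgebra.ι R a) :=
    word_ext' (h1 a) fun b z => h2 a b z
  exact LinearMap.congr_fun this y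

lemma ldel_kap_one (σ : X _⦋N⦌) (l : List (Fin (N + 1))) :
    (ldel (kap σ) l : Op R x).unop 1 = 0 := by
  have h := map_ldel (⟨⟨fun P : Op R x => P.unop 1, rfl⟩, fun _ _ => rfl⟩ : Op R x →+ Bar R x)
    (kap σ) l
  refine h.trans ?_
  have : (fun m => (kap σ m : Op R x).unop 1) = fun m => 0 * 0 := by
    funext m
    rw [mul_zero]
    exact contr_one _
  change ldel (fun m => (kap σ m : Op R x).unop 1) l = 0
  rw [this, ldel_mul_left]
  exact zero_mul _

lemma ldel_kap_cons (σ : X _⦋N⦌) (l : List (Fin (N + 1))) (a : Cbar R x) (y : Bar R x) :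
    (ldel (kap σ) l : Op R x).unop (TensorAlgebra.ι R a * y) = ldel (ev σ a.1) l • y := by
  have h := map_ldel (⟨⟨fun P : Op R x => P.unop (TensorAlgebra.ι R a * y), rfl⟩,
    fun _ _ => rfl⟩ : Op R x →+ Bar R x) (kap σ) l
  refine h.trans ?_
  have h' := map_ldel (LinearMap.toSpanSingleton R (Bar R x) y).toAddMonoidHom (ev σ a.1) l
  refine Eq.trans ?_ h'.symm
  congr 1
  funext m
  exact contr_cons _ _ _

lemma unop_lcup_kap (σ : X _⦋N⦌) (l : List (Fin (N + 1))) (y : Bar R x) :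
    (lcup (lsgn (kap σ)) (kap σ) l : Op R x).unop y = ∑ p : Fin l.length,
      contr (evBar σ (l.drop p)) ((-1 : ℤ) ^ (l.take (p + 1)).length •
        contr (evBar σ (l.take (p + 1))) y) := by
  rw [lcup_eq_sum, Finset.unop_sum, LinearMap.sum_apply]
  rfl

lemma evBar_dCbar (σ : X _⦋N⦌) {l : List (Fin (N + 1))} (h : l.Pairwise (· ≤ ·)) (a : Cbar R x) :
    evBar σ l (dCbar R x a) = ldel (ev σ a.1) l := ev_coboundary σ a.1 h

lemma evBar_cupBar (σ : X _⦋N⦌) {l : List (Fin (N + 1))} (h : l.Pairwise (· ≤ ·))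
    (a b : Cbar R x) : evBar σ l (cupBar R x a b)
      = ∑ p : Fin l.length, evBar σ (l.take (p + 1)) a * evBar σ (l.drop p) b := by
  rw [evBar, LinearMap.coe_mk, AddHom.coe_mk]
  exact (ev_cup σ a.1 b.1 h).trans (lcup_eq_sum _ _ _)

/-- The first letter of a differential is the coboundary of a letter, the old first letter, or the
product of the first two. Evaluation on l turns these into `ldel`, a passage of D, and a cut of l
into two pieces. -/
lemma opD_kap (σ : X _⦋N⦌) {l : List (Fin (N + 1))} (h : l.Pairwise (· ≤ ·)) :
    opD R x * kap σ l = -ldel (kap σ) l + lsgn (kap σ) l * opD R x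
      - lcup (lsgn (kap σ)) (kap σ) l := by
  have hz : ∀ y : Bar R x, ((-1 : ℤ) ^ l.length • y) = (-1 : R) ^ l.length • y := fun y => by
    have : ((-1 : R) ^ l.length) = (((-1 : ℤ) ^ l.length : ℤ) : R) := by push_cast; rfl
    rw [this, Int.cast_smul_eq_zsmul]
  have hD : ∀ y, (opD R x * kap σ l).unop y = contr (evBar σ l) (barD R x y) := fun _ => rfl
  have hD' : ∀ y, (lsgn (kap σ) l * opD R x).unop y
      = barD R x ((-1 : R) ^ l.length • contr (evBar σ l) y) := fun y => by
    rw [← hz]; rfl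
  refine op_ext_two ?_ (fun a => ?_) fun a b z => ?_
  · simp only [MulOpposite.unop_add, MulOpposite.unop_sub, MulOpposite.unop_neg,
      LinearMap.add_apply, LinearMap.sub_apply, LinearMap.neg_apply, hD, hD', ldel_kap_one,
      unop_lcup_kap, contr_one, barD_one]
    simp
  · simp only [MulOpposite.unop_add, MulOpposite.unop_sub, MulOpposite.unop_neg,
      LinearMap.add_apply, LinearMap.sub_apply, LinearMap.neg_apply, hD, hD', ldel_kap_cons,
      unop_lcup_kap, contr_cons, barD_single, map_neg, evBar_dCbar σ h, map_smul, map_zsmul,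
      contr_one, barD_one]
    simp
  · simp only [MulOpposite.unop_add, MulOpposite.unop_sub, MulOpposite.unop_neg,
      LinearMap.add_apply, LinearMap.sub_apply, LinearMap.neg_apply, hD, hD', ldel_kap_cons,
      unop_lcup_kap, contr_cons, barD_cons_cons, map_neg, map_sub, map_add, evBar_dCbar σ h,
      map_smul, map_zsmul, evBar_invBar, evBar_cupBar σ h, mul_smul, Finset.sum_smul]
    congr 1
    refine Finset.sum_congr rfl fun p _ => ?_
    have : ((-1 : R) ^ (l.take (p + 1)).length)
      = (((-1 : ℤ) ^ (l.take (p + 1)).length : ℤ) : R) := by push_cast; rfl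
    rw [this, Int.cast_smul_eq_zsmul]

lemma opD_opS : opD R x * opS R x = -(opS R x * opD R x) := by
  refine MulOpposite.unop_injective (LinearMap.ext fun y => ?_)
  exact signBar_barD y

/-- Adding ε to the letters creates cross terms in the cup square. They are the outer faces, so the
coboundary is reduced to its interior part. -/
lemma opD_gap (σ : X _⦋N⦌) {l : List (Fin (N + 1))} (h : l.Pairwise (· ≤ ·)) :
    opD R x * gapOp σ l = lsgn (gapOp σ) l * opD R x - ldelInt (gapOp σ) l
      - lcup (lsgn (gapOp σ)) (gapOp σ) l := by
  have hu : opD R x * lunit 2 l = lunit 2 l * opD R x := by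
    simp only [lunit]; split_ifs <;> simp
  have h0 : (kap σ [] + lunit 2 ([] : List (Fin (N + 1))) : Op R x) = 0 := by
    simp [kap_nil, lunit]
  simp only [gapOp, lsgn_add, lsgn_lunit_two, ldelInt, lcup_add_left, lcup_add_right, ldel_add,
    ldel_lunit_two, Pi.add_apply, Pi.sub_apply, mul_add, add_mul, hu, opD_kap σ h, h0, zero_mul,
    sub_zero]
  abel

/-- The sign involution S squares to 1 and anticommutes with D; moving one copy of S across the cut
changes the cup square of `gapOp` into that of `psi`. -/
lemma opD_psi (σ : X _⦋N⦌) {l : List (Fin (N + 1))} (h : l.Pairwise (· ≤ ·)) :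
    opD R x * psi σ l = -lsgn (psi σ) l * opD R x - ldelInt (psi σ) l
      + lsgn (lcup (psi σ) (psi σ)) l * opS R x := by
  have hp : (psi σ : _ → Op R x) = fun l => gapOp σ l * opS R x := rfl
  have hq : (fun l => opS R x * (gapOp σ l * opS R x)) = lsgn (gapOp σ) := by
    funext l
    rw [← mul_assoc, opS_gap, mul_assoc, opS_opS, mul_one]
  have hc : lsgn (lcup (psi σ) (psi σ)) = -lcup (lsgn (gapOp σ : _ → Op R x)) (gapOp σ) := by
    rw [hp, lcup_mul_mid, hq, ← neg_eq_iff_eq_neg, ← lcup_lsgn, lsgn_lsgn]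
  rw [hc, hp, ldelInt_mul_right, lsgn_mul_right, ← mul_assoc, opD_gap σ h]
  exact sub_mul_of_anticomm opD_opS _ _ _

lemma opD_lexp (σ : X _⦋N⦌) (f : List (Fin (N + 1)) → R) {l : List (Fin (N + 1))}
    (h : l.Pairwise (· ≤ ·)) :
    opD R x * lexp (psi σ) f l = -lsgn (lexp (psi σ) f) l * opD R x - ldelInt (lexp (psi σ) f) l
      + lsgn (lexp (psi σ) (lsgn (ldelInt f))) l * opS R x :=
  lexp_comm (psi_nil σ) (psi_singleton σ) (opS_psi σ) (fun _ hm _ => opD_psi σ (h.sublist hm)) f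

end AcyclicBar

end

/-! ### The operations as augmented expansions -/

noncomputable section

namespace AcyclicBar

universe u v

lemma tprod_zero {R M : Type*} [CommRing R] [AddCommGroup M] [Module R M] (a : Fin 0 → M) :
    TensorAlgebra.tprod R M 0 a = 1 := by
  simp [TensorAlgebra.tprod_apply]

lemma tprod_succ {R M : Type*} [CommRing R] [AddCommGroup M] [Module R M] {n : ℕ}
    (a : Fin (n + 1) → M) : TensorAlgebra.tprod R M (n + 1) a
      = TensorAlgebra.ι R (a 0) * TensorAlgebra.tprod R M n fun i => a i.succ := by
  simp [TensorAlgebra.tprod_apply, List.ofFn_succ]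

variable {R : Type v} [CommRing R] {X : SSet.{u}} {x : X _⦋0⦌} {N : ℕ}

variable (R x) in
/-- The counit of the bar construction. -/
def counit : Bar R x →ₐ[R] R := TensorAlgebra.algebraMapInv

lemma counit_cons (m : Cbar R x) (y : Bar R x) : counit R x (TensorAlgebra.ι R m * y) = 0 := by
  simp [counit, TensorAlgebra.algebraMapInv]

lemma signBar_tprod {n : ℕ} (a : Fin n → Cbar R x) : signBar R x (TensorAlgebra.tprod R _ n a)
    = TensorAlgebra.tprod R _ n fun i => invBar R x (a i) := by
  induction n with
  | zero => rw [tprod_zero, tprod_zero, map_one]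
  | succ n ih => rw [tprod_succ, tprod_succ, signBar_cons, ih]

lemma psi_unop_one (σ : X _⦋N⦌) (l : List (Fin (N + 1))) :
    (psi σ l : Op R x).unop 1 = (lunit 2 l : R) • 1 := by
  change signBar R x (contr (evBar σ l) 1 + (lunit 2 l : Op R x).unop 1) = _
  rw [contr_one, zero_add]
  simp only [lunit]
  split_ifs
  · simp
  · simp

lemma psi_unop_cons (σ : X _⦋N⦌) (l : List (Fin (N + 1))) (a : Cbar R x) (y : Bar R x) :
    (psi σ l : Op R x).unop (TensorAlgebra.ι R a * y) = ev σ a.1 l • signBar R x y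
      + (lunit 2 l : R) • signBar R x (TensorAlgebra.ι R a * y) := by
  change signBar R x (contr (evBar σ l) _ + (lunit 2 l : Op R x).unop _) = _
  rw [contr_cons, map_add, map_smul]
  congr 1
  simp only [lunit]
  split_ifs
  · simp
  · simp

lemma extend_cons_zero {k j : ℕ} {B : Type*} (f : Fin k → Fin j)
    (a : Fin (k + 1) → B) (e : Fin (j + 1) → B) :
    Function.extend (Fin.cons 0 fun i => (f i).succ : Fin (k + 1) → Fin (j + 1)) a e 0 = a 0 := by
  have h : ∃ i, (Fin.cons 0 fun i => (f i).succ : Fin (k + 1) → Fin (j + 1)) i = 0 := ⟨0, rfl⟩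
  have h0 : h.choose = 0 := by
    by_contra hne
    obtain ⟨i, hi⟩ := Fin.exists_succ_eq.mpr hne
    have := h.choose_spec
    rw [← hi, Fin.cons_succ] at this
    exact Fin.succ_ne_zero _ this
  rw [Function.extend_def, dif_pos h]
  exact congrArg a h0

lemma extend_cons_succ {k j : ℕ} {B : Type*} {f : Fin k → Fin j} (hf : StrictMono f)
    (a : Fin (k + 1) → B) (e : Fin (j + 1) → B) (q : Fin j) :
    Function.extend (Fin.cons 0 fun i => (f i).succ : Fin (k + 1) → Fin (j + 1)) a e q.succ
      = Function.extend f (fun i => a i.succ) (fun q => e q.succ) q := by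
  by_cases hq : ∃ i, f i = q
  · obtain ⟨i, rfl⟩ := hq
    rw [hf.injective.extend_apply]
    have hinj : Function.Injective
        (Fin.cons 0 fun i => (f i).succ : Fin (k + 1) → Fin (j + 1)) := by
      rw [Fin.cons_injective_iff]
      exact ⟨by simp, (Fin.succ_injective _).comp hf.injective⟩
    have := hinj.extend_apply a e i.succ
    rwa [Fin.cons_succ] at this
  · rw [Function.extend_apply' _ _ _ hq, Function.extend_apply']
    rintro ⟨i, hi⟩
    induction i using Fin.cases with
    | zero => simp [Fin.ext_iff] at hi
    | succ i => exact hq ⟨i, by simpa using hi⟩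

lemma extend_succ_zero {k j : ℕ} {B : Type*} (f : Fin k → Fin j)
    (a : Fin k → B) (e : Fin (j + 1) → B) :
    Function.extend (fun i => (f i).succ) a e 0 = e 0 := by
  rw [Function.extend_apply']
  rintro ⟨i, hi⟩
  simp [Fin.ext_iff] at hi

lemma extend_succ_succ {k j : ℕ} {B : Type*} {f : Fin k → Fin j} (hf : StrictMono f)
    (a : Fin k → B) (e : Fin (j + 1) → B) (q : Fin j) :
    Function.extend (fun i => (f i).succ) a e q.succ
      = Function.extend f a (fun q => e q.succ) q := by
  by_cases hq : ∃ i, f i = q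
  · obtain ⟨i, rfl⟩ := hq
    rw [hf.injective.extend_apply]
    exact ((Fin.succ_injective _).comp hf.injective).extend_apply a e i
  · rw [Function.extend_apply' _ _ _ hq, Function.extend_apply']
    rintro ⟨i, hi⟩
    exact hq ⟨i, by simpa using hi⟩

/-- The slots filled with ε carry no sign: ε lives on lists of length 2, which is even. -/
lemma ev_extend_invBar (σ : X _⦋N⦌) {k j : ℕ} {f : Fin k → Fin j} (hf : StrictMono f)
    (a : Fin k → Cbar R x) (q : Fin j) {L : List (Fin (N + 1))}
    (hL : ev σ (eps x : Coch R X) L = lunit 2 L) :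
    ev σ (Function.extend f (fun i => (invBar R x (a i)).1) (fun _ => eps x) q) L
      = (-1) ^ L.length * ev σ (Function.extend f (fun i => (a i).1) (fun _ => eps x) q) L := by
  by_cases hq : ∃ i, f i = q
  · obtain ⟨i, rfl⟩ := hq
    rw [hf.injective.extend_apply, hf.injective.extend_apply]
    exact evBar_invBar σ (a i) L
  · rw [Function.extend_apply' _ _ _ hq, Function.extend_apply' _ _ _ hq, hL]
    simp only [lunit]
    split_ifs with h
    · simp [h]
    · simp

/-- The value on a word of the product of the operators attached to a sequence of gaps. -/
lemma counit_prod_psi (σ : X _⦋N⦌) {j : ℕ} (L : Fin j → List (Fin (N + 1)))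
    (h2 : ∀ q, 2 ≤ (L q).length) (hL : ∀ q, ev σ (eps x : Coch R X) (L q) = lunit 2 (L q))
    {k : ℕ} (a : Fin k → Cbar R x) :
    counit R x ((List.ofFn fun q => (psi σ (L q) : Op R x)).prod.unop
      (TensorAlgebra.tprod R _ k a)) = sumEmb k j fun f =>
        (-1) ^ (∑ q : Fin j, (q : ℕ) * ((L q).length - 2)) *
          ∏ q, ev σ (Function.extend f (fun i => (a i).1) (fun _ => eps x) q) (L q) := by
  induction j generalizing k with
  | zero =>
    cases k with
    | zero => rw [sumEmb_zero_left, tprod_zero]; simp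
    | succ k => rw [sumEmb_of_lt (Nat.succ_pos k), tprod_succ]; simp [counit_cons]
  | succ j ih =>
    -- The involution that belongs to the first gap acts once on every later letter and thereby
    -- raises each weight q by one.
    have hsgn : ((-1 : R) ^ (∑ q : Fin (j + 1), (q : ℕ) * ((L q).length - 2)))
        = (-1) ^ (∑ q : Fin j, (q : ℕ) * ((L q.succ).length - 2))
          * ∏ q : Fin j, (-1) ^ (L q.succ).length := by
      rw [Fin.sum_univ_succ, Finset.prod_pow_eq_pow_sum, ← pow_add, ← Finset.sum_add_distrib]
      have : ∀ q : Fin j, (-1 : R) ^ ((q.succ : ℕ) * ((L q.succ).length - 2))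
          = (-1) ^ ((q : ℕ) * ((L q.succ).length - 2) + (L q.succ).length) := fun q => by
        have h := h2 q.succ
        obtain ⟨t, ht⟩ := Nat.exists_eq_add_of_le h
        rw [ht, Fin.val_succ, Nat.add_sub_cancel_left, add_mul, one_mul, ← add_assoc, pow_add,
          pow_add, pow_add]
        simp
      simp only [Fin.val_zero, zero_mul, zero_add, ← Finset.prod_pow_eq_pow_sum, this]
    have step : ∀ {k' : ℕ} (a' : Fin k' → Cbar R x), counit R x
        ((List.ofFn fun q : Fin j => (psi σ (L q.succ) : Op R x)).prod.unop
          (signBar R x (TensorAlgebra.tprod R _ k' a'))) = sumEmb k' j fun f =>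
        (-1) ^ (∑ q : Fin (j + 1), (q : ℕ) * ((L q).length - 2)) *
          ∏ q : Fin j, ev σ (Function.extend f (fun i => (a' i).1) (fun _ => eps x) q)
            (L q.succ) := by
      intro k' a'
      rw [signBar_tprod, ih (fun q => L q.succ) (fun q => h2 _) (fun q => hL _)]
      refine sumEmb_congr fun f hf => ?_
      rw [hsgn, mul_assoc, ← Finset.prod_mul_distrib]
      congr 1
      exact Finset.prod_congr rfl fun q _ => ev_extend_invBar σ hf a' q (hL _)
    rw [List.ofFn_succ, List.prod_cons, MulOpposite.unop_mul, Module.End.mul_apply]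
    cases k with
    | zero =>
      rw [tprod_zero, psi_unop_one, map_smul, map_smul]
      have := step (fun i : Fin 0 => (i.elim0 : Cbar R x))
      rw [tprod_zero, map_one] at this
      rw [this, sumEmb_zero_left, sumEmb_zero_left, Fin.prod_univ_succ]
      have he : ∀ {j : ℕ} (f : Fin 0 → Fin j) (b : Fin 0 → Coch R X) (q : Fin j),
          Function.extend f b (fun _ => (eps x : Coch R X)) q = eps x := fun f b q =>
        Function.extend_apply' _ _ _ (by rintro ⟨i, -⟩; exact i.elim0)
      simp only [he, hL, smul_eq_mul]
      ring
    | succ k =>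
      -- The first gap takes the first letter or an ε; these are the two kinds of increasing maps in
      -- `sumEmb_succ`.
      rw [tprod_succ, psi_unop_cons, ← tprod_succ, map_add, map_add, map_smul, map_smul, map_smul,
        map_smul, step, step, sumEmb_succ]
      congr 1
      · rw [← LinearMap.lsmul_apply (R := R), map_sumEmb]
        refine sumEmb_congr fun f hf => ?_
        rw [Fin.prod_univ_succ, extend_cons_zero]
        simp only [extend_cons_succ hf, LinearMap.lsmul_apply, smul_eq_mul]
        ring
      · rw [← LinearMap.lsmul_apply (R := R), map_sumEmb]
        refine sumEmb_congr fun f hf => ?_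
        rw [Fin.prod_univ_succ, extend_succ_zero, hL]
        simp only [extend_succ_succ hf, LinearMap.lsmul_apply, smul_eq_mul]
        ring

/-- The triviality of the 1-simplices enters the argument here: it makes ε equal to 1 on every edge
of σ. -/
lemma ev_eps (hX : ∀ e : X _⦋1⦌, e = constSimplex X x 1) (σ : X _⦋N⦌) {L : List (Fin (N + 1))}
    (h : L.Pairwise (· ≤ ·)) : ev σ (eps x : Coch R X) L = lunit 2 L := by
  match L, h with
  | [], _ => simp [lunit]
  | [v], h => simp [ev, eps, lunit]
  | [v, w], h =>
    rw [ev_eq σ _ (n := 1) rfl (monotone_get h rfl) fun _ => rfl]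
    simp only [lunit, eps, List.length_cons, List.length_nil, zero_add, Nat.reduceAdd, if_true,
      true_and]
    exact if_pos ⟨rfl, hX _⟩
  | v :: w :: z :: l, h =>
    simp only [ev]
    rw [eps_of_ne (by simp)]
    simp [lunit]

/-- The operations `E_{k,1}` in terms of vertex lists. -/
lemma ev_opFun (hX : ∀ e : X _⦋1⦌, e = constSimplex X x 1) (σ : X _⦋N⦌) {k : ℕ}
    (a : Fin k → Cbar R x) (a₀ : Coch R X) {l : List (Fin (N + 1))} (h : l.Pairwise (· ≤ ·)) :
    ev σ (opFun x k (fun i => (a i).1) a₀) l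
      = counit R x ((lexp (psi σ) (ev σ a₀) l : Op R x).unop (TensorAlgebra.tprod R _ k a)) := by
  cases l with
  | nil => simp
  | cons v l =>
    rw [ev_eq σ _ (n := l.length) rfl (monotone_get h rfl) (fun _ => rfl), lexp_eq_sum,
      Finset.unop_sum, LinearMap.sum_apply, map_sum, opFun]
    refine Finset.sum_congr rfl fun j hj => ?_
    unfold opTilde
    -- The definition chooses the slots of the letters before the vertices, the expansion chooses
    -- the vertices first.
    rw [Finset.sum_comm]
    let φ : Op R x →+ R := ⟨⟨fun P => counit R x (P.unop (TensorAlgebra.tprod R _ k a)), by simp⟩,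
      fun P Q => by simp⟩
    change _ = φ _
    rw [map_sumEmb]
    refine Finset.sum_congr rfl fun g _ => ?_
    by_cases hg : g 0 = 0 ∧ g (Fin.last j) = Fin.last l.length
    swap
    · simp [hg]
    simp only [hg, and_self, if_true]
    have hpos : ∀ q : Fin j, (g q.castSucc : ℕ) < g q.succ := gap_pos g
    have hlt : ∀ i, (g i : ℕ) ≤ l.length := fun i => Nat.le_of_lt_succ (g i).2
    have hlen : ∀ q : Fin j, (lseg (v :: l) (g q.castSucc) (g q.succ)).length
        = (g q.succ : ℕ) - g q.castSucc + 1 := fun q => by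
      have h1 := hpos q
      have h2 := hlt q.succ
      simp only [lseg, List.length_take, List.length_drop, List.length_cons]
      omega
    have hseg : ∀ (q : Fin j) (c : Coch R X), ev σ c (lseg (v :: l) (g q.castSucc) (g q.succ))
        = c ((g q.succ : ℕ) - g q.castSucc) (segment (face σ (fun i : Fin (l.length + 1) =>
            (v :: l).get i) (monotone_get h rfl)) (g q.castSucc)
              ((g q.succ : ℕ) - g q.castSucc) (gap_le g q)) := fun q c => by
      rw [segment_face]
      refine ev_eq σ c (hlen q) _ fun i => ?_
      simp [lseg, Nat.add_comm (i : ℕ)]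
      rfl
    have hprod := counit_prod_psi σ (fun q : Fin j => lseg (v :: l) (g q.castSucc) (g q.succ))
      (fun q => by rw [hlen]; have := hpos q; omega)
      (fun q => ev_eps hX σ (h.sublist ((List.take_sublist _ _).trans (List.drop_sublist _ _)))) a
    have hsub : ev σ a₀ (List.ofFn fun i => (v :: l).get (g i)) = a₀ j (subface (face σ
        (fun i : Fin (l.length + 1) => (v :: l).get i) (monotone_get h rfl)) g) := by
      unfold subface
      rw [map_face]
      refine ev_eq σ a₀ (by simp) _ fun i => ?_
      rw [List.get_eq_getElem, List.getElem_ofFn]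
      rfl
    have hmul : ∀ (P : Op R x) (r : R), φ (P * algebraMap R _ r) = φ P * r := fun P r => by
      rw [← Algebra.commutes, ← Algebra.smul_def, mul_comm]
      exact map_smul (counit R x) r _
    rw [hmul]
    rw [hsub]
    refine Eq.trans ?_ (congrArg (· * _) hprod.symm)
    simp only [hseg, hlen]
    unfold sumEmb
    rw [Finset.sum_mul]
    refine Finset.sum_congr rfl fun f _ => ?_
    rfl

end AcyclicBar

end

/-! ### Convolution over deconcatenations -/

noncomputable section

namespace AcyclicBar

universe u v

section Convolution

variable {R M : Type*} [CommRing R] [AddCommGroup M] [Module R M]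
  {A B D A' B' D' H : Type*} [AddCommGroup A] [Module R A] [AddCommGroup B] [Module R B]
  [AddCommGroup D] [Module R D] [AddCommGroup A'] [Module R A'] [AddCommGroup B'] [Module R B']
  [AddCommGroup D'] [Module R D'] [AddCommGroup H] [Module R H]

/-- The convolution `x ↦ ∑ β (f x') (g x'')` over the deconcatenations of `x`. -/
def cv (β : A →ₗ[R] B →ₗ[R] D) : (TensorAlgebra R M →ₗ[R] A) →ₗ[R] (TensorAlgebra R M →ₗ[R] B) →ₗ[R]
    (TensorAlgebra R M →ₗ[R] D) :=
  LinearMap.mk₂ R (fun f g => TensorProduct.lift β ∘ₗ TensorProduct.map f g ∘ₗ deconcat R M)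
    (fun f f' g => by rw [TensorProduct.map_add_left]; ext; simp)
    (fun r f g => by rw [TensorProduct.map_smul_left]; ext; simp)
    (fun f g g' => by rw [TensorProduct.map_add_right]; ext; simp)
    (fun r f g => by rw [TensorProduct.map_smul_right]; ext; simp)

/-- Concatenation with a letter. -/
def consMap (m : M) : TensorAlgebra R M →ₗ[R] TensorAlgebra R M :=
  LinearMap.mulLeft R (TensorAlgebra.ι R m)

lemma consMap_apply (m : M) (y : TensorAlgebra R M) : consMap m y = TensorAlgebra.ι R m * y := rfl

lemma cv_one (β : A →ₗ[R] B →ₗ[R] D) (f : TensorAlgebra R M →ₗ[R] A)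
    (g : TensorAlgebra R M →ₗ[R] B) : cv β f g 1 = β (f 1) (g 1) := by
  simp [cv, deconcat_one]

/-- The initial piece is either empty or starts with m. -/
lemma cv_cons (β : A →ₗ[R] B →ₗ[R] D) (f : TensorAlgebra R M →ₗ[R] A)
    (g : TensorAlgebra R M →ₗ[R] B) (m : M) (y : TensorAlgebra R M) :
    cv β f g (TensorAlgebra.ι R m * y)
      = β (f 1) (g (TensorAlgebra.ι R m * y)) + cv β (f ∘ₗ consMap m) g y := by
  simp only [cv, LinearMap.mk₂_apply, LinearMap.comp_apply, deconcat_cons, map_add,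
    TensorProduct.map_tmul, TensorProduct.lift.tmul]
  congr 1
  rw [← LinearMap.comp_apply (TensorProduct.map f g), LinearMap.map_comp_rTensor]
  rfl

lemma cv_congr_map (β : A →ₗ[R] B →ₗ[R] D) (β' : A' →ₗ[R] B' →ₗ[R] D)
    {f : TensorAlgebra R M →ₗ[R] A} {g : TensorAlgebra R M →ₗ[R] B}
    {f' : TensorAlgebra R M →ₗ[R] A'} {g' : TensorAlgebra R M →ₗ[R] B'}
    (h : ∀ y z, β (f y) (g z) = β' (f' y) (g' z)) : cv β f g = cv β' f' g' := by
  refine LinearMap.ext fun y => ?_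
  simp only [cv, LinearMap.mk₂_apply, LinearMap.comp_apply]
  generalize deconcat R M y = t
  induction t with
  | zero => simp
  | tmul a b => simpa using h a b
  | add a b ha hb => simp only [map_add, ha, hb]

lemma cv_congr_sum {ι : Type*} (s : Finset ι) (β : A →ₗ[R] B →ₗ[R] D)
    (β' : ι → A' →ₗ[R] B' →ₗ[R] D)
    {f : TensorAlgebra R M →ₗ[R] A} {g : TensorAlgebra R M →ₗ[R] B}
    {f' : ι → TensorAlgebra R M →ₗ[R] A'} {g' : ι → TensorAlgebra R M →ₗ[R] B'}
    (h : ∀ y z, β (f y) (g z) = ∑ i ∈ s, β' i (f' i y) (g' i z)) :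
    cv β f g = ∑ i ∈ s, cv (β' i) (f' i) (g' i) := by
  refine LinearMap.ext fun y => ?_
  simp only [cv, LinearMap.mk₂_apply, LinearMap.comp_apply, LinearMap.sum_apply]
  generalize deconcat R M y = t
  induction t with
  | zero => simp
  | tmul a b => simpa using h a b
  | add a b ha hb => simp only [map_add, ha, hb, Finset.sum_add_distrib]

lemma cv_eq_zero (β : A →ₗ[R] B →ₗ[R] D) {f : TensorAlgebra R M →ₗ[R] A}
    {g : TensorAlgebra R M →ₗ[R] B} (h : ∀ y z, β (f y) (g z) = 0) : cv β f g = 0 :=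
  (cv_congr_sum (ι := Fin 0) Finset.univ β (fun _ => β) (f' := fun _ => f) (g' := fun _ => g)
    fun y z => by simp [h]).trans (by simp)

lemma comp_cv (β : A →ₗ[R] B →ₗ[R] D) (f : TensorAlgebra R M →ₗ[R] A)
    (g : TensorAlgebra R M →ₗ[R] B) (φ : D →ₗ[R] D') :
    φ ∘ₗ cv β f g = cv (β.compr₂ φ) f g := by
  refine LinearMap.ext fun y => ?_
  simp only [cv, LinearMap.mk₂_apply, LinearMap.comp_apply]
  generalize deconcat R M y = t
  induction t with
  | zero => simp
  | tmul a b => simp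
  | add a b ha hb => simp only [map_add, ha, hb]

/-- Only the cut with empty initial piece survives. -/
lemma cv_unit_left (β : A →ₗ[R] B →ₗ[R] D) {f : TensorAlgebra R M →ₗ[R] A}
    (g : TensorAlgebra R M →ₗ[R] B) (hf : ∀ m y, f (TensorAlgebra.ι R m * y) = 0) :
    cv β f g = β (f 1) ∘ₗ g := by
  refine word_ext' (cv_one _ _ _) fun m y => ?_
  have : f ∘ₗ consMap m = 0 := LinearMap.ext fun y => hf m y
  rw [cv_cons, this, map_zero]
  simp

lemma cv_unit_right (β : A →ₗ[R] B →ₗ[R] D) (f : TensorAlgebra R M →ₗ[R] A)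
    {g : TensorAlgebra R M →ₗ[R] B} (hg : ∀ m y, g (TensorAlgebra.ι R m * y) = 0) :
    cv β f g = β.flip (g 1) ∘ₗ f := by
  refine LinearMap.ext fun y => ?_
  induction y using word_induction generalizing f with
  | one => exact cv_one _ _ _
  | cons m y ih =>
    rw [cv_cons, hg, ih, map_zero, zero_add]
    rfl
  | add y z hy hz => rw [map_add, hy, hz, map_add]
  | smul r y hy => rw [map_smul, hy, map_smul]

/-- Coassociativity of deconcatenation. Four different pairings are allowed, so that it covers
products, actions and tensors alike. -/
lemma cv_assoc {β : A' →ₗ[R] D →ₗ[R] H} {γ : A →ₗ[R] B →ₗ[R] A'} {β' : A →ₗ[R] B' →ₗ[R] H}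
    {γ' : B →ₗ[R] D →ₗ[R] B'} (h : ∀ a b c, β (γ a b) c = β' a (γ' b c))
    (f : TensorAlgebra R M →ₗ[R] A) (g : TensorAlgebra R M →ₗ[R] B)
    (k : TensorAlgebra R M →ₗ[R] D) : cv β (cv γ f g) k = cv β' f (cv γ' g k) := by
  refine LinearMap.ext fun y => ?_
  induction y using word_induction generalizing f with
  | one => simp only [cv_one, h]
  | cons m y ih =>
    have e : cv γ f g ∘ₗ consMap m = γ (f 1) ∘ₗ (g ∘ₗ consMap m) + cv γ (f ∘ₗ consMap m) g :=
      LinearMap.ext fun z => cv_cons γ f g m z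
    rw [cv_cons, e, map_add, LinearMap.add_apply, LinearMap.add_apply, ih, cv_cons, cv_one,
      cv_cons γ', map_add, ← h, add_assoc]
    congr 2
    have e1 : cv β (γ (f 1) ∘ₗ (g ∘ₗ consMap m)) k = β' (f 1) ∘ₗ cv γ' (g ∘ₗ consMap m) k := by
      rw [comp_cv]
      exact cv_congr_map _ _ fun y z => h _ _ _
    exact LinearMap.congr_fun e1 y
  | add y z hy hz => rw [map_add, hy, hz, map_add]
  | smul r y hy => rw [map_smul, hy, map_smul]

end Convolution

end AcyclicBar

end

noncomputable section

namespace AcyclicBar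

universe u v

variable {R : Type v} [CommRing R] {X : SSet.{u}} {x : X _⦋0⦌} {N : ℕ}

/-! ### Homogeneous components -/

/-- The component of degree `n`. -/
def component (n : ℕ) (a : Coch R X) : Coch R X := fun m => if m = n then a m else 0

lemma component_mem (n : ℕ) {a : Coch R X} (ha : a ∈ cochains R x) :
    component n a ∈ cochains R x := by
  obtain ⟨⟨N, hN⟩, ha⟩ := ha
  refine ⟨⟨N, fun m hm => ?_⟩, fun m hm => ?_⟩
  · simp [component, hN m hm]
  · unfold component
    split_ifs
    · exact ha m hm
    · rfl

lemma isHomog_component (n : ℕ) (a : Coch R X) : IsHomog n (component n a) := fun _ hm =>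
  if_neg hm

/-- A cochain vanishes in large degrees, so its top component can be split off repeatedly. -/
lemma C_induction {P : C R x → Prop} (zero : P 0) (add : ∀ a b, P a → P b → P (a + b))
    (homog : ∀ q a, IsHomog q a.1 → P a) (a : C R x) : P a := by
  obtain ⟨N, hN⟩ := a.2.1
  induction N generalizing a with
  | zero =>
    have : a = 0 := Subtype.ext (funext fun n => hN n (Nat.zero_le n))
    rwa [this]
  | succ N ih =>
    let c : C R x := ⟨component N a.1, component_mem N a.2⟩
    have h : a = c + (a - c) := by abel
    rw [h]
    refine add _ _ (homog N c (isHomog_component N a.1)) (ih _ fun n hn => ?_)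
    change a.1 n - component N a.1 n = 0
    unfold component
    split_ifs with h'
    · exact sub_self _
    · rw [hN n (by omega), sub_zero]

lemma Cbar_induction {P : Cbar R x → Prop} (zero : P 0) (add : ∀ a b, P a → P b → P (a + b))
    (homog : ∀ q a, IsHomog (q + 1) a.1 → P a) (a : Cbar R x) : P a := by
  obtain ⟨N, hN⟩ := a.2.1.1
  have h0 : a.1 0 = 0 := a.2.2
  induction N generalizing a with
  | zero =>
    have : a = 0 := Subtype.ext (funext fun n => hN n (Nat.zero_le n))
    rwa [this]
  | succ N ih =>
    cases N with
    | zero =>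
      have : a = 0 := Subtype.ext (funext fun n => by
        cases n with
        | zero => exact h0
        | succ n => exact hN _ (by omega))
      rwa [this]
    | succ N =>
      let c : Cbar R x := ⟨component (N + 1) a.1, component_mem _ a.2.1,
        show component (N + 1) a.1 0 = 0 from if_neg (by simp)⟩
      have h : a = c + (a - c) := by abel
      rw [h]
      refine add _ _ (homog N c (isHomog_component _ a.1)) (ih _ (fun n hn => ?_) ?_)
      · change a.1 n - component (N + 1) a.1 n = 0
        unfold component
        split_ifs with h'
        · exact sub_self _
        · rw [hN n (by omega), sub_zero]
      · change a.1 0 - component (N + 1) a.1 0 = 0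
        rw [h0]
        simp [component]

variable (R x) in
/-- A homogeneous letter. -/
structure HLetter where
  /-- The degree in the bar construction. -/
  deg : ℕ
  /-- The letter. -/
  val : Cbar R x
  homog : IsHomog (deg + 1) val.1

/-- The word with given homogeneous letters. -/
def hword (l : List (HLetter R x)) : Bar R x := (l.map fun a => TensorAlgebra.ι R a.val).prod

/-- The degree of a word. -/
def hdeg (l : List (HLetter R x)) : ℕ := (l.map HLetter.deg).sum

@[simp] lemma hword_nil : hword ([] : List (HLetter R x)) = 1 := rfl

@[simp] lemma hword_cons (a : HLetter R x) (l : List (HLetter R x)) :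
    hword (a :: l) = TensorAlgebra.ι R a.val * hword l := by
  simp [hword]

@[simp] lemma hdeg_nil : hdeg ([] : List (HLetter R x)) = 0 := rfl

@[simp] lemma hdeg_cons (a : HLetter R x) (l : List (HLetter R x)) :
    hdeg (a :: l) = a.deg + hdeg l := by
  simp [hdeg]

lemma mem_span_hword (y : Bar R x) : y ∈ Submodule.span R (Set.range (hword (R := R) (x := x))) := by
  induction y using word_induction with
  | one => exact Submodule.subset_span ⟨[], rfl⟩
  | cons m y hy =>
    induction m using Cbar_induction with
    | zero => rw [map_zero, zero_mul]; exact Submodule.zero_mem _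
    | add a b ha hb => rw [map_add, add_mul]; exact Submodule.add_mem _ ha hb
    | homog q a ha =>
      induction hy using Submodule.span_induction with
      | mem z hz =>
        obtain ⟨l, rfl⟩ := hz
        exact Submodule.subset_span ⟨⟨q, a, ha⟩ :: l, hword_cons _ _⟩
      | zero => rw [mul_zero]; exact Submodule.zero_mem _
      | add y z _ _ hy hz => rw [mul_add]; exact Submodule.add_mem _ hy hz
      | smul r y _ hy => rw [mul_smul_comm]; exact Submodule.smul_mem _ _ hy
  | add y z hy hz => exact Submodule.add_mem _ hy hz
  | smul r y hy => exact Submodule.smul_mem _ _ hy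

/-- Linear maps that agree on words with homogeneous letters are equal. -/
lemma hword_ext {B : Type*} [AddCommGroup B] [Module R B] {f g : Bar R x →ₗ[R] B}
    (h : ∀ l, f (hword l) = g (hword l)) : f = g := by
  refine LinearMap.ext fun y => ?_
  induction mem_span_hword y using Submodule.span_induction with
  | mem z hz => obtain ⟨l, rfl⟩ := hz; exact h l
  | zero => simp
  | add y z _ _ hy hz => simp [hy, hz]
  | smul r y _ hy => simp [hy]

lemma hword_eq_tprod (l : List (HLetter R x)) :
    hword l = TensorAlgebra.tprod R _ l.length fun i => (l.get i).val := by
  rw [TensorAlgebra.tprod_apply, hword]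
  congr 1
  refine List.ext_getElem (by simp) fun i h1 h2 => by simp

/-! ### Signs -/

variable (R x) in
/-- Multiplication by `(-1)^(p * d)` on words of degree `d`. -/
def sgn (p : ℕ) : Bar R x →ₗ[R] Bar R x := (signBar R x).toLinearMap ^ p

lemma sgn_zero (y : Bar R x) : sgn R x 0 y = y := rfl

lemma sgn_succ (p : ℕ) (y : Bar R x) : sgn R x (p + 1) y = signBar R x (sgn R x p y) := by
  unfold sgn
  rw [pow_succ']
  rfl

lemma sgn_one_eq (y : Bar R x) : sgn R x 1 y = signBar R x y := by rw [sgn_succ, sgn_zero]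

lemma sgn_add (p q : ℕ) (y : Bar R x) : sgn R x (p + q) y = sgn R x p (sgn R x q y) := by
  unfold sgn
  rw [pow_add]
  rfl

lemma sgn_eq_iterate (p : ℕ) (y : Bar R x) : sgn R x p y = (signBar R x)^[p] y := by
  unfold sgn
  rw [Module.End.pow_apply]
  rfl

lemma sgn_sgn (p : ℕ) (y : Bar R x) : sgn R x p (sgn R x p y) = y := by
  induction p generalizing y with
  | zero => rfl
  | succ p ih =>
    rw [sgn_succ, sgn_add p 1, sgn_one_eq, ← sgn_succ, add_comm, sgn_add 1 p, ih, sgn_one_eq,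
      signBar_signBar]

lemma sgn_one (p : ℕ) : sgn R x p 1 = 1 := by
  induction p with
  | zero => rfl
  | succ p ih => rw [sgn_succ, ih, signBar_one]

lemma invBar_of_homog {q : ℕ} {a : Cbar R x} (ha : IsHomog (q + 1) a.1) :
    invBar R x a = (-1 : R) ^ q • a := by
  have ha' : ∀ n, n ≠ q + 1 → a.1 n = 0 := ha
  refine Subtype.ext (funext fun n => funext fun σ => ?_)
  change -((-1) ^ n * a.1 n σ) = (-1) ^ q * a.1 n σ
  rcases eq_or_ne n (q + 1) with rfl | hn
  · rw [pow_succ]; ring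
  · rw [ha' n hn]; simp

lemma inv_of_homog {q : ℕ} {a : C R x} (ha : IsHomog q a.1) : inv R x a = (-1 : R) ^ q • a := by
  have ha' : ∀ n, n ≠ q → a.1 n = 0 := ha
  refine Subtype.ext (funext fun n => funext fun σ => ?_)
  change (-1) ^ n * a.1 n σ = (-1) ^ q * a.1 n σ
  rcases eq_or_ne n q with rfl | hn
  · rfl
  · rw [ha' n hn]; simp

lemma signBar_hword (l : List (HLetter R x)) :
    signBar R x (hword l) = (-1 : R) ^ hdeg l • hword l := by
  induction l with
  | nil => simp
  | cons a l ih =>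
    rw [hword_cons, signBar_cons, ih, invBar_of_homog a.homog, hdeg_cons, pow_add, map_smul,
      smul_mul_smul_comm]

lemma sgn_hword (p : ℕ) (l : List (HLetter R x)) :
    sgn R x p (hword l) = (-1 : R) ^ (p * hdeg l) • hword l := by
  induction p with
  | zero => simp [sgn_zero]
  | succ p ih =>
    rw [sgn_succ, ih, map_smul, signBar_hword, smul_smul, ← pow_add]
    congr 2
    ring

variable {A B D : Type*} [AddCommGroup A] [Module R A] [AddCommGroup B] [Module R B]
  [AddCommGroup D] [Module R D]

/-- The degree of a word is the sum of the degrees of its two pieces. -/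
lemma cv_signBar (β : A →ₗ[R] B →ₗ[R] D) (f : Bar R x →ₗ[R] A) (g : Bar R x →ₗ[R] B) :
    cv β f g ∘ₗ (signBar R x).toLinearMap
      = cv β (f ∘ₗ (signBar R x).toLinearMap) (g ∘ₗ (signBar R x).toLinearMap) := by
  refine LinearMap.ext fun y => ?_
  induction y using word_induction generalizing f with
  | one => simp [cv_one]
  | cons m y ih =>
    have e : (f ∘ₗ (signBar R x).toLinearMap) ∘ₗ consMap m
        = (f ∘ₗ consMap (invBar R x m)) ∘ₗ (signBar R x).toLinearMap :=
      LinearMap.ext fun z => by simp [consMap_apply, signBar_cons]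
    rw [cv_cons, e, ← ih]
    simp [signBar_cons, cv_cons]
  | add y z hy hz => rw [map_add, hy, hz, map_add]
  | smul r y hy => rw [map_smul, hy, map_smul]

lemma cv_sgn (p : ℕ) (β : A →ₗ[R] B →ₗ[R] D) (f : Bar R x →ₗ[R] A) (g : Bar R x →ₗ[R] B) :
    cv β f g ∘ₗ sgn R x p = cv β (f ∘ₗ sgn R x p) (g ∘ₗ sgn R x p) := by
  induction p generalizing f g with
  | zero => rfl
  | succ p ih =>
    have e : sgn R x (p + 1) = (signBar R x).toLinearMap ∘ₗ sgn R x p :=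
      LinearMap.ext fun y => sgn_succ p y
    rw [e, ← LinearMap.comp_assoc, cv_signBar, ih]
    rfl

/-! ### The operations on the bar construction -/

variable (R x) in
/-- The operations `E_{k,1}`, as a linear map on the bar construction. -/
def opC : Bar R x →ₗ[R] C R x →ₗ[R] C R x :=
  DirectSum.toModule R ℕ _ (fun k => PiTensorProduct.lift (opE R x k)) ∘ₗ
    TensorAlgebra.toDirectSum.toLinearMap

lemma opC_tprod (k : ℕ) (a : Fin k → Cbar R x) :
    opC R x (TensorAlgebra.tprod R _ k a) = opE R x k a := by
  unfold opC
  rw [LinearMap.comp_apply, AlgHom.toLinearMap_apply,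
    TensorAlgebra.toDirectSum_tensorPower_tprod]
  erw [DirectSum.toModule_lof]
  exact PiTensorProduct.lift.tprod a

lemma incl_injective : Function.Injective (incl R x) := Submodule.inclusion_injective _

lemma incl_opBar (y : Bar R x) (b : Cbar R x) :
    incl R x (opBar R x y b) = opC R x y (incl R x b) := by
  have : incl R x ∘ₗ (opBar R x).flip b = (opC R x).flip (incl R x b) := hword_ext fun l => by
    rw [hword_eq_tprod]
    simp only [LinearMap.comp_apply, LinearMap.flip_apply, opBar_tprod, opC_tprod]
    rfl
  exact LinearMap.congr_fun this y

lemma ev_opC (hX : ∀ e : X _⦋1⦌, e = constSimplex X x 1) (σ : X _⦋N⦌) (y : Bar R x) (c : C R x)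
    {l : List (Fin (N + 1))} (h : l.Pairwise (· ≤ ·)) :
    ev σ (opC R x y c).1 l = counit R x ((lexp (psi σ) (ev σ c.1) l : Op R x).unop y) := by
  let φ : C R x →ₗ[R] R :=
    { toFun := fun a => ev σ a.1 l
      map_add' := fun a b => by rw [Submodule.coe_add, ev_add]; rfl
      map_smul' := fun r a => by rw [Submodule.coe_smul, ev_smul]; rfl }
  have : φ ∘ₗ (opC R x).flip c
      = (counit R x).toLinearMap ∘ₗ (lexp (psi σ) (ev σ c.1) l : Op R x).unop :=
    hword_ext fun l' => by
      rw [hword_eq_tprod]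
      simp only [LinearMap.comp_apply, LinearMap.flip_apply, opC_tprod]
      exact ev_opFun hX σ _ c.1 h
  exact LinearMap.congr_fun this y

end AcyclicBar

end

/-! ### Operators that consume an initial piece of a word -/

noncomputable section

namespace AcyclicBar

universe u v

variable {R : Type v} [CommRing R] {X : SSet.{u}} {x : X _⦋0⦌} {N : ℕ}

/-- Operators that act on an initial piece of a word, with a sign for the rest. -/
def IsShift (p : ℕ) (P : Bar R x →ₗ[R] Bar R x) : Prop :=
  deconcat R (Cbar R x) ∘ₗ P = cv (TensorProduct.mk R _ _) P (sgn R x p)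

lemma cv_mk_id : cv (TensorProduct.mk R _ _) LinearMap.id LinearMap.id
    = deconcat R (Cbar R x) := by
  simp [cv, TensorProduct.lift_mk]

lemma cv_comp_isShift {A B D : Type*} [AddCommGroup A] [Module R A] [AddCommGroup B] [Module R B]
    [AddCommGroup D] [Module R D] {p : ℕ} {P : Bar R x →ₗ[R] Bar R x} (hP : IsShift p P)
    (β : A →ₗ[R] B →ₗ[R] D) (f : Bar R x →ₗ[R] A) (g : Bar R x →ₗ[R] B) :
    cv β f g ∘ₗ P = cv β (f ∘ₗ P) (g ∘ₗ sgn R x p) := by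
  have h : ∀ f' : Bar R x →ₗ[R] A, ∀ g' : Bar R x →ₗ[R] B,
      cv β f' g' = (TensorProduct.lift β ∘ₗ TensorProduct.map f' g') ∘ₗ deconcat R (Cbar R x) :=
    fun _ _ => rfl
  rw [h f g, LinearMap.comp_assoc, hP, comp_cv]
  exact cv_congr_map _ _ fun y z => by simp

lemma isShift_smul_id (r : R) : IsShift 0 (r • LinearMap.id : Bar R x →ₗ[R] Bar R x) := by
  unfold IsShift
  rw [map_smul, LinearMap.smul_apply, LinearMap.comp_smul]
  congr 1
  exact cv_mk_id.symm

lemma isShift_zero (p : ℕ) : IsShift p (0 : Bar R x →ₗ[R] Bar R x) := by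
  unfold IsShift
  rw [map_zero, LinearMap.comp_zero, LinearMap.zero_apply]

lemma IsShift.add {p : ℕ} {P Q : Bar R x →ₗ[R] Bar R x} (hP : IsShift p P) (hQ : IsShift p Q) :
    IsShift p (P + Q) := by
  unfold IsShift at *
  rw [map_add, LinearMap.comp_add, LinearMap.add_apply, hP, hQ]

lemma IsShift.sum {ι : Type*} {s : Finset ι} {p : ℕ} {P : ι → Bar R x →ₗ[R] Bar R x}
    (hP : ∀ i ∈ s, IsShift p (P i)) : IsShift p (∑ i ∈ s, P i) :=
  Finset.sum_induction _ _ (fun _ _ => IsShift.add) (isShift_zero p) hP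

lemma IsShift.comp {p q : ℕ} {P Q : Bar R x →ₗ[R] Bar R x} (hQ : IsShift q Q)
    (hP : IsShift p P) : IsShift (q + p) (Q ∘ₗ P) := by
  unfold IsShift
  rw [← LinearMap.comp_assoc, hQ, cv_comp_isShift hP]
  congr 1
  exact LinearMap.ext fun y => (sgn_add q p y).symm

lemma isShift_signBar : IsShift 1 (signBar R x).toLinearMap := by
  unfold IsShift
  rw [← cv_mk_id, cv_signBar]
  congr 1

lemma isShift_contr (φ : Cbar R x →ₗ[R] R) : IsShift 0 (contr φ) := by
  refine word_ext' ?_ fun m y => ?_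
  · simp [contr_one, cv_one]
  · rw [LinearMap.comp_apply, contr_cons, cv_cons, contr_one, map_smul]
    have : contr φ ∘ₗ consMap m = φ m • LinearMap.id :=
      LinearMap.ext fun z => contr_cons φ m z
    rw [this, map_smul, ← cv_mk_id]
    simp
    rfl

lemma isShift_psi (σ : X _⦋N⦌) (l : List (Fin (N + 1))) :
    IsShift 1 (psi σ l : Op R x).unop := by
  have : (psi σ l : Op R x).unop = (signBar R x).toLinearMap ∘ₗ
      (contr (evBar σ l) + (lunit 2 l : R) • LinearMap.id) := by
    refine word_ext' ?_ fun m y => ?_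
    · rw [psi_unop_one]
      simp [contr_one, signBar_one]
    · rw [psi_unop_cons]
      simp only [LinearMap.comp_apply, LinearMap.add_apply, LinearMap.smul_apply, contr_cons,
        AlgHom.toLinearMap_apply, map_add, map_smul, LinearMap.id_apply]
      rfl
  rw [this]
  have h := (isShift_contr (evBar (x := x) σ l)).add (isShift_smul_id (lunit 2 l : R))
  have h2 := IsShift.comp (isShift_signBar (R := R) (x := x)) h
  rw [Nat.add_zero] at h2
  exact h2

/-- Only sublists with p + 1 members count. They have p gaps, and each gap applies the sign
involution once to the remaining word. -/
lemma isShift_lexp (σ : X _⦋N⦌) {p : ℕ} {f : List (Fin (N + 1)) → R}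
    (hf : ∀ m, m.length ≠ p + 1 → f m = 0) (l : List (Fin (N + 1))) :
    IsShift p (lexp (psi σ) f l : Op R x).unop := by
  induction l using list_suffix_induction generalizing f p with
  | nil => exact isShift_zero p
  | cons v l ih =>
    rw [lexp_cons', MulOpposite.unop_add]
    refine IsShift.add ?_ ?_
    · split_ifs with hl
      · cases p with
        | zero =>
          have := isShift_smul_id (R := R) (x := x) (f [v])
          exact this
        | succ p =>
          rw [hf _ (by simp), map_zero]
          exact isShift_zero _
      · exact isShift_zero p
    · rw [lcup_eq_sum, Finset.unop_sum]
      refine IsShift.sum fun i _ => ?_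
      cases p with
      | zero =>
        have : lexp (psi σ) (lder v f) (l.drop i) = (0 : Op R x) := by
          rw [lexp_congr (psi σ) (f := lder v f) (g := 0) fun m _ hm =>
            hf (v :: m) (by simpa using hm)]
          have := lexp_mul_left (psi σ : _ → Op R x) 0 (0 : List (Fin (N + 1)) → R)
          simp only [zero_mul, zero_smul] at this
          exact congrFun this _
        rw [this, mul_zero]
        exact isShift_zero _
      | succ p =>
        exact (ih (l.drop i) (List.drop_suffix _ _) (p := p)
          (fun m hm => hf _ (by simpa using hm))).comp (isShift_psi σ _)

/-- Applying the counit to the first tensor factor recovers P from its augmented values: these say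
which initial pieces are consumed completely, and the rest only receives a sign. -/
lemma IsShift.eq {p : ℕ} {P : Bar R x →ₗ[R] Bar R x} (hP : IsShift p P) :
    P = cv (LinearMap.lsmul R (Bar R x)) ((counit R x).toLinearMap ∘ₗ P) (sgn R x p) := by
  have h := congrArg (fun Q => TensorProduct.lift (LinearMap.lsmul R (Bar R x) ∘ₗ
    (counit R x).toLinearMap) ∘ₗ Q) hP
  simp only [← LinearMap.comp_assoc] at h
  rw [comp_cv] at h
  have e : TensorProduct.lift (LinearMap.lsmul R (Bar R x) ∘ₗ
      (counit R x).toLinearMap) ∘ₗ deconcat R (Cbar R x) = LinearMap.id := by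
    rw [← cv_mk_id, comp_cv, cv_congr_map _ (LinearMap.lsmul R (Bar R x))
      (f' := (counit R x).toLinearMap) (g' := LinearMap.id) fun y z => by simp,
      cv_unit_left _ _ fun m y => counit_cons m y]
    exact LinearMap.ext fun y => by simp
  rw [e, LinearMap.id_comp] at h
  exact h.trans (cv_congr_map _ _ fun y z => by simp)

end AcyclicBar

end

/-! ### The recursion for right multiplication -/

noncomputable section

namespace AcyclicBar

universe u v

variable {R : Type v} [CommRing R] {X : SSet.{u}} {x : X _⦋0⦌} {N : ℕ}

section Letters

variable {M A : Type*} [AddCommGroup M] [Module R M] [AddCommGroup A] [Module R A]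

variable (R M) in
/-- Concatenation of a letter and a word. -/
def consB : M →ₗ[R] TensorAlgebra R M →ₗ[R] TensorAlgebra R M :=
  LinearMap.mul R _ ∘ₗ TensorAlgebra.ι R

lemma consB_apply (m : M) (y : TensorAlgebra R M) : consB R M m y = TensorAlgebra.ι R m * y := rfl

variable (R M) in
/-- The projection to words of length one. -/
def letter : TensorAlgebra R M →ₗ[R] M :=
  (TensorProduct.rid R M).toLinearMap ∘ₗ
    LinearMap.lTensor M TensorAlgebra.algebraMapInv.toLinearMap ∘ₗ uncons R M

lemma letter_one : letter R M 1 = 0 := by simp [letter, uncons_one]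

lemma letter_cons (m : M) (y : TensorAlgebra R M) :
    letter R M (TensorAlgebra.ι R m * y) = TensorAlgebra.algebraMapInv (R := R) y • m := by
  simp [letter, uncons_cons]

lemma cv_letter_one {D : Type*} [AddCommGroup D] [Module R D] (β : M →ₗ[R] A →ₗ[R] D)
    (g : TensorAlgebra R M →ₗ[R] A) : cv β (letter R M) g 1 = 0 := by
  rw [cv_one, letter_one, map_zero, LinearMap.zero_apply]

/-- `letter` detects words of length one, so only the cut right after the first letter survives. -/
lemma cv_letter_cons {D : Type*} [AddCommGroup D] [Module R D] (β : M →ₗ[R] A →ₗ[R] D)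
    (g : TensorAlgebra R M →ₗ[R] A) (m : M) (y : TensorAlgebra R M) :
    cv β (letter R M) g (TensorAlgebra.ι R m * y) = β m (g y) := by
  rw [cv_cons, letter_one, map_zero, LinearMap.zero_apply, zero_add, cv_unit_left]
  · have h : (letter R M ∘ₗ consMap m) 1 = m := by
      rw [LinearMap.comp_apply, consMap_apply, letter_cons]
      simp
    rw [h]
    rfl
  · intro m' y
    rw [LinearMap.comp_apply, consMap_apply, letter_cons]
    simp [TensorAlgebra.algebraMapInv]

lemma contr_cv_consB (φ : M →ₗ[R] R) (h : TensorAlgebra R M →ₗ[R] M)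
    (g : TensorAlgebra R M →ₗ[R] TensorAlgebra R M) :
    contr φ ∘ₗ cv (consB R M) h g = cv (LinearMap.lsmul R _) (φ ∘ₗ h) g := by
  rw [comp_cv]
  exact cv_congr_map _ _ fun y z => contr_cons _ _ _

end Letters

/-- Right multiplication on the bar construction. -/
def rmul (y : Bar R x) : Bar R x →ₗ[R] Bar R x := (barMul R x).flip y

/-- The operations with last argument `b`. -/
def opL (b : Cbar R x) : Bar R x →ₗ[R] Cbar R x := (opBar R x).flip b

lemma rmul_apply (y z : Bar R x) : rmul y z = barMul R x z y := rfl

lemma opL_apply (b : Cbar R x) (z : Bar R x) : opL b z = opBar R x z b := rfl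

lemma rmul_one : rmul (1 : Bar R x) = LinearMap.id := LinearMap.ext fun y => barMul_nil y

lemma rmul_add (y z : Bar R x) : rmul (y + z) = rmul y + rmul z := map_add _ _ _

lemma rmul_smul (r : R) (y : Bar R x) : rmul (r • y) = r • rmul y := map_smul _ _ _

lemma rmul_letter {q : ℕ} {b : Cbar R x} (hb : IsHomog (q + 1) b.1) (y : Bar R x) :
    rmul (TensorAlgebra.ι R b * y) = cv (LinearMap.mul R _) LinearMap.id
      (cv (consB R _) (opL b) (rmul y ∘ₗ sgn R x q)) := by
  have h : ∀ f g : Bar R x →ₗ[R] Bar R x, cv (LinearMap.mul R _) f g = conv R x f g :=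
    fun _ _ => rfl
  have h2 : cv (consB R _) (opL b) (rmul y ∘ₗ sgn R x q)
      = conv R x (TensorAlgebra.ι R ∘ₗ opL b) (rmul y ∘ₗ sgn R x q) := by
    rw [← h]
    exact cv_congr_map _ _ fun _ _ => rfl
  refine hword_ext fun l => ?_
  have hl : hword l = ((l.map HLetter.val).map (TensorAlgebra.ι R)).prod := by
    simp [hword]; rfl
  rw [hl, rmul_apply, barMul_cons hb, h, conv_word]
  refine Finset.sum_congr rfl fun i _ => ?_
  rw [h2, conv_word, Finset.mul_sum]
  refine Finset.sum_congr rfl fun j _ => ?_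
  simp only [LinearMap.id_apply, LinearMap.comp_apply, sgn_eq_iterate, rmul_apply, opL_apply]

/-- The untouched initial piece is empty, or its first letter is also the first letter of the
result. -/
lemma cv_mul_id (g : Bar R x →ₗ[R] Bar R x) :
    cv (LinearMap.mul R _) LinearMap.id g = g + cv (consB R _) (letter R _)
      (cv (LinearMap.mul R _) LinearMap.id g) := by
  have hid : ∀ m : Cbar R x, (LinearMap.id : Bar R x →ₗ[R] Bar R x) ∘ₗ consMap m
      = consMap m ∘ₗ LinearMap.id := fun m => rfl
  refine word_ext' ?_ fun m y => ?_
  · rw [LinearMap.add_apply, cv_letter_one, cv_one]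
    simp
  · rw [LinearMap.add_apply, cv_letter_cons, cv_cons, hid]
    have e : cv (LinearMap.mul R _) (consMap m ∘ₗ LinearMap.id) g
        = consMap m ∘ₗ cv (LinearMap.mul R _) LinearMap.id g := by
      rw [comp_cv]
      exact cv_congr_map _ _ fun y z => by simp [consMap_apply, mul_assoc]
    rw [e]
    simp [consMap_apply, consB_apply]

/-- Recursion for right multiplication. -/
lemma rmul_letter_rec {q : ℕ} {b : Cbar R x} (hb : IsHomog (q + 1) b.1) (y : Bar R x) :
    rmul (TensorAlgebra.ι R b * y) = cv (consB R _) (opL b) (rmul y ∘ₗ sgn R x q)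
      + cv (consB R _) (letter R _) (rmul (TensorAlgebra.ι R b * y)) := by
  conv_lhs => rw [rmul_letter hb, cv_mul_id]
  rw [← rmul_letter hb]

variable (hX : ∀ e : X _⦋1⦌, e = constSimplex X x 1)

/-- `ev` as a functional on cochains. -/
def evC (σ : X _⦋N⦌) (l : List (Fin (N + 1))) : C R x →ₗ[R] R where
  toFun a := ev σ a.1 l
  map_add' a b := by rw [Submodule.coe_add, ev_add]; rfl
  map_smul' r a := by rw [Submodule.coe_smul, ev_smul]; rfl

lemma C_ext {a b : C R x} (h : ∀ (N : ℕ) (σ : X _⦋N⦌) (l : List (Fin (N + 1))),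
    l.Pairwise (· ≤ ·) → ev σ a.1 l = ev σ b.1 l) : a = b :=
  Subtype.ext (coch_ext fun N σ => h N σ _ (pairwise_finRange _))

lemma C_hom_ext {f g : Bar R x →ₗ[R] C R x} (h : ∀ (N : ℕ) (σ : X _⦋N⦌) (l : List (Fin (N + 1))),
    l.Pairwise (· ≤ ·) → evC σ l ∘ₗ f = evC σ l ∘ₗ g) : f = g :=
  LinearMap.ext fun y => C_ext fun N σ l hl => LinearMap.congr_fun (h N σ l hl) y

lemma ev_inv (σ : X _⦋N⦌) (a : C R x) : ev σ (inv R x a).1 = -lsgn (ev σ a.1) := by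
  funext l
  cases l with
  | nil => simp [lsgn]
  | cons v l =>
    simp only [ev, Pi.neg_apply, lsgn]
    split_ifs
    · simp [inv, pow_succ]
    · simp

lemma counit_signBar (y : Bar R x) : counit R x (signBar R x y) = counit R x y := by
  induction y using word_induction with
  | one => simp
  | cons m y _ => rw [signBar_cons, counit_cons, counit_cons]
  | add y z hy hz => simp [hy, hz]
  | smul r y hy => simp [hy]

-- An operation adds the degrees of its arguments. In terms of expansions this is `lexp_sign` for
-- the sign involution, which the augmentation does not see.
include hX in
lemma inv_opC (y : Bar R x) (c : C R x) :
    inv R x (opC R x y c) = opC R x (signBar R x y) (inv R x c) := by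
  refine C_ext fun N σ l hl => ?_
  rw [ev_inv, ev_opC hX σ _ _ hl, ev_inv, Pi.neg_apply, lsgn, ev_opC hX σ _ _ hl]
  have h := lexp_sign (s := opS R x) (psi_singleton σ) (opS_psi σ) (-lsgn (ev σ c.1)) l
  have h' := congrArg (fun P : Op R x => counit R x (P.unop y)) h
  change counit R x ((lexp (psi σ) (-lsgn (ev σ c.1)) l : Op R x).unop (signBar R x y)) = _ at h'
  rw [h', lsgn_neg, lsgn_lsgn, lexp_neg]
  change _ = counit R x (signBar R x _)
  rw [counit_signBar, lsgn_neg, Pi.neg_apply, lsgn, MulOpposite.unop_neg, MulOpposite.unop_smul,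
    LinearMap.neg_apply, LinearMap.smul_apply, map_neg, map_zsmul]

lemma incl_invBar (b : Cbar R x) : incl R x (invBar R x b) = -inv R x (incl R x b) :=
  Subtype.ext (funext fun _ => rfl)

include hX in
lemma invBar_opL (y : Bar R x) (b : Cbar R x) :
    invBar R x (opL b y) = opL (invBar R x b) (signBar R x y) := by
  refine incl_injective ?_
  rw [incl_invBar, opL_apply, opL_apply, incl_opBar, incl_opBar, inv_opC hX, incl_invBar, map_neg]

end AcyclicBar

end

/-! ### Gap operators after right multiplication -/

noncomputable section

namespace AcyclicBar

universe u v

variable {R : Type v} [CommRing R] {X : SSet.{u}} {x : X _⦋0⦌} {N : ℕ}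

variable (hX : ∀ e : X _⦋1⦌, e = constSimplex X x 1)

/-- Linear maps with `f = k + β(letter, f)` are determined by `k`. -/
lemma cv_letter_unique {B : Type*} [AddCommGroup B] [Module R B]
    {β : Cbar R x →ₗ[R] B →ₗ[R] B} {f g k : Bar R x →ₗ[R] B}
    (hf : f = k + cv β (letter R _) f) (hg : g = k + cv β (letter R _) g) : f = g := by
  refine word_ext ?_ fun m y ih => ?_
  · rw [hf, hg, LinearMap.add_apply, LinearMap.add_apply, cv_letter_one, cv_letter_one]
  · rw [hf, hg, LinearMap.add_apply, LinearMap.add_apply, cv_letter_cons, cv_letter_cons, ih]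

lemma letter_signBar : letter R _ ∘ₗ (signBar R x).toLinearMap = invBar R x ∘ₗ letter R _ := by
  refine word_ext' (by simp [letter_one]) fun m y => ?_
  simp only [LinearMap.comp_apply, AlgHom.toLinearMap_apply, signBar_cons, letter_cons, map_smul]
  congr 1
  exact counit_signBar y

lemma sgn_signBar (p : ℕ) (y : Bar R x) :
    sgn R x p (signBar R x y) = signBar R x (sgn R x p y) := by
  rw [← sgn_succ, sgn_add p 1, sgn_one_eq]

lemma cv_consB_comp_signBar (h : Bar R x →ₗ[R] Cbar R x) (g : Bar R x →ₗ[R] Bar R x) :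
    (signBar R x).toLinearMap ∘ₗ cv (consB R _) h g
      = cv (consB R _) (invBar R x ∘ₗ h) ((signBar R x).toLinearMap ∘ₗ g) := by
  rw [comp_cv]
  exact cv_congr_map _ _ fun y z => signBar_cons _ _

-- The product adds degrees. Both sides solve the same recursion along the first letter.
include hX in
lemma signBar_rmul (y : Bar R x) : (signBar R x).toLinearMap ∘ₗ rmul y
    = rmul (signBar R x y) ∘ₗ (signBar R x).toLinearMap := by
  have key : ∀ l : List (HLetter R x), (signBar R x).toLinearMap ∘ₗ rmul (hword l)
      = rmul (signBar R x (hword l)) ∘ₗ (signBar R x).toLinearMap := by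
    intro l
    induction l with
    | nil => rw [hword_nil, signBar_one, rmul_one]; rfl
    | cons b l ih =>
      have hb' : IsHomog (b.deg + 1) (invBar R x b.val).1 := by
        rw [invBar_of_homog b.homog]
        intro n hn
        change (-1 : R) ^ b.deg • b.val.1 n = 0
        rw [b.homog n hn, smul_zero]
      rw [hword_cons, signBar_cons]
      set y := hword l
      have e1 := congrArg (fun P => (signBar R x).toLinearMap ∘ₗ P) (rmul_letter_rec b.homog y)
      have e2 := congrArg (fun P => P ∘ₗ (signBar R x).toLinearMap)
        (rmul_letter_rec hb' (signBar R x y))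
      simp only [LinearMap.comp_add, LinearMap.add_comp, cv_signBar, cv_consB_comp_signBar]
        at e1 e2
      have h1 : invBar R x ∘ₗ opL b.val = opL (invBar R x b.val) ∘ₗ (signBar R x).toLinearMap :=
        LinearMap.ext fun z => invBar_opL hX z b.val
      have h2 : (signBar R x).toLinearMap ∘ₗ rmul y ∘ₗ sgn R x b.deg
          = (rmul (signBar R x y) ∘ₗ sgn R x b.deg) ∘ₗ (signBar R x).toLinearMap := by
        rw [← LinearMap.comp_assoc, ih]
        exact LinearMap.ext fun z => congrArg _ (sgn_signBar _ z).symm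
      have h3 : ∀ P, cv (consB R _) (invBar R x ∘ₗ letter R _) P
          = cv (consB R _ ∘ₗ invBar R x) (letter R _) P := fun P =>
        cv_congr_map _ _ fun _ _ => rfl
      rw [h1, h2, h3] at e1
      rw [letter_signBar, h3] at e2
      exact cv_letter_unique e1 e2
  induction mem_span_hword y using Submodule.span_induction with
  | mem z hz => obtain ⟨l, rfl⟩ := hz; exact key l
  | zero => simp [rmul]
  | add y z _ _ hy hz => rw [rmul_add, LinearMap.comp_add, hy, hz, map_add, rmul_add,
      LinearMap.add_comp]
  | smul r y _ hy => rw [rmul_smul, LinearMap.comp_smul, hy, map_smul, rmul_smul,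
      LinearMap.smul_comp]

include hX in
lemma evBar_opL (σ : X _⦋N⦌) {l : List (Fin (N + 1))} (h : l.Pairwise (· ≤ ·)) (b : Cbar R x) :
    evBar σ l ∘ₗ opL b
      = (counit R x).toLinearMap ∘ₗ (lexp (psi σ) (ev σ b.1) l : Op R x).unop :=
  LinearMap.ext fun y => (congrArg (fun a : C R x => ev σ a.1 l) (incl_opBar y b)).trans
    (ev_opC hX σ y (incl R x b) h)

lemma ev_eq_zero_of_homog (σ : X _⦋N⦌) {q : ℕ} {a : Coch R X} (ha : IsHomog q a)
    {l : List (Fin (N + 1))} (hl : l.length ≠ q + 1) : ev σ a l = 0 := by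
  cases l with
  | nil => rfl
  | cons v l =>
    simp only [ev]
    rw [ha l.length (by simpa using hl)]
    simp

lemma isShift_lexp_ev (σ : X _⦋N⦌) {p : ℕ} {a : Coch R X} (ha : IsHomog p a)
    (l : List (Fin (N + 1))) : IsShift p (lexp (psi σ) (ev σ a) l : Op R x).unop :=
  isShift_lexp σ (fun _ hm => ev_eq_zero_of_homog σ ha hm) l

-- The first letter of z ∘ [b|y] is an operation on b with an initial piece of z, or the first
-- letter of z. By `IsShift.eq`, evaluating the operation is the same as letting the expansion of b
-- consume that piece.
include hX in
lemma contr_rmul (σ : X _⦋N⦌) {l : List (Fin (N + 1))} (h : l.Pairwise (· ≤ ·)) {q : ℕ}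
    {b : Cbar R x} (hb : IsHomog (q + 1) b.1) (y : Bar R x) :
    contr (evBar σ l) ∘ₗ rmul (TensorAlgebra.ι R b * y)
      = rmul y ∘ₗ (signBar R x).toLinearMap ∘ₗ (lexp (psi σ) (ev σ b.1) l : Op R x).unop
        + rmul (TensorAlgebra.ι R b * y) ∘ₗ contr (evBar σ l) := by
  conv_lhs => rw [rmul_letter_rec hb]
  rw [LinearMap.comp_add, contr_cv_consB, contr_cv_consB, evBar_opL hX σ h]
  congr 1
  · have e := (isShift_lexp_ev (x := x) σ hb l).eq
    have e2 := congrArg (fun P => rmul y ∘ₗ (signBar R x).toLinearMap ∘ₗ P) e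
    refine Eq.trans ?_ e2.symm
    rw [comp_cv, comp_cv]
    refine cv_congr_map _ _ fun u z => ?_
    simp only [LinearMap.lsmul_apply, LinearMap.compr₂_apply, LinearMap.comp_apply, map_smul,
      AlgHom.toLinearMap_apply]
    -- The expansion of b has q + 1 gaps, but the product carries the sign of the bar degree q; one
    -- involution makes up the difference.
    rw [sgn_succ, signBar_signBar]
  · refine word_ext' ?_ fun m z => ?_
    · rw [cv_one, LinearMap.comp_apply, LinearMap.comp_apply, contr_one, letter_one]
      simp
    · have := cv_letter_cons (LinearMap.lsmul R (Bar R x) ∘ₗ evBar σ l)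
        (rmul (TensorAlgebra.ι R b * y)) m z
      rw [LinearMap.comp_apply, contr_cons, map_smul]
      refine Eq.trans (LinearMap.congr_fun ?_ _) this
      exact cv_congr_map _ _ fun _ _ => rfl

include hX in
/-- The operator of a gap after right multiplication by a word. -/
lemma psi_rmul (σ : X _⦋N⦌) {l : List (Fin (N + 1))} (h : l.Pairwise (· ≤ ·)) (b : Cbar R x)
    (y : Bar R x) : (psi σ l : Op R x).unop ∘ₗ rmul (TensorAlgebra.ι R b * y)
      = rmul (signBar R x y) ∘ₗ (lexp (psi σ) (ev σ b.1) l : Op R x).unop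
        + rmul (signBar R x (TensorAlgebra.ι R b * y)) ∘ₗ (psi σ l : Op R x).unop := by
  induction b using Cbar_induction with
  | zero =>
    have h0 : lexp (psi σ) (ev σ (0 : Cbar R x).1) l = (0 : Op R x) := by
      have : (0 : Cbar R x).1 = (0 : R) • (0 : Coch R X) := by simp
      rw [this, ev_smul, lexp_mul_left, Pi.smul_apply, zero_smul]
    rw [h0, map_zero, zero_mul, map_zero]
    simp [rmul]
  | add a b ha hb =>
    rw [map_add, add_mul, map_add, rmul_add, rmul_add, LinearMap.comp_add, ha, hb,
      Submodule.coe_add, ev_add, lexp_add, Pi.add_apply, MulOpposite.unop_add, LinearMap.comp_add,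
      LinearMap.add_comp]
    abel
  | homog q b hb =>
    have hpsi : (psi σ l : Op R x).unop = (signBar R x).toLinearMap ∘ₗ
        (contr (evBar σ l) + (lunit 2 l : Op R x).unop) := rfl
    have hu : ∀ P : Bar R x →ₗ[R] Bar R x,
        (lunit 2 l : Op R x).unop ∘ₗ P = P ∘ₗ (lunit 2 l : Op R x).unop := fun P => by
      simp only [lunit]
      split_ifs
      · rfl
      · exact (LinearMap.zero_comp P).trans (LinearMap.comp_zero P).symm
    rw [hpsi, LinearMap.comp_assoc, LinearMap.add_comp, contr_rmul hX σ h hb, hu, add_assoc,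
      ← LinearMap.comp_add, LinearMap.comp_add, ← LinearMap.comp_assoc, signBar_rmul hX,
      ← LinearMap.comp_assoc _ (rmul _), signBar_rmul hX]
    congr 1
    refine LinearMap.ext fun z => ?_
    simp only [LinearMap.comp_apply, AlgHom.toLinearMap_apply, signBar_signBar]

end AcyclicBar

end

/-! ### Operations composed with operations -/

noncomputable section

namespace AcyclicBar

universe u v

variable {R : Type v} [CommRing R] {X : SSet.{u}} {x : X _⦋0⦌} {N : ℕ}

/-- The augmented value of an operator at `z`. -/
def augAt (z : Bar R x) : Op R x →+ R where
  toFun P := counit R x (P.unop z)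
  map_zero' := by simp
  map_add' P Q := by simp

lemma augAt_apply (z : Bar R x) (P : Op R x) : augAt z P = counit R x (P.unop z) := rfl

lemma augAt_add (y z : Bar R x) (P : Op R x) : augAt (y + z) P = augAt y P + augAt z P := by
  simp [augAt_apply]

lemma augAt_smul (r : R) (z : Bar R x) (P : Op R x) : augAt (r • z) P = r * augAt z P := by
  simp [augAt_apply]

lemma augAt_algebraMap (r : R) (z : Bar R x) :
    augAt z (algebraMap R (Op R x) r) = r * counit R x z := by
  rw [augAt_apply, ← smul_eq_mul, ← map_smul]
  rfl

lemma augAt_lcup {V : Type*} (z : Bar R x) (F G : List V → Op R x) (l : List V) :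
    augAt z (lcup F G l)
      = ∑ p : Fin l.length, augAt ((F (l.take (p + 1))).unop z) (G (l.drop p)) := by
  rw [lcup_eq_sum, map_sum]
  rfl

/-- Without letters every gap must be an edge, so the only sublist that contributes is l itself. -/
lemma lexp_augAt_congr {σ : X _⦋N⦌} {f : List (Fin (N + 1)) → R} {l : List (Fin (N + 1))}
    (hl : l ≠ []) : augAt (1 : Bar R x) (lexp (psi σ) f l) = f l := by
  induction l using list_suffix_induction generalizing f with
  | nil => exact absurd rfl hl
  | cons v l ih =>
    rw [lexp_cons', map_add, augAt_lcup]
    by_cases h : l = []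
    · subst h
      simp only [if_true, augAt_algebraMap]
      simp
    · rw [if_neg h, map_zero, zero_add]
      have : ∀ p : Fin l.length, augAt ((lder v (psi σ) (l.take (p + 1)) : Op R x).unop 1)
          (lexp (psi σ) (lder v f) (l.drop p))
          = lunit 1 (l.take (p + 1)) * lder v f (l.drop p) := fun p => by
        rw [lder_apply, psi_unop_one, augAt_smul, ih _ (List.drop_suffix _ _)]
        · congr 1
          simp [lunit]
        · simp
      rw [Finset.sum_congr rfl fun p _ => this p, ← lcup_eq_sum, lunit_one_lcup _ h]
      rfl

lemma counit_rmul_cons (b : Cbar R x) (y z : Bar R x) :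
    counit R x (rmul (TensorAlgebra.ι R b * y) z) = 0 := by
  induction b using Cbar_induction with
  | zero => simp [rmul]
  | add a b ha hb => rw [map_add, add_mul, rmul_add, LinearMap.add_apply, map_add, ha, hb, add_zero]
  | homog q b hb =>
    have : ∀ f g, counit R x (cv (consB R _) f g z) = 0 := fun f g => by
      have := LinearMap.congr_fun (comp_cv (consB R (Cbar R x)) f g (counit R x).toLinearMap) z
      refine this.trans ?_
      rw [cv_eq_zero _ fun y z => counit_cons _ _]
      rfl
    rw [rmul_letter_rec hb, LinearMap.add_apply, map_add, this, this, add_zero]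

variable (hX : ∀ e : X _⦋1⦌, e = constSimplex X x 1)

include hX in
/-- Operations on a product of words, in terms of vertex lists. -/
lemma augAt_rmul (σ : X _⦋N⦌) (f : List (Fin (N + 1)) → R) {l : List (Fin (N + 1))}
    (h : l.Pairwise (· ≤ ·)) (y z : Bar R x) : augAt (rmul y z) (lexp (psi σ) f l)
      = augAt z (lexp (psi σ) (fun m => augAt y (lexp (psi σ) f m)) l) := by
  induction l using list_suffix_induction generalizing f y z with
  | nil => simp
  | cons v l ih =>
    induction y using word_induction with
    | one =>
      rw [rmul_one, LinearMap.id_apply, lexp_congr (psi σ) fun m _ hm => (lexp_augAt_congr hm).symm]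
    | add y y' hy hy' =>
      have : (fun m => augAt (y + y') (lexp (psi σ) f m)) = (fun m => augAt y (lexp (psi σ) f m))
          + fun m => augAt y' (lexp (psi σ) f m) := funext fun m => augAt_add _ _ _
      rw [rmul_add, LinearMap.add_apply, augAt_add, hy, hy', this, lexp_add, Pi.add_apply, map_add]
    | smul r y hy =>
      have : (fun m => augAt (r • y) (lexp (psi σ) f m))
          = fun m => r * augAt y (lexp (psi σ) f m) := funext fun m => augAt_smul _ _ _
      rw [rmul_smul, LinearMap.smul_apply, augAt_smul, hy, this, lexp_mul_left, Pi.smul_apply,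
        augAt_apply, augAt_apply, ← smul_eq_mul, ← map_smul]
      rfl
    | cons b w _ =>
      set y := TensorAlgebra.ι R b * w with hy
      let G : Bar R x → List (Fin (N + 1)) → R := fun u m => augAt u (lexp (psi σ) (lder v f) m)
      have hv : ∀ m, m.Sublist l → (v :: m).Pairwise (· ≤ ·) := fun m hm => h.sublist (hm.cons_cons v)
      -- The first gap of the inner expansion takes b or an ε. Once v is split off, `lunit 2` turns
      -- into the cup unit `lunit 1`, so the ε case is an uncut term.
      have hg : ∀ m, m.Sublist l → m ≠ [] →
          lder v (fun m => augAt y (lexp (psi σ) f m)) m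
            = (lcup (lder v (ev σ b.1)) (G (signBar R x w)) + G (signBar R x y)) m := by
        intro m _ hm
        rw [lder_apply, lexp_cons', if_neg hm, zero_add, augAt_lcup, Pi.add_apply, lcup_eq_sum,
          ← lunit_one_lcup (G (signBar R x y)) hm, lcup_eq_sum, ← Finset.sum_add_distrib]
        refine Finset.sum_congr rfl fun p _ => ?_
        rw [lder_apply, hy, psi_unop_cons, augAt_add, augAt_smul, augAt_smul]
        congr 2
        simp [lunit]
      have h0 : (if l = [] then algebraMap R (Op R x)
          ((fun m => augAt y (lexp (psi σ) f m)) [v]) else 0) = 0 := by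
        split_ifs
        · simp only [lexp_singleton, augAt_algebraMap, hy, counit_cons, mul_zero, map_zero]
        · rfl
      have h1 : augAt (rmul y z) (if l = [] then algebraMap R (Op R x) (f [v]) else 0) = 0 := by
        split_ifs
        · rw [augAt_algebraMap, counit_rmul_cons, mul_zero]
        · exact map_zero _
      rw [lexp_cons', lexp_cons', h0, zero_add, map_add, h1, zero_add,
        lcup_congr (fun _ _ _ => rfl) fun m hm _ => lexp_congr (psi σ) fun m' hm' =>
          hg m' (hm'.trans hm.sublist), lexp_add, lcup_add_right, lexp_lcup, ← lcup_assoc,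
        Pi.add_apply, map_add,
        ← lcup_congr (F := lder v (lexp (psi σ) (ev σ b.1))) (fun m _ hm => lder_lexp _ _ v hm)
          fun _ _ _ => rfl, augAt_lcup, augAt_lcup, augAt_lcup, ← Finset.sum_add_distrib]
      refine Finset.sum_congr rfl fun p _ => ?_
      -- On the left side the first gap splits into the same two cases, and what remains is a right
      -- multiplication over a suffix.
      have hp := LinearMap.congr_fun (psi_rmul hX σ (hv _ (List.take_sublist (p + 1) l)) b w) z
      rw [LinearMap.add_apply] at hp
      rw [lder_apply]
      refine (congrArg (fun u => augAt u _) hp).trans ?_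
      rw [augAt_add]
      have hd : (l.drop p).Pairwise (· ≤ ·) := (List.pairwise_cons.mp h).2.sublist
        (List.drop_sublist _ _)
      congr 1
      · exact ih _ (List.drop_suffix _ _) _ hd _ _
      · exact ih _ (List.drop_suffix _ _) _ hd _ _

-- The inner operation is itself an augmented expansion on every sublist, so the right side is the
-- iterated expansion of `augAt_rmul`.
include hX in
lemma opC_barMul (y z : Bar R x) (c : C R x) :
    opC R x (barMul R x z y) c = opC R x z (opC R x y c) := by
  refine C_ext fun N σ l hl => ?_
  rw [ev_opC hX σ _ _ hl, ev_opC hX σ _ _ hl, lexp_congr (psi σ) fun m hm _ =>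
    ev_opC hX σ y c (hl.sublist hm)]
  exact augAt_rmul hX σ _ hl y z

include hX in
lemma opC_one_left (c : C R x) : opC R x 1 c = c := by
  refine C_ext fun N σ l hl => ?_
  rw [ev_opC hX σ _ _ hl]
  rcases eq_or_ne l [] with rfl | h
  · simp
  · exact lexp_augAt_congr h

lemma ev_one (σ : X _⦋N⦌) {l : List (Fin (N + 1))} (hl : l.Pairwise (· ≤ ·)) :
    ev σ (one R x).1 l = lunit 1 l := by
  cases l with
  | nil => simp [lunit]
  | cons v l => simp [ev, one, lunit, hl]

-- The unit is supported on single vertices. Such sublists have no gaps, hence no room for letters.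
include hX in
lemma opC_one_right (z : Bar R x) : opC R x z (one R x) = counit R x z • one R x := by
  refine C_ext fun N σ l hl => ?_
  rw [ev_opC hX σ _ _ hl, lexp_congr (psi σ) fun m hm _ => ev_one σ (hl.sublist hm),
    lexp_lunit_one, Submodule.coe_smul, ev_smul]
  change _ = counit R x z * ev σ (one R x).1 l
  rw [ev_one σ hl]
  simp only [lunit]
  split_ifs <;> simp

end AcyclicBar

end

noncomputable section

namespace AcyclicBar

universe u v

variable {R : Type v} [CommRing R] {X : SSet.{u}} {x : X _⦋0⦌} {N : ℕ}

/-! ### The differential graded algebra of cochains -/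

lemma ldel_congr_sublist {V A : Type*} [Ring A] {F G : List V → A} {l : List V}
    (h : ∀ m, m.Sublist l → F m = G m) : ldel F l = ldel G l := by
  rw [ldel_eq_sum, ldel_eq_sum]
  exact Finset.sum_congr rfl fun i _ => by rw [h _ (List.eraseIdx_sublist _ _)]

lemma lcup_congr_sublist {V A : Type*} [Ring A] {F F' G G' : List V → A} {l : List V}
    (hF : ∀ m, m.Sublist l → F m = F' m) (hG : ∀ m, m.Sublist l → G m = G' m) :
    lcup F G l = lcup F' G' l :=
  lcup_congr (fun m hm _ => hF m hm.sublist) fun m hm _ => hG m hm.sublist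

section

variable (σ : X _⦋N⦌) {l : List (Fin (N + 1))} (hl : l.Pairwise (· ≤ ·))

include hl

lemma ev_dC (a : C R x) : ev σ (dC R x a).1 l = ldel (ev σ a.1) l := ev_coboundary σ a.1 hl

lemma ev_cupC (a b : C R x) : ev σ (cup R x a b).1 l = lcup (ev σ a.1) (ev σ b.1) l :=
  ev_cup σ a.1 b.1 hl

end

lemma dC_dC (a : C R x) : dC R x (dC R x a) = 0 := by
  refine C_ext fun N σ l hl => ?_
  rw [ev_dC σ hl, ldel_congr_sublist fun m hm => ev_dC σ (hl.sublist hm) a, ldel_ldel]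
  exact (ev_zero σ l).symm

lemma cup_assoc (a b c : C R x) : cup R x (cup R x a b) c = cup R x a (cup R x b c) := by
  refine C_ext fun N σ l hl => ?_
  rw [ev_cupC σ hl, ev_cupC σ hl, lcup_congr_sublist (fun m hm => ev_cupC σ (hl.sublist hm) a b)
    fun _ _ => rfl, lcup_assoc]
  exact lcup_congr_sublist (fun _ _ => rfl) fun m hm => (ev_cupC σ (hl.sublist hm) b c).symm

lemma one_cup (a : C R x) : cup R x (one R x) a = a := by
  refine C_ext fun N σ l hl => ?_
  rw [ev_cupC σ hl, lcup_congr_sublist (fun m hm => ev_one σ (hl.sublist hm)) fun _ _ => rfl]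
  rcases eq_or_ne l [] with rfl | h
  · simp
  · exact lunit_one_lcup _ h

lemma cup_one (a : C R x) : cup R x a (one R x) = a := by
  refine C_ext fun N σ l hl => ?_
  rw [ev_cupC σ hl, lcup_congr_sublist (fun _ _ => rfl) fun m hm => ev_one σ (hl.sublist hm)]
  rcases eq_or_ne l [] with rfl | h
  · simp
  · exact lcup_lunit_one _ h

lemma inv_inv (a : C R x) : inv R x (inv R x a) = a := by
  ext n σ
  simp [inv, ← mul_assoc, ← mul_pow]

lemma inv_dC (a : C R x) : inv R x (dC R x a) = -dC R x (inv R x a) := by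
  ext n σ
  cases n with
  | zero => simp [inv, dC, coboundary]
  | succ n =>
    simp [inv, dC, coboundary, pow_succ, Finset.mul_sum]
    refine Finset.sum_congr rfl fun i _ => ?_
    ring

lemma inv_cup (a b : C R x) :
    inv R x (cup R x a b) = cup R x (inv R x a) (inv R x b) := by
  refine C_ext fun N σ l hl => ?_
  rw [ev_inv, ev_cupC σ hl, ev_inv, ev_inv, lcup_neg_left, lcup_neg_right, neg_neg, lcup_lsgn,
    Pi.neg_apply, Pi.neg_apply, lsgn, lsgn, ev_cupC σ hl]

lemma dC_cup (a b : C R x) : dC R x (cup R x a b)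
    = cup R x (dC R x a) b + cup R x (inv R x a) (dC R x b) := by
  refine C_ext fun N σ l hl => ?_
  rw [ev_dC σ hl, ldel_congr_sublist fun m hm => ev_cupC σ (hl.sublist hm) a b,
    ldel_lcup _ _ rfl, Submodule.coe_add, ev_add, Pi.add_apply, ev_cupC σ hl, ev_cupC σ hl, ev_inv,
    lcup_neg_left, Pi.sub_apply, Pi.sub_apply, Pi.neg_apply, ev_nil, zero_mul, sub_zero,
    sub_eq_add_neg]
  congr 1
  · exact lcup_congr_sublist (fun m hm => (ev_dC σ (hl.sublist hm) a).symm) fun _ _ => rfl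
  · congr 1
    exact lcup_congr_sublist (fun _ _ => rfl) fun m hm => (ev_dC σ (hl.sublist hm) b).symm

lemma inv_one : inv R x (one R x) = one R x := by
  refine Subtype.ext (funext fun n => funext fun σ => ?_)
  cases n <;> simp [inv, one]

/-- The Leibniz rule for 1 · 1 gives d1 = d1 + d1. -/
lemma dC_one : dC R x (one R x) = 0 := by
  have h := dC_cup (one R x) (one R x)
  rw [one_cup, inv_one, one_cup, cup_one] at h
  exact left_eq_add.mp h

/-! ### The operations and the product -/

/-- The operations with last argument `c`. -/
def opF (c : C R x) : Bar R x →ₗ[R] C R x := (opC R x).flip c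

lemma opF_apply (c : C R x) (y : Bar R x) : opF c y = opC R x y c := rfl

lemma evC_cv_cup (σ : X _⦋N⦌) {l : List (Fin (N + 1))} (hl : l.Pairwise (· ≤ ·))
    (f g : Bar R x →ₗ[R] C R x) : evC σ l ∘ₗ cv (cup R x) f g = ∑ p : Fin l.length,
      cv (LinearMap.mul R R) (evC σ (l.take (p + 1)) ∘ₗ f) (evC σ (l.drop p) ∘ₗ g) := by
  rw [comp_cv]
  refine cv_congr_sum _ _ (fun _ => LinearMap.mul R R) fun y z => ?_
  exact (ev_cupC σ hl _ _).trans (lcup_eq_sum _ _ _)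

variable (hX : ∀ e : X _⦋1⦌, e = constSimplex X x 1)

include hX in
lemma evC_opF (σ : X _⦋N⦌) {l : List (Fin (N + 1))} (hl : l.Pairwise (· ≤ ·)) (c : C R x) :
    evC σ l ∘ₗ opF c = (counit R x).toLinearMap ∘ₗ (lexp (psi σ) (ev σ c.1) l : Op R x).unop :=
  LinearMap.ext fun y => ev_opC hX σ y c hl

/-- Augmented values after a shift operator. -/
lemma augAt_isShift {p : ℕ} {P : Op R x} (hP : IsShift p P.unop) (Q : Op R x) (y : Bar R x) :
    augAt (P.unop y) Q = cv (LinearMap.mul R R) ((counit R x).toLinearMap ∘ₗ P.unop)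
      ((counit R x).toLinearMap ∘ₗ Q.unop ∘ₗ sgn R x p) y := by
  have h := congrArg (fun T => (counit R x).toLinearMap ∘ₗ Q.unop ∘ₗ T) hP.eq
  refine (LinearMap.congr_fun h y).trans (LinearMap.congr_fun ?_ y)
  rw [comp_cv, comp_cv]
  exact cv_congr_map _ _ fun y z => by simp

-- `lexp_lcup` cuts the vertex list. Since the expansion of b is a shift operator, the cut also
-- divides the word, and the second piece receives one sign for each of the q gaps of b.
include hX in
lemma opF_cup {q : ℕ} {b : C R x} (hb : IsHomog q b.1) (c : C R x) :
    opF (cup R x b c) = cv (cup R x) (opF b) (opF c ∘ₗ sgn R x q) := by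
  refine C_hom_ext fun N σ l hl => ?_
  rw [evC_cv_cup σ hl]
  refine LinearMap.ext fun y => ?_
  refine (ev_opC hX σ y _ hl).trans ?_
  rw [lexp_congr (psi σ) fun m hm _ => ev_cupC σ (hl.sublist hm) b c, lexp_lcup, ← augAt_apply,
    augAt_lcup, LinearMap.sum_apply]
  refine Finset.sum_congr rfl fun p _ => ?_
  rw [augAt_isShift (isShift_lexp_ev σ hb _), evC_opF hX σ (hl.sublist (List.take_sublist _ _)),
    ← LinearMap.comp_assoc _ _ (evC σ _), evC_opF hX σ (hl.sublist (List.drop_sublist _ _))]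
  rfl

end AcyclicBar

end

/-! ### The coboundary of an operation -/

noncomputable section

namespace AcyclicBar

universe u v

variable {R : Type v} [CommRing R] {X : SSet.{u}} {x : X _⦋0⦌} {N : ℕ}

lemma counit_sgn (p : ℕ) (y : Bar R x) : counit R x (sgn R x p y) = counit R x y := by
  induction p with
  | zero => rfl
  | succ p ih => rw [sgn_succ, counit_signBar, ih]

lemma augAt_signBar (y : Bar R x) (P : Op R x) :
    augAt (signBar R x y) P = augAt y (opS R x * P) := rfl

lemma augAt_ldel (y : Bar R x) {V : Type*} (F : List V → Op R x) (l : List V) :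
    augAt y (ldel F l) = ldel (fun m => augAt y (F m)) l := map_ldel (augAt y) F l

lemma contr_eq_cv (φ : Cbar R x →ₗ[R] R) :
    contr φ = cv (LinearMap.lsmul R (Bar R x)) (φ ∘ₗ letter R _) LinearMap.id := by
  refine word_ext' ?_ fun m z => ?_
  · rw [cv_one, LinearMap.comp_apply, contr_one, letter_one]
    simp
  · have := cv_letter_cons (LinearMap.lsmul R (Bar R x) ∘ₗ φ) LinearMap.id m z
    rw [contr_cons]
    refine Eq.symm (Eq.trans (LinearMap.congr_fun ?_ _) this)
    exact cv_congr_map _ _ fun _ _ => rfl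

lemma psi_unop (σ : X _⦋N⦌) (l : List (Fin (N + 1))) (y : Bar R x) : (psi σ l : Op R x).unop y
    = signBar R x (contr (evBar σ l) y) + (lunit 2 l : R) • signBar R x y := by
  induction y using word_induction with
  | one => rw [psi_unop_one, contr_one, map_zero, zero_add, signBar_one]
  | cons m y _ => rw [psi_unop_cons, contr_cons, map_smul]; rfl
  | add y z hy hz => simp only [map_add, hy, hz, smul_add]; abel
  | smul r y hy => simp only [map_smul, hy, smul_add]; rw [smul_comm r]

lemma counit_barD (y : Bar R x) : counit R x (barD R x y) = 0 := by
  induction y using word_induction with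
  | one => rw [barD_one, map_zero]
  | cons m y _ =>
    have : ∀ z : Bar R x, counit R x (LinearMap.mul' R _ (LinearMap.rTensor _
        (TensorAlgebra.ι R ∘ₗ cupBar R x (invBar R x m)) (uncons R _ z))) = 0 := by
      intro z
      induction z using word_induction with
      | one => simp [uncons_one]
      | cons b z _ => simp [uncons_cons, counit, TensorAlgebra.algebraMapInv]
      | add y z hy hz => simp only [map_add, hy, hz, add_zero]
      | smul r y hy => simp only [map_smul, hy, smul_zero]
    rw [barD_cons, map_sub, map_add, map_neg, counit_cons, counit_cons, this]
    simp
  | add y z hy hz => simp only [map_add, hy, hz, add_zero]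
  | smul r y hy => simp only [map_smul, hy, smul_zero]

lemma isHomog_inv {q : ℕ} {b : C R x} (hb : IsHomog q b.1) : IsHomog q (inv R x b).1 := by
  intro n hn
  funext σ
  change (-1) ^ n * b.1 n σ = 0
  rw [hb n hn]
  simp

/-- The first letter as a cochain. -/
def letterC : Bar R x →ₗ[R] C R x := incl R x ∘ₗ letter R _

lemma letterC_signBar : letterC ∘ₗ (signBar R x).toLinearMap = -(inv R x ∘ₗ letterC) := by
  refine LinearMap.ext fun y => ?_
  have := congrArg (incl R x) (LinearMap.congr_fun (letter_signBar (R := R) (x := x)) y)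
  exact this.trans (incl_invBar _)

lemma augAt_lunit_lcup {V : Type*} (y : Bar R x) (n : ℕ) (F : List V → Op R x) :
    (fun l => augAt y (lcup (lunit n) F l)) = lcup (lunit n) fun m => augAt y (F m) := by
  funext l
  rw [augAt_lcup, lcup_eq_sum]
  refine Finset.sum_congr rfl fun p _ => ?_
  simp only [lunit]
  split_ifs
  · rw [one_mul]; rfl
  · rw [zero_mul]; exact (congrArg (counit R x) (map_zero _)).trans (map_zero _)

lemma augAt_lcup_lunit {V : Type*} (y : Bar R x) (n : ℕ) (F : List V → Op R x) :
    (fun l => augAt y (lcup F (lunit n) l)) = lcup (fun m => augAt y (F m)) (lunit n) := by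
  funext l
  rw [augAt_lcup, lcup_eq_sum]
  refine Finset.sum_congr rfl fun p _ => ?_
  simp only [lunit]
  split_ifs
  · rw [mul_one]; rfl
  · rw [mul_zero]; exact map_zero _

variable (hX : ∀ e : X _⦋1⦌, e = constSimplex X x 1)

include hX

/-- The first gap is filled with the first letter, which multiplies from the left, or with ε, which
removes the first vertex. -/
lemma augAt_psi_lcup (σ : X _⦋N⦌) {l : List (Fin (N + 1))} (hl : l.Pairwise (· ≤ ·)) (c : C R x)
    (y : Bar R x) : augAt y (lcup (psi σ) (lexp (psi σ) (ev σ c.1)) l)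
      = ev σ (cv (cup R x) letterC (opF c ∘ₗ (signBar R x).toLinearMap) y).1 l
        + lcup (lunit 2) (ev σ (opF c (signBar R x y)).1) l := by
  have h := LinearMap.congr_fun (evC_cv_cup (x := x) σ hl letterC
    (opF c ∘ₗ (signBar R x).toLinearMap)) y
  refine Eq.trans ?_ (congrArg (· + _) h.symm)
  rw [augAt_lcup, lcup_eq_sum, LinearMap.sum_apply, ← Finset.sum_add_distrib]
  refine Finset.sum_congr rfl fun p _ => ?_
  rw [psi_unop, augAt_add, augAt_smul]
  congr 1
  · rw [contr_eq_cv, ← LinearMap.comp_assoc _ _ (evC σ _),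
      evC_opF hX σ (hl.sublist (List.drop_sublist _ _))]
    have := comp_cv (LinearMap.lsmul R (Bar R x)) (evBar σ (l.take (p + 1)) ∘ₗ letter R _)
      LinearMap.id ((counit R x).toLinearMap ∘ₗ (lexp (psi σ) (ev σ c.1) (l.drop p) : Op R x).unop
        ∘ₗ (signBar R x).toLinearMap)
    refine (LinearMap.congr_fun this y).trans (LinearMap.congr_fun (cv_congr_map _ _ fun u z => ?_) y)
    simp
    rfl
  · congr 1
    exact (ev_opC hX σ _ c (hl.sublist (List.drop_sublist _ _))).symm

/-- The mirror image: the final gap takes a last remaining letter or an ε. The sign is that of the q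
gaps in front of it. -/
lemma augAt_lcup_psi (σ : X _⦋N⦌) {l : List (Fin (N + 1))} (hl : l.Pairwise (· ≤ ·)) {q : ℕ}
    {c : C R x} (hc : IsHomog q c.1) (y : Bar R x) :
    augAt y (lcup (lexp (psi σ) (ev σ c.1)) (psi σ) l)
      = ev σ (cv (cup R x) (opF c) (letterC ∘ₗ sgn R x q) y).1 l
        + lcup (ev σ (opF c y).1) (lunit 2) l := by
  have h := LinearMap.congr_fun (evC_cv_cup (x := x) σ hl (opF c) (letterC ∘ₗ sgn R x q)) y
  refine Eq.trans ?_ (congrArg (· + _) h.symm)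
  rw [augAt_lcup, lcup_eq_sum, LinearMap.sum_apply, ← Finset.sum_add_distrib]
  refine Finset.sum_congr rfl fun p _ => ?_
  have ht := hl.sublist (List.take_sublist (p + 1) l)
  rw [augAt_isShift (isShift_lexp_ev σ hc _), ← evC_opF hX σ ht]
  have e : (counit R x).toLinearMap ∘ₗ (psi σ (l.drop p) : Op R x).unop ∘ₗ sgn R x q
      = evBar σ (l.drop p) ∘ₗ letter R _ ∘ₗ sgn R x q
        + (lunit 2 (l.drop p) : R) • (counit R x).toLinearMap := by
    refine LinearMap.ext fun z => ?_
    simp only [LinearMap.comp_apply, psi_unop, LinearMap.add_apply, LinearMap.smul_apply,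
      AlgHom.toLinearMap_apply, map_add, map_smul, counit_signBar, counit_sgn]
    congr 1
    generalize sgn R x q z = w
    induction w using word_induction with
    | one => simp [contr_one, letter_one]
    | cons m w _ => simp [contr_cons, letter_cons, counit, mul_comm]
    | add y z hy hz => simp only [map_add, hy, hz]
    | smul r y hy => simp only [map_smul, hy]
  rw [e, map_add, LinearMap.add_apply]
  congr 1
  rw [map_smul, cv_unit_right _ _ fun m y => counit_cons m y]
  simp [mul_comm]
  rfl

/-- The coboundary of an operation. -/
lemma dC_opF {q : ℕ} {b : C R x} (hb : IsHomog q b.1) : dC R x ∘ₗ opF b =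
    opF (dC R x b) ∘ₗ (signBar R x).toLinearMap - opF b ∘ₗ barD R x
      + cv (cup R x) (inv R x ∘ₗ letterC) (opF b)
      - cv (cup R x) (inv R x ∘ₗ opF b) (inv R x ∘ₗ letterC ∘ₗ sgn R x q) := by
  refine C_hom_ext fun N σ l hl => LinearMap.ext fun y => ?_
  have h := congrArg (augAt y) (opD_lexp (x := x) σ (ev σ b.1) hl)
  have hs := lexp_sign (s := opS R x) (psi_singleton σ) (opS_psi σ) (ldelInt (ev σ b.1)) l
  -- A differential never has an empty word as a component.
  have h1 : augAt y (-lsgn (lexp (psi σ) (ev σ b.1)) l * opD R x) = 0 := counit_barD _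
  have hE : ∀ c : C R x, ∀ z, ∀ m, m.Sublist l →
      augAt z (lexp (psi σ) (ev σ c.1) m) = ev σ (opF c z).1 m := fun c z m hm =>
    (ev_opC hX σ z c (hl.sublist hm)).symm
  -- Interior removals are the full coboundary of the operation less its two outer faces.
  have h2 : augAt y (ldelInt (lexp (psi σ) (ev σ b.1)) l) = ev σ (dC R x (opF b y)).1 l
      - lcup (lunit 2) (ev σ (opF b y).1) l - lcup (lsgn (ev σ (opF b y).1)) (lunit 2) l := by
    have e1 := congrFun (augAt_lunit_lcup y 2 (lexp (psi σ) (ev σ b.1))) l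
    have e2 := congrFun (augAt_lcup_lunit y 2 (lsgn (lexp (psi σ) (ev σ b.1)))) l
    rw [ldelInt, Pi.sub_apply, Pi.sub_apply, Pi.sub_apply, map_sub, map_sub, map_sub, augAt_ldel,
      ldel_congr_sublist (hE b y), ← ev_dC σ hl]
    rw [e1, e2, lcup_congr_sublist (fun _ _ => rfl) (hE b y), lexp_nil, zero_mul, map_zero,
      sub_zero]
    congr 1
    refine lcup_congr_sublist (fun m hm => ?_) fun _ _ => rfl
    rw [lsgn, map_zsmul, hE b y m hm, lsgn]
  have hsg : lsgn (ev σ b.1) = -ev σ (inv R x b).1 := by rw [ev_inv, neg_neg]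
  -- Outer removals in the list given to b become cup products with ψ, because ψ is the expansion of
  -- `lunit 2`.
  have h3 : augAt (signBar R x y) (lexp (psi σ) (ldelInt (ev σ b.1)) l)
      = ev σ (opF (dC R x b) (signBar R x y)).1 l
        - augAt (signBar R x y) (lcup (psi σ) (lexp (psi σ) (ev σ b.1)) l)
        + augAt (signBar R x y) (lcup (lexp (psi σ) (ev σ (inv R x b).1)) (psi σ) l) := by
    have e0 : (fun l : List (Fin (N + 1)) => ev σ b.1 [] * lunit 1 l) = fun l => 0 * lunit 1 l := rfl
    rw [← hE _ _ _ (List.Sublist.refl l), lexp_congr (psi σ) fun m hm _ =>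
      ev_dC σ (hl.sublist hm) b, ldelInt, e0, lexp_sub, lexp_sub, lexp_sub, lexp_mul_left, hsg,
      lexp_lcup, lexp_lcup, lexp_neg, lcup_neg_left,
      lexp_lunit_two (psi_nil σ) (psi_singleton σ), zero_smul, sub_zero, Pi.sub_apply,
      Pi.sub_apply, Pi.neg_apply, sub_neg_eq_add, map_add, map_sub]
  rw [← hs, map_add, map_sub, h1, h2, ← augAt_signBar, h3, augAt_psi_lcup hX σ hl,
    augAt_lcup_psi hX σ hl (isHomog_inv hb), signBar_signBar] at h
  have hL : augAt y (opD R x * lexp (psi σ) (ev σ b.1) l) = ev σ (opF b (barD R x y)).1 l :=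
    hE b _ l (List.Sublist.refl l)
  have hi : opF (inv R x b) (signBar R x y) = inv R x (opF b y) := (inv_opC hX y b).symm
  have c1 : cv (cup R x) letterC (opF b ∘ₗ (signBar R x).toLinearMap) (signBar R x y)
      = -cv (cup R x) (inv R x ∘ₗ letterC) (opF b) y := by
    have e := LinearMap.congr_fun (cv_signBar (cup R x) letterC
      (opF b ∘ₗ (signBar R x).toLinearMap)) y
    have e' : (opF b ∘ₗ (signBar R x).toLinearMap) ∘ₗ (signBar R x).toLinearMap = opF b :=
      LinearMap.ext fun z => congrArg (opF b) (signBar_signBar z)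
    rw [e', letterC_signBar, map_neg] at e
    exact e
  have c2 : cv (cup R x) (opF (inv R x b)) (letterC ∘ₗ sgn R x q) (signBar R x y)
      = -cv (cup R x) (inv R x ∘ₗ opF b) (inv R x ∘ₗ letterC ∘ₗ sgn R x q) y := by
    have e := LinearMap.congr_fun (cv_signBar (cup R x) (opF (inv R x b))
      (letterC ∘ₗ sgn R x q)) y
    have e1 : opF (inv R x b) ∘ₗ (signBar R x).toLinearMap = inv R x ∘ₗ opF b :=
      LinearMap.ext fun z => (inv_opC hX z b).symm
    have e2 : (letterC ∘ₗ sgn R x q) ∘ₗ (signBar R x).toLinearMap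
        = -(inv R x ∘ₗ letterC ∘ₗ sgn R x q) := by
      refine LinearMap.ext fun z => ?_
      have := LinearMap.congr_fun (letterC_signBar (R := R) (x := x)) (sgn R x q z)
      simp only [LinearMap.comp_apply, AlgHom.toLinearMap_apply, sgn_signBar] at this ⊢
      exact this
    rw [e1, e2, map_neg] at e
    exact e
  -- The ε parts of the two products with ψ now coincide with the outer faces from `h2` and cancel.
  rw [hL, c1, c2, hi, ev_inv, lcup_neg_left, Pi.neg_apply] at h
  have g : ∀ a : C R x, ev σ a.1 l = evC σ l a := fun _ => rfl
  simp only [g, map_neg] at h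
  simp only [LinearMap.comp_apply, LinearMap.sub_apply, LinearMap.add_apply, map_sub, map_add,
    AlgHom.toLinearMap_apply]
  linear_combination h

end AcyclicBar

end

noncomputable section

namespace AcyclicBar

universe u v

section Bilinear

variable {R M : Type*} [CommRing R] [AddCommGroup M] [Module R M]
  {A B D : Type*} [AddCommGroup A] [Module R A] [AddCommGroup B] [Module R B]
  [AddCommGroup D] [Module R D]

lemma cv_add_bil (β β' : A →ₗ[R] B →ₗ[R] D) (f : TensorAlgebra R M →ₗ[R] A)
    (g : TensorAlgebra R M →ₗ[R] B) : cv (β + β') f g = cv β f g + cv β' f g := by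
  refine LinearMap.ext fun y => ?_
  simp only [cv, LinearMap.mk₂_apply, LinearMap.comp_apply, LinearMap.add_apply]
  generalize TensorProduct.map f g (deconcat R M y) = t
  induction t with
  | zero => simp
  | tmul a b => simp
  | add a b ha hb => simp only [map_add, ha, hb]; abel

lemma cv_neg_bil (β : A →ₗ[R] B →ₗ[R] D) (f : TensorAlgebra R M →ₗ[R] A)
    (g : TensorAlgebra R M →ₗ[R] B) : cv (-β) f g = -cv β f g := by
  refine eq_neg_of_add_eq_zero_left ?_
  rw [← cv_add_bil, neg_add_cancel]
  exact cv_eq_zero _ fun _ _ => rfl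

/-- A word is empty or consists of a first letter and a rest. -/
lemma id_eq_unit_add : (LinearMap.id : TensorAlgebra R M →ₗ[R] TensorAlgebra R M)
    = (LinearMap.toSpanSingleton R _ 1) ∘ₗ TensorAlgebra.algebraMapInv.toLinearMap
      + cv (consB R M) (letter R M) LinearMap.id := by
  refine word_ext' ?_ fun m y => ?_
  · rw [LinearMap.add_apply, cv_letter_one]; simp
  · rw [LinearMap.add_apply, cv_letter_cons]; simp [consB_apply, TensorAlgebra.algebraMapInv]

end Bilinear

variable {R : Type v} [CommRing R] {X : SSet.{u}} {x : X _⦋0⦌} {N : ℕ}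

/-! ### The differential of the bar construction -/

variable (R x) in
/-- Multiplication of the first letter of a word by a cochain. -/
def capB : Cbar R x →ₗ[R] Bar R x →ₗ[R] Bar R x :=
  LinearMap.mk₂ R (fun a y => LinearMap.mul' R _ (LinearMap.rTensor _
    (TensorAlgebra.ι R ∘ₗ cupBar R x a) (uncons R _ y)))
    (fun a a' y => by
      simp only [map_add, LinearMap.comp_add, LinearMap.rTensor_add, LinearMap.add_apply])
    (fun r a y => by
      simp only [map_smul, LinearMap.comp_smul, LinearMap.rTensor_smul, LinearMap.smul_apply])
    (fun a y y' => by simp only [map_add])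
    (fun r a y => by simp only [map_smul])

lemma capB_one (a : Cbar R x) : capB R x a 1 = 0 := by simp [capB, uncons_one]

lemma capB_cons (a b : Cbar R x) (y : Bar R x) : capB R x a (TensorAlgebra.ι R b * y)
    = TensorAlgebra.ι R (cupBar R x a b) * y := by simp [capB, uncons_cons]

lemma barD_cons_cap (v : Cbar R x) (y : Bar R x) : barD R x (TensorAlgebra.ι R v * y)
    = -(TensorAlgebra.ι R (dCbar R x v) * y) + TensorAlgebra.ι R (invBar R x v) * barD R x y
      - capB R x (invBar R x v) y := barD_cons v y

lemma capB_capB (a b : Cbar R x) (y : Bar R x) :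
    capB R x a (capB R x b y) = capB R x (cupBar R x a b) y := by
  induction y using word_induction with
  | one => simp only [capB_one, map_zero]
  | cons m y _ =>
    rw [capB_cons, capB_cons, capB_cons]
    congr 2
    exact incl_injective (cup_assoc (incl R x a) (incl R x b) (incl R x m)).symm
  | add y z hy hz => simp only [map_add, hy, hz]
  | smul r y hy => simp only [map_smul, hy]

lemma dCbar_dCbar (a : Cbar R x) : dCbar R x (dCbar R x a) = 0 :=
  incl_injective (dC_dC (incl R x a))

lemma dCbar_cupBar (a b : Cbar R x) : dCbar R x (cupBar R x a b)
    = cupBar R x (dCbar R x a) b - cupBar R x (invBar R x a) (dCbar R x b) := by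
  refine incl_injective ?_
  have h := dC_cup (incl R x a) (incl R x b)
  have h' : inv R x (incl R x a) = -incl R x (invBar R x a) := by rw [incl_invBar, neg_neg]
  rw [h', map_neg, LinearMap.neg_apply, ← sub_eq_add_neg] at h
  exact h

lemma barD_barD (y : Bar R x) : barD R x (barD R x y) = 0 := by
  -- Multiplying the first letter by m anticommutes with the differential up to dm. This combines
  -- the Leibniz rule for the cup product with associativity.
  have key : ∀ (m : Cbar R x) (y : Bar R x), barD R x (capB R x (invBar R x m) y)
      = -capB R x (dCbar R x (invBar R x m)) y - capB R x m (barD R x y) := by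
    intro m y
    induction y using word_induction with
    | one => simp only [capB_one, barD_one, map_zero, neg_zero, sub_zero]
    | cons b z _ =>
      rw [capB_cons, capB_cons, barD_cons_cap, barD_cons_cap, dCbar_cupBar, invBar_cupBar,
        invBar_invBar]
      simp only [map_sub, map_add, map_neg, capB_cons, capB_capB, sub_mul, neg_mul,
        LinearMap.neg_apply]
      abel
    | add y z hy hz => simp only [map_add, hy, hz]; abel
    | smul r y hy => simp only [map_smul, hy, smul_sub, smul_neg]
  induction y using word_induction with
  | one => rw [barD_one, map_zero]
  | cons m y ih =>
    rw [barD_cons_cap, map_sub, map_add, map_neg, barD_cons_cap, barD_cons_cap, dCbar_dCbar, key,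
      ih, invBar_dCbar, invBar_invBar]
    simp only [map_zero, zero_mul, mul_zero, map_neg, neg_mul, LinearMap.neg_apply]
    abel
  | add y z hy hz => rw [map_add, map_add, hy, hz, add_zero]
  | smul r y hy => rw [map_smul, map_smul, hy, smul_zero]

section Coderivation

variable {A B D : Type*} [AddCommGroup A] [Module R A] [AddCommGroup B] [Module R B]
  [AddCommGroup D] [Module R D]

/-- The altered first letter lies in the initial piece unless that piece is empty. -/
lemma cv_capB (β : A →ₗ[R] B →ₗ[R] D) (f : Bar R x →ₗ[R] A) (g : Bar R x →ₗ[R] B) (m : Cbar R x)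
    (y : Bar R x) : cv β f g (capB R x m y)
      = β (f 1) (g (capB R x m y)) + cv β (f ∘ₗ capB R x m) g y := by
  induction y using word_induction with
  | one => simp [capB_one, cv_one]
  | cons b y _ =>
    rw [capB_cons, cv_cons, cv_cons, LinearMap.comp_apply, capB_one, map_zero, map_zero,
      LinearMap.zero_apply, zero_add]
    have : (f ∘ₗ capB R x m) ∘ₗ consMap b = f ∘ₗ consMap (cupBar R x m b) :=
      LinearMap.ext fun z => congrArg f (capB_cons m b z)
    rw [this]
  | add y z hy hz => simp only [map_add, hy, hz]; abel
  | smul r y hy => simp only [map_smul, hy, smul_add]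

/-- The differential of the bar construction is a coderivation. -/
lemma cv_barD (β : A →ₗ[R] B →ₗ[R] D) (f : Bar R x →ₗ[R] A) (g : Bar R x →ₗ[R] B) :
    cv β f g ∘ₗ barD R x
      = cv β (f ∘ₗ barD R x) g + cv β (f ∘ₗ (signBar R x).toLinearMap) (g ∘ₗ barD R x) := by
  refine LinearMap.ext fun y => ?_
  induction y using word_induction generalizing f with
  | one => simp [barD_one, cv_one]
  | cons m y ih =>
    have e1 : (f ∘ₗ barD R x) ∘ₗ consMap m = -(f ∘ₗ consMap (dCbar R x m))
        + (f ∘ₗ consMap (invBar R x m)) ∘ₗ barD R x - f ∘ₗ capB R x (invBar R x m) := by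
      refine LinearMap.ext fun z => ?_
      simp only [LinearMap.comp_apply, consMap_apply, barD_cons_cap, map_sub, map_add, map_neg,
        LinearMap.sub_apply, LinearMap.add_apply, LinearMap.neg_apply]
    have e2 : (f ∘ₗ (signBar R x).toLinearMap) ∘ₗ consMap m
        = (f ∘ₗ consMap (invBar R x m)) ∘ₗ (signBar R x).toLinearMap :=
      LinearMap.ext fun z => congrArg f (signBar_cons m z)
    have h := ih (f ∘ₗ consMap (invBar R x m))
    simp only [LinearMap.comp_apply, LinearMap.add_apply] at h
    simp only [LinearMap.comp_apply, LinearMap.add_apply, cv_cons, e1, e2, barD_one]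
    simp only [barD_cons_cap, map_sub, map_add, map_neg, cv_cons, cv_capB, h, LinearMap.add_apply,
      LinearMap.sub_apply, LinearMap.neg_apply, map_zero, LinearMap.zero_apply,
      AlgHom.toLinearMap_apply, signBar_one]
    abel
  | add y z hy hz => rw [map_add, hy, hz, map_add]
  | smul r y hy => rw [map_smul, hy, map_smul]

end Coderivation

end AcyclicBar

end

noncomputable section

namespace AcyclicBar

universe u v

/-! ### Coproduct and product -/

section Words

variable {R M : Type*} [CommRing R] [AddCommGroup M] [Module R M]
  {A B D : Type*} [AddCommGroup A] [Module R A] [AddCommGroup B] [Module R B]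
  [AddCommGroup D] [Module R D]

lemma comp_sum_linear {ι : Type*} (s : Finset ι) (φ : B →ₗ[R] D) (f : ι → A →ₗ[R] B) :
    φ ∘ₗ ∑ i ∈ s, f i = ∑ i ∈ s, φ ∘ₗ f i :=
  LinearMap.ext fun y => by simp

lemma sum_comp_linear {ι : Type*} (s : Finset ι) (φ : ι → B →ₗ[R] D) (f : A →ₗ[R] B) :
    (∑ i ∈ s, φ i) ∘ₗ f = ∑ i ∈ s, φ i ∘ₗ f :=
  LinearMap.ext fun y => by simp

lemma cv_eq_lift_comp (β : A →ₗ[R] B →ₗ[R] D) (f : TensorAlgebra R M →ₗ[R] A)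
    (g : TensorAlgebra R M →ₗ[R] B) : cv β f g
      = (TensorProduct.lift β ∘ₗ TensorProduct.map f g) ∘ₗ deconcat R M := rfl

lemma cv_mk_id_id : cv (TensorProduct.mk R (TensorAlgebra R M) (TensorAlgebra R M))
    LinearMap.id LinearMap.id = deconcat R M := by
  simp [cv, TensorProduct.lift_mk]

/-- Concatenation of a letter and the first word of a pair. -/
def consTensor (B : Type*) [AddCommGroup B] [Module R B] :
    M →ₗ[R] (TensorAlgebra R M ⊗[R] B →ₗ[R] TensorAlgebra R M ⊗[R] B) :=
  LinearMap.rTensorHom B ∘ₗ consB R M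

lemma cv_mk_cv_consB (h : TensorAlgebra R M →ₗ[R] M)
    (k : TensorAlgebra R M →ₗ[R] TensorAlgebra R M) (g : TensorAlgebra R M →ₗ[R] B) :
    cv (TensorProduct.mk R _ _) (cv (consB R M) h k) g
      = cv (consTensor B) h (cv (TensorProduct.mk R _ _) k g) :=
  cv_assoc (fun _ _ _ => rfl) h k g

lemma deconcat_cv_consB (h : TensorAlgebra R M →ₗ[R] M)
    (k : TensorAlgebra R M →ₗ[R] TensorAlgebra R M) :
    deconcat R M ∘ₗ cv (consB R M) h k = TensorProduct.mk R _ _ 1 ∘ₗ cv (consB R M) h k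
      + cv (consTensor _) h (deconcat R M ∘ₗ k) := by
  have e : (consB R M).compr₂ (deconcat R M)
      = (consB R M).compr₂ (TensorProduct.mk R _ _ 1)
        + (consTensor (TensorAlgebra R M)).compl₂ (deconcat R M) := by
    refine LinearMap.ext₂ fun m y => ?_
    exact deconcat_cons m y
  rw [comp_cv, comp_cv, e, cv_add_bil]
  congr 1
  exact cv_congr_map _ _ fun _ _ => rfl

lemma cv_mk_id_eq (g : TensorAlgebra R M →ₗ[R] B) :
    cv (TensorProduct.mk R (TensorAlgebra R M) B) LinearMap.id g = TensorProduct.mk R _ _ 1 ∘ₗ g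
      + cv (consTensor B) (letter R M) (cv (TensorProduct.mk R _ _) LinearMap.id g) := by
  conv_lhs => rw [id_eq_unit_add]
  rw [map_add, LinearMap.add_apply, cv_mk_cv_consB, cv_unit_left]
  · simp
  · intro m y
    simp [TensorAlgebra.algebraMapInv]

lemma cv_mk_rec {f h k} (g : TensorAlgebra R M →ₗ[R] B)
    (hf : f = cv (consB R M) h k + cv (consB R M) (letter R M) f) :
    cv (TensorProduct.mk R _ _) f g = cv (consTensor B) h (cv (TensorProduct.mk R _ _) k g)
      + cv (consTensor B) (letter R M) (cv (TensorProduct.mk R _ _) f g) := by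
  conv_lhs => rw [hf]
  rw [map_add, LinearMap.add_apply, cv_mk_cv_consB, cv_mk_cv_consB]

lemma deconcat_rec {f h k} (hf : f = cv (consB R M) h k + cv (consB R M) (letter R M) f) :
    deconcat R M ∘ₗ f = (TensorProduct.mk R _ _ 1 ∘ₗ f
      + cv (consTensor _) h (deconcat R M ∘ₗ k))
      + cv (consTensor _) (letter R M) (deconcat R M ∘ₗ f) := by
  have e : deconcat R M ∘ₗ f = TensorProduct.mk R _ _ 1 ∘ₗ (cv (consB R M) h k
      + cv (consB R M) (letter R M) f) + cv (consTensor _) h (deconcat R M ∘ₗ k)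
      + cv (consTensor _) (letter R M) (deconcat R M ∘ₗ f) := by
    conv_lhs => rw [hf, LinearMap.comp_add, deconcat_cv_consB, deconcat_cv_consB]
    rw [LinearMap.comp_add]
    abel
  rwa [← hf] at e

/-- Both the coproduct of f and V solve the same recursion along the first letter, and word
induction gives uniqueness. -/
lemma deconcat_eq_of_rec {f h k V} (hf : f = cv (consB R M) h k + cv (consB R M) (letter R M) f)
    (hV : V = (TensorProduct.mk R _ _ 1 ∘ₗ f + cv (consTensor _) h (deconcat R M ∘ₗ k))
      + cv (consTensor _) (letter R M) V) : deconcat R M ∘ₗ f = V := by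
  have hd := deconcat_rec hf
  generalize TensorProduct.mk R (TensorAlgebra R M) (TensorAlgebra R M) 1 ∘ₗ f
    + cv (consTensor _) h (deconcat R M ∘ₗ k) = K at hV hd
  refine word_ext ?_ fun m y ih => ?_
  · rw [hd, hV, LinearMap.add_apply, LinearMap.add_apply, cv_letter_one, cv_letter_one]
  · rw [hd, hV, LinearMap.add_apply, LinearMap.add_apply, cv_letter_cons, cv_letter_cons, ih]

lemma sum_range_rec {V W : Type*} [AddCommMonoid V] [Module R V] [AddCommMonoid W]
    [Module R W] (E : V →ₗ[R] W) (L : W →ₗ[R] W) {A : ℕ → W} {B : ℕ → V} {c : W} {n : ℕ}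
    (h0 : A 0 = c + L (A 0)) (h : ∀ i, A (i + 1) = E (B i) + L (A (i + 1))) :
    ∑ i ∈ Finset.range (n + 1), A i
      = (c + E (∑ i ∈ Finset.range n, B i)) + L (∑ i ∈ Finset.range (n + 1), A i) := by
  rw [Finset.sum_range_succ', map_add, map_sum, map_sum]
  conv_lhs => rw [h0, Finset.sum_congr rfl fun i _ => h i, Finset.sum_add_distrib]
  abel

/-- The induction step for `deconcat_rmul` in abstract form: f is right multiplication by a word, h
the operation on its first letter, k multiplication by the rest. The index 0 leaves the whole right
factor in the second tensor factor. -/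
lemma deconcat_eq_sum {f h k} (hf : f = cv (consB R M) h k + cv (consB R M) (letter R M) f)
    {n : ℕ} {k' F G G' : ℕ → TensorAlgebra R M →ₗ[R] TensorAlgebra R M}
    (hk : deconcat R M ∘ₗ k = ∑ i ∈ Finset.range n, cv (TensorProduct.mk R _ _) (k' i) (G' i))
    (hF : F 0 = LinearMap.id) (hG : G 0 = f)
    (hF' : ∀ i, F (i + 1) = cv (consB R M) h (k' i) + cv (consB R M) (letter R M) (F (i + 1)))
    (hG' : ∀ i, G (i + 1) = G' i) :
    deconcat R M ∘ₗ f
      = ∑ i ∈ Finset.range (n + 1), cv (TensorProduct.mk R _ _) (F i) (G i) := by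
  refine deconcat_eq_of_rec hf ?_
  rw [hk]
  refine sum_range_rec (cv (consTensor _) h) (cv (consTensor _) (letter R _)) ?_ fun i => ?_
  · rw [hF, hG]
    exact cv_mk_id_eq f
  · rw [hG']
    exact cv_mk_rec _ (hF' i)

end Words

variable {R : Type v} [CommRing R] {X : SSet.{u}} {x : X _⦋0⦌} {N : ℕ}

lemma cv_hword {A B D : Type*} [AddCommGroup A] [Module R A] [AddCommGroup B] [Module R B]
    [AddCommGroup D] [Module R D] (β : A →ₗ[R] B →ₗ[R] D) (f : Bar R x →ₗ[R] A)
    (g : Bar R x →ₗ[R] B) (l : List (HLetter R x)) : cv β f g (hword l)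
      = ∑ i ∈ Finset.range (l.length + 1), β (f (hword (l.take i))) (g (hword (l.drop i))) := by
  induction l generalizing f with
  | nil => simp [cv_one]
  | cons a l ih =>
    rw [hword_cons, cv_cons, ih, List.length_cons, Finset.sum_range_succ' _ (l.length + 1),
      add_comm]
    simp [consMap_apply]

/-- The summands in the coproduct of a right multiplication. -/
def splitR (l : List (HLetter R x)) (i : ℕ) : Bar R x →ₗ[R] Bar R x :=
  rmul (hword (l.drop i)) ∘ₗ sgn R x (hdeg (l.take i))

lemma sgn_comp (p q : ℕ) : sgn R x p ∘ₗ sgn R x q = sgn R x (p + q) :=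
  LinearMap.ext fun y => (sgn_add p q y).symm

lemma splitR_cons (a : HLetter R x) (l : List (HLetter R x)) (i : ℕ) :
    splitR (a :: l) (i + 1) = splitR l i ∘ₗ sgn R x a.deg := by
  unfold splitR
  rw [LinearMap.comp_assoc, sgn_comp, List.drop_succ_cons, List.take_succ_cons, hdeg_cons,
    add_comm]

lemma splitR_zero (l : List (HLetter R x)) : splitR l 0 = rmul (hword l) := rfl

/-- Cutting a product cuts both factors; the sign moves the first piece of l past the second piece
of the left factor. -/
lemma deconcat_rmul (l : List (HLetter R x)) : deconcat R _ ∘ₗ rmul (hword l)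
    = ∑ i ∈ Finset.range (l.length + 1),
      cv (TensorProduct.mk R _ _) (rmul (hword (l.take i))) (splitR l i) := by
  induction l with
  | nil => simp [rmul_one, splitR_zero, cv_mk_id_id]
  | cons b l ih =>
    rw [hword_cons]
    have h1 := rmul_letter_rec b.homog (hword l)
    have h2 : deconcat R _ ∘ₗ (rmul (hword l) ∘ₗ sgn R x b.deg)
        = ∑ i ∈ Finset.range (l.length + 1), cv (TensorProduct.mk R _ _)
          (rmul (hword (l.take i)) ∘ₗ sgn R x b.deg) (splitR l i ∘ₗ sgn R x b.deg) := by
      rw [← LinearMap.comp_assoc _ (rmul (hword l)), ih, sum_comp_linear]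
      exact Finset.sum_congr rfl fun i _ => cv_sgn _ _ _ _
    exact @deconcat_eq_sum R (Cbar R x) _ _ _ (rmul (TensorAlgebra.ι R b.val * hword l))
      (opL b.val) (rmul (hword l) ∘ₗ sgn R x b.deg) h1 (l.length + 1)
      (fun i => rmul (hword (l.take i)) ∘ₗ sgn R x b.deg)
      (fun i => rmul (hword ((b :: l).take i))) (splitR (b :: l))
      (fun i => splitR l i ∘ₗ sgn R x b.deg) h2 rmul_one rfl
      (fun i => rmul_letter_rec b.homog (hword (l.take i))) (splitR_cons b l)

/-- The product is comultiplicative. -/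
lemma cv_rmul {A B D : Type*} [AddCommGroup A] [Module R A] [AddCommGroup B] [Module R B]
    [AddCommGroup D] [Module R D] (β : A →ₗ[R] B →ₗ[R] D) (f : Bar R x →ₗ[R] A)
    (g : Bar R x →ₗ[R] B) (l : List (HLetter R x)) : cv β f g ∘ₗ rmul (hword l)
    = ∑ i ∈ Finset.range (l.length + 1), cv β (f ∘ₗ rmul (hword (l.take i))) (g ∘ₗ splitR l i) := by
  rw [cv_eq_lift_comp, LinearMap.comp_assoc, deconcat_rmul, comp_sum_linear]
  refine Finset.sum_congr rfl fun i _ => ?_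
  rw [comp_cv]
  exact cv_congr_map _ _ fun y z => by simp

end AcyclicBar

end

noncomputable section

namespace AcyclicBar

universe u v

variable {R : Type v} [CommRing R] {X : SSet.{u}} {x : X _⦋0⦌} {N : ℕ}

lemma sum_add_rec {R V ι : Type*} [Semiring R] [AddCommMonoid V] [Module R V] (Λ : V →ₗ[R] V)
    {s : Finset ι} {F K : ι → V} {F' K' : V} (h : ∀ i, F i = K i + Λ (F i)) (h' : F' = K' + Λ F') :
    ∑ i ∈ s, F i + F' = (∑ i ∈ s, K i + K') + Λ (∑ i ∈ s, F i + F') := by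
  conv_lhs => rw [h', Finset.sum_congr rfl fun i _ => h i, Finset.sum_add_distrib]
  rw [map_add, map_sum, add_add_add_comm]

/-! ### Degrees of the operations -/

lemma lexp_eq_zero (σ : X _⦋N⦌) {f : List (Fin (N + 1)) → R} (hf : ∀ m, m ≠ [] → f m = 0)
    (l : List (Fin (N + 1))) : lexp (psi σ : _ → Op R x) f l = 0 := by
  rw [lexp_congr (psi σ) (f := f) (g := 0) fun m _ hm => hf m hm]
  have := lexp_mul_left (psi σ : _ → Op R x) 0 (0 : List (Fin (N + 1)) → R)
  simp only [zero_mul, zero_smul] at this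
  exact congrFun this _

/-- A count of edges: among p gaps, an ε takes one edge and a letter takes one more than its bar
degree, so exactly `p + hdeg L` edges are needed. -/
lemma augAt_hword_eq_zero (σ : X _⦋N⦌) (L : List (HLetter R x)) {p : ℕ}
    {f : List (Fin (N + 1)) → R} (hf : ∀ m, m.length ≠ p + 1 → f m = 0)
    {l : List (Fin (N + 1))} (hl : l.length ≠ p + hdeg L + 1) :
    augAt (hword L) (lexp (psi σ) f l) = 0 := by
  induction l using list_suffix_induction generalizing f p L with
  | nil => simp
  | cons v l ih =>
    rw [lexp_cons', map_add]
    cases p with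
    | zero =>
      have h0 : ∀ m, m ≠ [] → lder v f m = 0 := fun m hm => hf (v :: m) (by simpa using hm)
      rw [lcup_eq_sum, Finset.sum_eq_zero fun i _ => by rw [lexp_eq_zero σ h0, mul_zero], map_zero,
        add_zero]
      split_ifs with h
      · subst h
        cases L with
        | nil => simp at hl
        | cons a L => rw [augAt_algebraMap, hword_cons, counit_cons, mul_zero]
      · exact map_zero _
    | succ p =>
      have hf' : ∀ m, m.length ≠ p + 1 → lder v f m = 0 := fun m hm => hf (v :: m) (by simpa using hm)
      have h0 : augAt (hword L) (if l = [] then algebraMap R (Op R x) (f [v]) else 0) = 0 := by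
        split_ifs
        · rw [hf _ (by simp), map_zero, map_zero]
        · exact map_zero _
      rw [h0, zero_add, augAt_lcup]
      refine Finset.sum_eq_zero fun i _ => ?_
      have hi := i.isLt
      rw [lder_apply]
      have hlen : (l.take (i + 1)).length = i + 1 := by simp
      have hdr : (l.drop i).length = l.length - i := by simp
      rw [List.length_cons] at hl
      have hih : ∀ L' : List (HLetter R x), i + p + hdeg L' + 1 ≠ l.length →
          augAt (hword L') (lexp (psi σ) (lder v f) (l.drop i)) = 0 := by
        exact fun L' hL' => ih _ (List.drop_suffix _ _) L' hf' (by omega)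
      cases L with
      | nil =>
        rw [hword_nil, psi_unop_one, augAt_smul, lunit]
        split_ifs with h2
        · rw [List.length_cons, hlen] at h2
          have := hih [] (by simp at hl ⊢; omega)
          rw [hword_nil] at this
          rw [this, mul_zero]
        · rw [zero_mul]
      | cons a L =>
        rw [hdeg_cons] at hl
        rw [hword_cons, psi_unop_cons, ← hword_cons, signBar_hword, signBar_hword]
        simp only [augAt_add, augAt_smul, lunit]
        have e1 : ev σ a.val.1 (v :: l.take (i + 1)) * ((-1 : R) ^ hdeg L * augAt (hword L)
            (lexp (psi σ) (lder v f) (l.drop i))) = 0 := by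
          -- If the first gap fits the letter a, the rest of the word misses its degree; otherwise a
          -- vanishes on the gap.
          by_cases h : (i : ℕ) = a.deg
          · rw [hih L (by omega), mul_zero, mul_zero]
          · rw [ev_eq_zero_of_homog σ a.homog (by rw [List.length_cons, hlen]; omega), zero_mul]
        rw [e1, zero_add]
        split_ifs with h2
        · rw [List.length_cons, hlen] at h2
          rw [hih _ (by rw [hdeg_cons]; omega), mul_zero, mul_zero]
        · rw [zero_mul]

lemma letter_cv_consB (h : Bar R x →ₗ[R] Cbar R x) (g : Bar R x →ₗ[R] Bar R x) :
    letter R _ ∘ₗ cv (consB R _) h g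
      = cv (LinearMap.lsmul R _).flip h ((counit R x).toLinearMap ∘ₗ g) := by
  rw [comp_cv]
  exact cv_congr_map _ _ fun y z => letter_cons _ _

lemma counit_comp_rmul (y : Bar R x) : (counit R x).toLinearMap ∘ₗ rmul y
    = counit R x y • (counit R x).toLinearMap := by
  induction y using word_induction with
  | one => rw [rmul_one, map_one, one_smul]; rfl
  | cons b y _ =>
    rw [counit_cons, zero_smul]
    exact LinearMap.ext fun z => counit_rmul_cons b y z
  | add y z hy hz => rw [rmul_add, LinearMap.comp_add, hy, hz, map_add, add_smul]
  | smul r y hy => rw [rmul_smul, LinearMap.comp_smul, hy, map_smul, smul_smul]; rfl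

/-- Each letter of the right factor contributes a letter to the product. So a single letter arises
only from y empty with the entire left factor absorbed into the operation on b. -/
lemma letter_comp_rmul {q : ℕ} {b : Cbar R x} (hb : IsHomog (q + 1) b.1) (y : Bar R x) :
    letter R _ ∘ₗ rmul (TensorAlgebra.ι R b * y) = counit R x y • opL b := by
  rw [rmul_letter_rec hb, LinearMap.comp_add, letter_cv_consB, letter_cv_consB, counit_comp_rmul,
    counit_cons, zero_smul, map_zero, add_zero, ← LinearMap.comp_assoc _ _ (counit R x).toLinearMap,
    counit_comp_rmul]
  have e : (counit R x y • (counit R x).toLinearMap) ∘ₗ sgn R x q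
      = counit R x y • (counit R x).toLinearMap :=
    LinearMap.ext fun z => congrArg (counit R x y * ·) (counit_sgn q z)
  rw [e, map_smul, cv_unit_right _ _ fun m y => counit_cons m y]
  refine LinearMap.ext fun z => ?_
  simp

/-- In the coproduct of a right multiplication, the first tensor factor can be a single letter only
if it takes none or just the first letter of the right factor. -/
lemma cv_letter_rmul {A D : Type*} [AddCommGroup A] [Module R A] [AddCommGroup D] [Module R D]
    (β : Cbar R x →ₗ[R] A →ₗ[R] D) (g : Bar R x →ₗ[R] A) (e : HLetter R x)
    (l : List (HLetter R x)) : cv β (letter R _) g ∘ₗ rmul (hword (e :: l))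
      = cv β (opL e.val) ((g ∘ₗ rmul (hword l)) ∘ₗ sgn R x e.deg)
        + cv β (letter R _) (g ∘ₗ rmul (hword (e :: l))) := by
  rw [cv_rmul, List.length_cons, Finset.sum_range_succ' _ (l.length + 1), List.take_zero, hword_nil,
    rmul_one, LinearMap.comp_id, splitR_zero, Finset.sum_range_succ']
  congr 1
  rw [Finset.sum_eq_zero, zero_add, splitR_cons, splitR_zero, List.take_succ_cons, List.take_zero,
    hword_cons, letter_comp_rmul e.homog, hword_nil, map_one, one_smul]
  · rfl
  · intro i hi
    cases l with
    | nil => simp at hi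
    | cons a l =>
      rw [List.take_succ_cons, List.take_succ_cons, hword_cons, letter_comp_rmul e.homog,
        hword_cons, counit_cons, zero_smul, map_zero, LinearMap.zero_apply]

/-- The terms of the product of two words that start with an operation. -/
def rmulHead (b : HLetter R x) (z : Bar R x) (l : List (HLetter R x)) (i : ℕ) :
    Cbar R x × Bar R x :=
  (opL b.val (hword (l.take i)), rmul z (sgn R x b.deg (hword (l.drop i))))

lemma rmul_hword_cons (b : HLetter R x) (z : Bar R x) (e : HLetter R x) (l : List (HLetter R x)) :
    rmul (TensorAlgebra.ι R b.val * z) (hword (e :: l))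
      = ∑ i ∈ Finset.range (l.length + 2), TensorAlgebra.ι R (rmulHead b z (e :: l) i).1 *
          (rmulHead b z (e :: l) i).2
        + TensorAlgebra.ι R e.val * rmul (TensorAlgebra.ι R b.val * z) (hword l) := by
  rw [rmul_letter_rec b.homog, LinearMap.add_apply, cv_hword, ← rmul_letter_rec b.homog,
    hword_cons, cv_letter_cons]
  rfl

variable (hX : ∀ e : X _⦋1⦌, e = constSimplex X x 1)

include hX

lemma isHomog_opF {p : ℕ} {c : C R x} (hc : IsHomog p c.1) (L : List (HLetter R x)) :
    IsHomog (p + hdeg L) (opF c (hword L)).1 := by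
  intro n hn
  funext σ
  rw [← ev_finRange σ (opF c (hword L)).1]
  refine (ev_opC hX σ _ c (pairwise_finRange _)).trans ?_
  exact augAt_hword_eq_zero σ L (fun m hm => ev_eq_zero_of_homog σ hc hm)
    (by rw [List.length_finRange]; omega)

lemma isHomog_opL {q : ℕ} {b : Cbar R x} (hb : IsHomog (q + 1) b.1) (L : List (HLetter R x)) :
    IsHomog (q + hdeg L + 1) (opL b (hword L)).1 := by
  have h := isHomog_opF hX (c := incl R x b) hb L
  rw [opF_apply, ← incl_opBar, add_right_comm] at h
  exact h

/-! ### Associativity of the product on the bar construction -/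

lemma opL_comp_rmul (c : Cbar R x) (y : Bar R x) : opL c ∘ₗ rmul y = opL (opL c y) :=
  LinearMap.ext fun z => incl_injective <| by
    simp only [LinearMap.comp_apply, opL_apply, rmul_apply, incl_opBar, opC_barMul hX]

lemma sgn_comp_rmul (p : ℕ) (y : Bar R x) :
    sgn R x p ∘ₗ rmul y = rmul (sgn R x p y) ∘ₗ sgn R x p := by
  induction p generalizing y with
  | zero => rfl
  | succ p ih =>
    refine LinearMap.ext fun z => ?_
    have h1 := LinearMap.congr_fun (ih y) z
    have h2 := LinearMap.congr_fun (signBar_rmul hX (sgn R x p y)) (sgn R x p z)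
    simp only [LinearMap.comp_apply, AlgHom.toLinearMap_apply] at h1 h2 ⊢
    rw [sgn_succ, h1, h2, sgn_succ, sgn_succ]

lemma opL_one (b : Cbar R x) : opL b 1 = b :=
  incl_injective <| by rw [opL_apply, incl_opBar, opC_one_left hX]

lemma rmul_apply_one (y : Bar R x) : rmul y 1 = y := by
  have h : barMul R x 1 = LinearMap.id := by
    refine hword_ext fun l => ?_
    induction l with
    | nil => exact barMul_nil 1
    | cons b l ih =>
      have := LinearMap.congr_fun (rmul_letter_rec b.homog (hword l)) 1
      rw [LinearMap.add_apply, cv_one, cv_letter_one, add_zero, LinearMap.comp_apply, sgn_one,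
        opL_one hX] at this
      rw [hword_cons]
      refine this.trans ?_
      rw [consB_apply]
      exact congrArg _ ih
  exact LinearMap.congr_fun h y

/-- Both sides satisfy one recursion along the first letter of the argument. That first letter is an
operation on b, on e, or an old letter, and iterated operations agree by `opL_comp_rmul`. The outer
induction shortens L, the inner one the right factor in the middle. -/
lemma rmul_comp_rmul_hword (L : List (HLetter R x)) (y : Bar R x) :
    rmul (hword L) ∘ₗ rmul y = rmul (rmul (hword L) y) := by
  induction L generalizing y with
  | nil => rw [hword_nil, rmul_one, LinearMap.id_comp, LinearMap.id_apply]
  | cons b L ih =>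
    -- For fixed u the claim is linear in y, so homogeneous words suffice; these are what `cv_rmul`
    -- needs.
    suffices h : ∀ l, rmul (hword (b :: L)) ∘ₗ rmul (hword l)
        = rmul (rmul (hword (b :: L)) (hword l)) by
      refine LinearMap.ext fun u => ?_
      have e : rmul (hword (b :: L)) ∘ₗ barMul R x u = barMul R x u ∘ₗ rmul (hword (b :: L)) :=
        hword_ext fun l => LinearMap.congr_fun (h l) u
      exact LinearMap.congr_fun e y
    intro l
    rw [hword_cons]
    set z := hword L
    set Z := TensorAlgebra.ι R b.val * z with hZ
    induction l with
    | nil =>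
      rw [hword_nil, rmul_one, LinearMap.comp_id]
      rw [rmul_apply_one hX]
    | cons e l ihl =>
      -- Here the outer induction hypothesis associates the product behind the operation on b.
      have hr : ∀ i, (rmul z ∘ₗ sgn R x b.deg) ∘ₗ splitR (e :: l) i
          = rmul (rmulHead b z (e :: l) i).2 ∘ₗ sgn R x (b.deg + hdeg ((e :: l).take i)) := by
        intro i
        rw [splitR, LinearMap.comp_assoc, ← LinearMap.comp_assoc _ _ (sgn R x b.deg),
          sgn_comp_rmul hX, LinearMap.comp_assoc, sgn_comp, ← LinearMap.comp_assoc, ih]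
        rfl
      have e1 : rmul Z ∘ₗ rmul (hword (e :: l))
          = (∑ i ∈ Finset.range (l.length + 2), cv (consB R _) (opL (rmulHead b z (e :: l) i).1)
              (rmul (rmulHead b z (e :: l) i).2 ∘ₗ sgn R x (b.deg + hdeg ((e :: l).take i)))
            + cv (consB R _) (opL e.val) (rmul (rmul Z (hword l)) ∘ₗ sgn R x e.deg))
            + cv (consB R _) (letter R _) (rmul Z ∘ₗ rmul (hword (e :: l))) := by
        rw [add_assoc, ← ihl, ← cv_letter_rmul]
        conv_lhs => rw [hZ, rmul_letter_rec b.homog, LinearMap.add_comp, cv_rmul]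
        refine congrArg (· + _) ?_
        refine Finset.sum_congr rfl fun i _ => ?_
        rw [hr, opL_comp_rmul hX]
        rfl
      have hb : ∀ i, IsHomog (b.deg + hdeg ((e :: l).take i) + 1)
          (rmulHead b z (e :: l) i).1.1 := fun i => isHomog_opL hX b.homog _
      -- On this side the product of the two right factors is expanded into words first, and each
      -- word contributes its own recursion.
      have e2 : ∀ y, y = rmul Z (hword (e :: l)) → rmul y
          = (∑ i ∈ Finset.range (l.length + 2), cv (consB R _) (opL (rmulHead b z (e :: l) i).1)
              (rmul (rmulHead b z (e :: l) i).2 ∘ₗ sgn R x (b.deg + hdeg ((e :: l).take i)))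
            + cv (consB R _) (opL e.val) (rmul (rmul Z (hword l)) ∘ₗ sgn R x e.deg))
            + cv (consB R _) (letter R _) (rmul y) := by
        intro y hy
        rw [rmul_hword_cons] at hy
        have hs : rmul y = ∑ i ∈ Finset.range (l.length + 2),
            rmul (TensorAlgebra.ι R (rmulHead b z (e :: l) i).1 * (rmulHead b z (e :: l) i).2)
            + rmul (TensorAlgebra.ι R e.val * rmul Z (hword l)) := by
          rw [hy, rmul_add]
          congr 1
          exact map_sum (barMul R x).flip _ _
        rw [hs]
        exact sum_add_rec (cv (consB R _) (letter R _)) (fun i => rmul_letter_rec (hb i) _)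
          (rmul_letter_rec e.homog _)
      exact cv_letter_unique e1 (e2 _ rfl)

lemma rmul_comp_rmul (y z : Bar R x) : rmul z ∘ₗ rmul y = rmul (rmul z y) := by
  refine LinearMap.ext fun u => ?_
  have e : barMul R x (barMul R x u y) = barMul R x u ∘ₗ barMul R x y :=
    hword_ext fun l => LinearMap.congr_fun (rmul_comp_rmul_hword hX l y) u
  exact LinearMap.congr_fun e z

end AcyclicBar

end

noncomputable section

namespace AcyclicBar

universe u v

variable {R : Type v} [CommRing R] {X : SSet.{u}} {x : X _⦋0⦌} {N : ℕ}

/-! ### The differential and the product on the bar construction -/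

lemma barD_cv_consB (f : Bar R x →ₗ[R] Cbar R x) (g : Bar R x →ₗ[R] Bar R x) :
    barD R x ∘ₗ cv (consB R _) f g = -cv (consB R _) (dCbar R x ∘ₗ f) g
      + cv (consB R _) (invBar R x ∘ₗ f) (barD R x ∘ₗ g) - cv (capB R x) (invBar R x ∘ₗ f) g := by
  have e : (consB R _).compr₂ (barD R x) = -(consB R _ ∘ₗ dCbar R x)
      + ((consB R _ ∘ₗ invBar R x).compl₂ (barD R x) + -(capB R x ∘ₗ invBar R x)) := by
    refine LinearMap.ext₂ fun m y => ?_
    refine (barD_cons_cap m y).trans ?_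
    rw [sub_eq_add_neg, add_assoc]
    rfl
  rw [comp_cv, e, cv_add_bil, cv_add_bil, cv_neg_bil, cv_neg_bil, sub_eq_add_neg, add_assoc]
  congr 1
  · exact congrArg _ (cv_congr_map _ _ fun _ _ => rfl)
  congr 1
  · exact cv_congr_map _ _ fun _ _ => rfl
  · exact congrArg _ (cv_congr_map _ _ fun _ _ => rfl)

lemma cv_capB_cv_consB (f h : Bar R x →ₗ[R] Cbar R x) (g : Bar R x →ₗ[R] Bar R x) :
    cv (capB R x) f (cv (consB R _) h g) = cv (consB R _) (cv (cupBar R x) f h) g :=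
  (cv_assoc (fun a b c => (capB_cons a b c).symm) f h g).symm

lemma letter_capB (a : Cbar R x) (y : Bar R x) :
    letter R _ (capB R x a y) = cupBar R x a (letter R _ y) := by
  induction y using word_induction with
  | one => rw [capB_one, letter_one, map_zero, map_zero]
  | cons b y _ => rw [capB_cons, letter_cons, letter_cons, map_smul]
  | add y z hy hz => simp only [map_add, hy, hz]
  | smul r y hy => simp only [map_smul, hy]

/-- A single letter in a differential comes from the coboundary of a single letter or from the
product of exactly two letters. -/
lemma letter_comp_barD : letter R _ ∘ₗ barD R x
    = -(dCbar R x ∘ₗ letter R _) - cv (cupBar R x) (invBar R x ∘ₗ letter R _) (letter R _) := by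
  have e : cv (cupBar R x) (invBar R x ∘ₗ letter R _) (letter R _)
      = cv (cupBar R x ∘ₗ invBar R x) (letter R _) (letter R _) :=
    cv_congr_map _ _ fun _ _ => rfl
  rw [e]
  refine word_ext' ?_ fun m y => ?_
  · rw [LinearMap.sub_apply, cv_letter_one]
    simp [barD_one, letter_one]
  · have h := counit_barD y
    rw [LinearMap.sub_apply, cv_letter_cons, LinearMap.comp_apply, barD_cons_cap, map_sub, map_add,
      map_neg, letter_cons, letter_cons, letter_capB]
    change -_ + counit R x (barD R x y) • _ - _ = _
    rw [h, zero_smul, add_zero, LinearMap.neg_apply, LinearMap.comp_apply, letter_cons, map_smul]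
    rfl

lemma rmul_letter_signBar {q : ℕ} {b : Cbar R x} (hb : IsHomog (q + 1) b.1) (y : Bar R x) :
    rmul (TensorAlgebra.ι R b * y) ∘ₗ (signBar R x).toLinearMap
      = cv (consB R _) (opL b ∘ₗ (signBar R x).toLinearMap)
          ((rmul y ∘ₗ (signBar R x).toLinearMap) ∘ₗ sgn R x q)
        + cv (consB R _) (invBar R x ∘ₗ letter R _)
          (rmul (TensorAlgebra.ι R b * y) ∘ₗ (signBar R x).toLinearMap) := by
  conv_lhs => rw [rmul_letter_rec hb, LinearMap.add_comp, cv_signBar, cv_signBar, letter_signBar]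
  have e : (rmul y ∘ₗ sgn R x q) ∘ₗ (signBar R x).toLinearMap
      = (rmul y ∘ₗ (signBar R x).toLinearMap) ∘ₗ sgn R x q :=
    LinearMap.ext fun z => congrArg (rmul y) (sgn_signBar q z)
  rw [e]

lemma isHomog_cup {p q : ℕ} {a b : Coch R X} (ha : IsHomog p a) (hb : IsHomog q b) :
    IsHomog (p + q) (cupFun a b) := by
  intro n hn
  funext σ
  refine Finset.sum_eq_zero fun i _ => ?_
  by_cases h : (i : ℕ) = p
  · rw [hb (n - i) (by omega)]
    simp
  · rw [ha i h]
    simp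

lemma isHomog_coboundary {p : ℕ} {a : Coch R X} (ha : IsHomog p a) :
    IsHomog (p + 1) (coboundary a) := by
  intro n hn
  cases n with
  | zero => rfl
  | succ n =>
    funext σ
    have h : a n = 0 := ha n (by omega)
    simp [coboundary, h]

lemma isHomog_invBar {q : ℕ} {b : Cbar R x} (hb : IsHomog q b.1) :
    IsHomog q (invBar R x b).1 := by
  intro n hn
  funext σ
  change -((-1) ^ n * b.1 n σ) = 0
  rw [hb n hn]
  simp

lemma sgn_barD (q : ℕ) (y : Bar R x) :
    sgn R x q (barD R x y) = (-1 : R) ^ q • barD R x (sgn R x q y) := by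
  induction q with
  | zero => rw [pow_zero, one_smul]; rfl
  | succ q ih => rw [sgn_succ, ih, map_smul, signBar_barD, sgn_succ, pow_succ, mul_smul]; simp

lemma opF_incl (c : Cbar R x) : opF (incl R x c) = incl R x ∘ₗ opL c :=
  LinearMap.ext fun y => (incl_opBar y c).symm

lemma cv_incl (f g : Bar R x →ₗ[R] Cbar R x) : incl R x ∘ₗ cv (cupBar R x) f g
    = cv (cup R x) (incl R x ∘ₗ f) (incl R x ∘ₗ g) := by
  rw [comp_cv]
  exact cv_congr_map _ _ fun _ _ => rfl

variable (hX : ∀ e : X _⦋1⦌, e = constSimplex X x 1)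

include hX

lemma invBar_comp_opL (b : Cbar R x) :
    invBar R x ∘ₗ opL b = opL (invBar R x b) ∘ₗ (signBar R x).toLinearMap :=
  LinearMap.ext fun z => invBar_opL hX z b

lemma opL_cupBar {q : ℕ} {b : Cbar R x} (hb : IsHomog (q + 1) b.1) (c : Cbar R x) :
    opL (cupBar R x b c) = cv (cupBar R x) (opL b) (opL c ∘ₗ sgn R x (q + 1)) := by
  have h := opF_cup (b := incl R x b) hX hb (incl R x c)
  rw [opF_incl, opF_incl, LinearMap.comp_assoc, ← cv_incl] at h
  refine LinearMap.ext fun y => incl_injective ?_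
  rw [opL_apply, incl_opBar]
  exact LinearMap.congr_fun h y

/-- This is `dC_opF` in shifted degrees: `inv` becomes minus `invBar`, and on the last letter it
reduces the sign from q + 1 to q. -/
lemma dCbar_opL {q : ℕ} {b : Cbar R x} (hb : IsHomog (q + 1) b.1) : dCbar R x ∘ₗ opL b =
    opL (dCbar R x b) ∘ₗ (signBar R x).toLinearMap - opL b ∘ₗ barD R x
      - cv (cupBar R x) (invBar R x ∘ₗ letter R _) (opL b)
      - cv (cupBar R x) (invBar R x ∘ₗ opL b) (letter R _ ∘ₗ sgn R x q) := by
  have h := dC_opF (b := incl R x b) hX hb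
  have hd : dC R x (incl R x b) = incl R x (dCbar R x b) := rfl
  have h1 : inv R x ∘ₗ letterC = -(incl R x ∘ₗ (invBar R x ∘ₗ letter R _)) :=
    LinearMap.ext fun y => by
      simp only [LinearMap.comp_apply, LinearMap.neg_apply, incl_invBar, neg_neg]
      rfl
  have h2 : inv R x ∘ₗ incl R x ∘ₗ opL b = -(incl R x ∘ₗ (invBar R x ∘ₗ opL b)) :=
    LinearMap.ext fun y => by
      simp only [LinearMap.comp_apply, LinearMap.neg_apply, incl_invBar, neg_neg]
  have h3 : inv R x ∘ₗ letterC ∘ₗ sgn R x (q + 1) = -(incl R x ∘ₗ (letter R _ ∘ₗ sgn R x q)) := by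
    rw [← LinearMap.comp_assoc, h1]
    refine LinearMap.ext fun y => ?_
    have e := LinearMap.congr_fun (letter_signBar (R := R) (x := x)) (sgn R x (q + 1) y)
    simp only [LinearMap.comp_apply, LinearMap.neg_apply] at e ⊢
    rw [← e, sgn_succ, AlgHom.toLinearMap_apply, signBar_signBar]
  rw [hd, opF_incl, opF_incl, h1, h2, h3, map_neg, map_neg, LinearMap.neg_apply, map_neg, LinearMap.neg_apply,
    neg_neg, ← cv_incl, ← cv_incl] at h
  refine LinearMap.ext fun y => incl_injective ?_
  have h' := LinearMap.congr_fun h y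
  simp only [LinearMap.sub_apply, LinearMap.add_apply, LinearMap.neg_apply, LinearMap.comp_apply,
    map_sub] at h' ⊢
  refine Eq.trans h' ?_
  abel

end AcyclicBar

end

/-! ### The bar product is compatible with the differential -/

noncomputable section

namespace AcyclicBar

universe u v

variable {R : Type v} [CommRing R] {X : SSet.{u}} {x : X _⦋0⦌} {N : ℕ}

lemma rmul_zero : rmul (0 : Bar R x) = 0 := map_zero _

lemma sgn_succ_comp_signBar (q : ℕ) :
    sgn R x (q + 1) ∘ₗ (signBar R x).toLinearMap = sgn R x q :=
  LinearMap.ext fun y => by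
    rw [LinearMap.comp_apply, sgn_add q 1, sgn_one_eq, AlgHom.toLinearMap_apply, signBar_signBar]

lemma cv_capB_sgn (f : Bar R x →ₗ[R] Cbar R x) (q : ℕ) : cv (capB R x) f (sgn R x q)
    = cv (consB R _) (cv (cupBar R x) f (letter R _ ∘ₗ sgn R x q)) (sgn R x q) := by
  have h := congrArg (fun P => P ∘ₗ sgn R x q) (id_eq_unit_add (R := R) (M := Cbar R x))
  rw [LinearMap.id_comp, LinearMap.add_comp, cv_sgn, LinearMap.id_comp] at h
  conv_lhs => rw [h, map_add]
  rw [cv_capB_cv_consB, cv_eq_zero, zero_add]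
  intro y z
  rw [LinearMap.comp_apply, LinearMap.comp_apply, LinearMap.toSpanSingleton_apply, map_smul,
    capB_one, smul_zero]

/-- Solutions of recursions with a common linear part Λ can be combined linearly, along with their
initial terms. -/
lemma add_rec {R V : Type*} [Ring R] [AddCommGroup V] [Module R V] (Λ : V →ₗ[R] V)
    {f g h k f' g' h' k' : V} (hf : f = f' + Λ f) (hg : g = g' + Λ g) (hh : h = h' + Λ h)
    (hk : k = k' + Λ k) : f + (-g + h - k) = (f' + (-g' + h' - k')) + Λ (f + (-g + h - k)) := by
  conv_lhs => rw [hf, hg, hh, hk]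
  simp only [map_add, map_sub, map_neg]
  abel

lemma rmul_barD_cons (b : Cbar R x) (y : Bar R x) : rmul (barD R x (TensorAlgebra.ι R b * y))
    = -rmul (TensorAlgebra.ι R (dCbar R x b) * y)
      + rmul (TensorAlgebra.ι R (invBar R x b) * barD R x y)
      - rmul (capB R x (invBar R x b) y) := by
  rw [barD_cons_cap]
  unfold rmul
  rw [map_sub, map_add, map_neg]

variable (hX : ∀ e : X _⦋1⦌, e = constSimplex X x 1)

include hX

/-- G collects the products of an operation on b with an adjacent operation on the next letter c. By
`opL_cupBar` it is the same whether the merging happens before or after multiplying. For empty L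
there is no next letter and G is 0. In the second equation the other neighbour is a letter of the
left factor. -/
lemma exists_capB_term (b : HLetter R x) (L : List (HLetter R x)) : ∃ G : Bar R x →ₗ[R] Bar R x,
    rmul (capB R x (invBar R x b.val) (hword L)) ∘ₗ (signBar R x).toLinearMap
      = G + cv (consB R _) (invBar R x ∘ₗ letter R _)
        (rmul (capB R x (invBar R x b.val) (hword L)) ∘ₗ (signBar R x).toLinearMap) ∧
    cv (capB R x) (invBar R x ∘ₗ opL b.val) (rmul (hword L) ∘ₗ sgn R x b.deg)
      = G + cv (consB R _) (cv (cupBar R x) (invBar R x ∘ₗ opL b.val)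
          (letter R _ ∘ₗ sgn R x b.deg)) (rmul (hword L) ∘ₗ sgn R x b.deg) := by
  cases L with
  | nil =>
    refine ⟨0, ?_, ?_⟩
    · rw [hword_nil, capB_one, rmul_zero, LinearMap.zero_comp, map_zero, add_zero]
    · rw [hword_nil, rmul_one, LinearMap.id_comp, zero_add]
      exact cv_capB_sgn _ _
  | cons c L =>
    refine ⟨cv (consB R _) (cv (cupBar R x) (invBar R x ∘ₗ opL b.val) (opL c.val ∘ₗ sgn R x b.deg))
      ((rmul (hword L) ∘ₗ sgn R x c.deg) ∘ₗ sgn R x b.deg), ?_, ?_⟩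
    rotate_left
    · have h := congrArg (fun P => P ∘ₗ sgn R x b.deg) (rmul_letter_rec c.homog (hword L))
      rw [LinearMap.add_comp, cv_sgn, cv_sgn] at h
      rw [hword_cons]
      conv_lhs => rw [h, map_add]
      rw [cv_capB_cv_consB, cv_capB_cv_consB]
    · have hc : IsHomog (b.deg + 1 + c.deg + 1) (cupBar R x (invBar R x b.val) c.val).1 :=
        isHomog_cup (q := c.deg + 1) (isHomog_invBar b.homog) c.homog
      rw [hword_cons, capB_cons]
      conv_lhs => rw [rmul_letter_signBar hc]
      refine congrArg (· + _) ?_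
      rw [opL_cupBar hX (isHomog_invBar b.homog), cv_signBar, LinearMap.comp_assoc _ _ (opL c.val),
        sgn_succ_comp_signBar, invBar_comp_opL hX]
      refine congrArg _ ?_
      rw [LinearMap.comp_assoc, LinearMap.comp_assoc, sgn_comp]
      refine congrArg _ (LinearMap.ext fun z => ?_)
      rw [LinearMap.comp_apply, AlgHom.toLinearMap_apply, ← sgn_succ]
      -- The involutions of the two degree shifts cancel.
      have : b.deg + 1 + c.deg + 1 = (c.deg + b.deg) + 1 + 1 := by ring
      rw [this, sgn_succ, sgn_succ, signBar_signBar]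

lemma rmul_barD_rec (b : HLetter R x) (w : Bar R x) :
    rmul (TensorAlgebra.ι R b.val * w) ∘ₗ barD R x
      = (cv (consB R _) (opL b.val ∘ₗ barD R x) (rmul w ∘ₗ sgn R x b.deg)
        + cv (consB R _) (invBar R x ∘ₗ opL b.val) ((rmul w ∘ₗ barD R x) ∘ₗ sgn R x b.deg)
        + cv (consB R _) (letter R _ ∘ₗ barD R x) (rmul (TensorAlgebra.ι R b.val * w)))
        + cv (consB R _) (invBar R x ∘ₗ letter R _)
          (rmul (TensorAlgebra.ι R b.val * w) ∘ₗ barD R x) := by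
  have h : cv (consB R _) (opL b.val ∘ₗ (signBar R x).toLinearMap)
        ((rmul w ∘ₗ sgn R x b.deg) ∘ₗ barD R x)
      = cv (consB R _) (invBar R x ∘ₗ opL b.val) ((rmul w ∘ₗ barD R x) ∘ₗ sgn R x b.deg) := by
    have h1 : (rmul w ∘ₗ sgn R x b.deg) ∘ₗ barD R x
        = (-1 : R) ^ b.deg • (rmul w ∘ₗ barD R x) ∘ₗ sgn R x b.deg := LinearMap.ext fun z => by
      simp only [LinearMap.comp_apply, LinearMap.smul_apply, sgn_barD, map_smul]
    have h2 : invBar R x ∘ₗ opL b.val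
        = (-1 : R) ^ b.deg • opL b.val ∘ₗ (signBar R x).toLinearMap := by
      rw [invBar_comp_opL hX, invBar_of_homog b.homog]
      unfold opL
      rw [map_smul]
      rfl
    rw [h1, h2, map_smul, map_smul, LinearMap.smul_apply]
  conv_lhs => rw [rmul_letter_rec b.homog, LinearMap.add_comp, cv_barD, cv_barD, letter_signBar, h]
  simp only [add_assoc]

/-- `dCbar_opL` produces products of the operation on b with an adjacent letter of the left factor.
These cancel against the products formed by the bar differential, and only G and the differentials
of the factors are left. -/
lemma barD_rmul_rec (b : HLetter R x) (w : Bar R x) (G : Bar R x →ₗ[R] Bar R x)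
    (hG : cv (capB R x) (invBar R x ∘ₗ opL b.val) (rmul w ∘ₗ sgn R x b.deg)
      = G + cv (consB R _) (cv (cupBar R x) (invBar R x ∘ₗ opL b.val)
          (letter R _ ∘ₗ sgn R x b.deg)) (rmul w ∘ₗ sgn R x b.deg))
    (ih : barD R x ∘ₗ rmul w = rmul w ∘ₗ barD R x
      + rmul (barD R x w) ∘ₗ (signBar R x).toLinearMap) :
    barD R x ∘ₗ rmul (TensorAlgebra.ι R b.val * w)
      = ((cv (consB R _) (opL b.val ∘ₗ barD R x) (rmul w ∘ₗ sgn R x b.deg)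
        + cv (consB R _) (invBar R x ∘ₗ opL b.val) ((rmul w ∘ₗ barD R x) ∘ₗ sgn R x b.deg)
        + cv (consB R _) (letter R _ ∘ₗ barD R x) (rmul (TensorAlgebra.ι R b.val * w)))
        + (-cv (consB R _) (opL (dCbar R x b.val) ∘ₗ (signBar R x).toLinearMap)
            (rmul w ∘ₗ sgn R x b.deg)
          + cv (consB R _) (invBar R x ∘ₗ opL b.val)
            ((rmul (barD R x w) ∘ₗ (signBar R x).toLinearMap) ∘ₗ sgn R x b.deg) - G))
        + cv (consB R _) (invBar R x ∘ₗ letter R _)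
          (barD R x ∘ₗ rmul (TensorAlgebra.ι R b.val * w)) := by
  have hrec := rmul_letter_rec b.homog w
  have h1 : cv (capB R x) (invBar R x ∘ₗ letter R _) (rmul (TensorAlgebra.ι R b.val * w))
      = cv (consB R _) (cv (cupBar R x) (invBar R x ∘ₗ letter R _) (opL b.val))
          (rmul w ∘ₗ sgn R x b.deg)
        + cv (consB R _) (cv (cupBar R x) (invBar R x ∘ₗ letter R _) (letter R _))
          (rmul (TensorAlgebra.ι R b.val * w)) := by
    conv_lhs => rw [hrec, map_add]
    rw [cv_capB_cv_consB, cv_capB_cv_consB]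
  have h2 : barD R x ∘ₗ (rmul w ∘ₗ sgn R x b.deg) = (rmul w ∘ₗ barD R x) ∘ₗ sgn R x b.deg
      + (rmul (barD R x w) ∘ₗ (signBar R x).toLinearMap) ∘ₗ sgn R x b.deg := by
    rw [← LinearMap.comp_assoc, ih, LinearMap.add_comp]
  conv_lhs => rw [hrec, LinearMap.comp_add, barD_cv_consB, barD_cv_consB, h1, h2, hG,
    dCbar_opL hX b.homog]
  rw [letter_comp_barD]
  simp only [map_sub, map_add, map_neg, LinearMap.sub_apply, LinearMap.neg_apply]
  abel

/-- Differentiating after or before multiplying gives the same recursion; `rmul_barD_cons` matches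
the three parts of the differential of the right factor with those in `barD_rmul_rec`. -/
lemma barD_comp_rmul_hword (L : List (HLetter R x)) : barD R x ∘ₗ rmul (hword L)
    = rmul (hword L) ∘ₗ barD R x
      + rmul (barD R x (hword L)) ∘ₗ (signBar R x).toLinearMap := by
  induction L with
  | nil => rw [hword_nil, barD_one, rmul_zero, rmul_one]; simp
  | cons b L ih =>
    obtain ⟨G, hG1, hG2⟩ := exists_capB_term hX b L
    rw [hword_cons]
    set w := hword L
    set P := rmul (TensorAlgebra.ι R b.val * w) with hP
    set g := rmul w ∘ₗ sgn R x b.deg with hg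
    set E' := invBar R x ∘ₗ opL b.val with hE'
    have hrec : P = cv (consB R _) (opL b.val) g + cv (consB R _) (letter R _) P :=
      rmul_letter_rec b.homog w
    have hA := barD_rmul_rec hX b w G hG2 ih
    have hB := rmul_barD_rec hX b w
    have hC1 : rmul (TensorAlgebra.ι R (dCbar R x b.val) * w) ∘ₗ (signBar R x).toLinearMap
      = cv (consB R _) (opL (dCbar R x b.val) ∘ₗ (signBar R x).toLinearMap) g + cv (consB R _) (invBar R x ∘ₗ letter R _)
        (rmul (TensorAlgebra.ι R (dCbar R x b.val) * w) ∘ₗ (signBar R x).toLinearMap) := by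
      have e : g = (rmul w ∘ₗ (signBar R x).toLinearMap) ∘ₗ sgn R x (b.deg + 1) :=
        LinearMap.ext fun z => by
          rw [hg, LinearMap.comp_apply, LinearMap.comp_apply, LinearMap.comp_apply, sgn_succ,
            AlgHom.toLinearMap_apply, signBar_signBar]
      rw [e]
      exact rmul_letter_signBar (isHomog_coboundary b.homog) w
    have hC2 : rmul (TensorAlgebra.ι R (invBar R x b.val) * barD R x w) ∘ₗ (signBar R x).toLinearMap
      = cv (consB R _) E' ((rmul (barD R x w) ∘ₗ (signBar R x).toLinearMap) ∘ₗ sgn R x b.deg)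
        + cv (consB R _) (invBar R x ∘ₗ letter R _)
        (rmul (TensorAlgebra.ι R (invBar R x b.val) * barD R x w)
          ∘ₗ (signBar R x).toLinearMap) := by
      rw [hE', invBar_comp_opL hX]
      exact rmul_letter_signBar (isHomog_invBar b.homog) _
    have hF := add_rec (cv (consB R _) (invBar R x ∘ₗ letter R _)) hB hC1 hC2 hG1
    have hs : rmul (barD R x (TensorAlgebra.ι R b.val * w)) ∘ₗ (signBar R x).toLinearMap
      = -(rmul (TensorAlgebra.ι R (dCbar R x b.val) * w) ∘ₗ (signBar R x).toLinearMap)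
        + rmul (TensorAlgebra.ι R (invBar R x b.val) * barD R x w) ∘ₗ (signBar R x).toLinearMap
        - rmul (capB R x (invBar R x b.val) w) ∘ₗ (signBar R x).toLinearMap := by
      rw [rmul_barD_cons, LinearMap.sub_comp, LinearMap.add_comp, LinearMap.neg_comp]
    rw [← hs] at hF
    have hβ : ∀ f : Bar R x →ₗ[R] Bar R x, cv (consB R _) (invBar R x ∘ₗ letter R _) f
        = cv (consB R _ ∘ₗ invBar R x) (letter R _) f := fun f => cv_congr_map _ _ fun _ _ => rfl
    rw [hβ] at hA hF
    exact cv_letter_unique hA hF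

end AcyclicBar

end

noncomputable section

namespace AcyclicBar

universe u v

variable {R : Type v} [CommRing R] {X : SSet.{u}} {x : X _⦋0⦌} {N : ℕ}

/-! ### The product on the acyclic bar construction -/

variable (R x) in
/-- The components of even degree if `e = 0`, and of odd degree if `e = 1`. -/
def partC (e : Fin 2) : C R x →ₗ[R] C R x where
  toFun a := ⟨fun n => if n % 2 = e then a.1 n else 0, by
    obtain ⟨a, ⟨N, hN⟩, ha⟩ := a
    refine ⟨⟨N, fun n hn => ?_⟩, fun n hn => ?_⟩
    · simp [hN n hn]
    · by_cases h : n % 2 = e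
      · simp [h, ha n hn]
      · simp [h]⟩
  map_add' a b := by ext n σ; by_cases h : n % 2 = e <;> simp [h]
  map_smul' r a := by ext n σ; by_cases h : n % 2 = e <;> simp [h]

lemma partC_of_homog {q : ℕ} {a : C R x} (ha : IsHomog q a.1) (e : Fin 2) :
    partC R x e a = if q % 2 = e then a else 0 := by
  have ha' : ∀ n, n ≠ q → a.1 n = 0 := ha
  refine Subtype.ext (funext fun n => ?_)
  change (if n % 2 = e then a.1 n else 0) = _
  rcases eq_or_ne n q with rfl | hn
  · split_ifs <;> rfl
  · rw [ha' n hn, ite_self]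
    split_ifs
    · exact (ha' n hn).symm
    · rfl

lemma sgn_of_even {q : ℕ} (h : q % 2 = 0) : sgn R x q = LinearMap.id := by
  obtain ⟨k, rfl⟩ := Nat.dvd_of_mod_eq_zero h
  exact LinearMap.ext fun y => by rw [two_mul, sgn_add, sgn_sgn, LinearMap.id_apply]

lemma sgn_of_odd {q : ℕ} (h : q % 2 = 1) : sgn R x q = (signBar R x).toLinearMap := by
  obtain ⟨k, rfl⟩ : ∃ k, q = 2 * k + 1 := ⟨q / 2, by omega⟩
  exact LinearMap.ext fun y => by
    rw [sgn_succ, sgn_of_even (by omega), LinearMap.id_apply]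
    rfl

variable (R x) in
/-- The action of cochains on the acyclic bar construction from the left. -/
def lact : C R x →ₗ[R] ABar R x →ₗ[R] ABar R x := LinearMap.rTensorHom (Bar R x) ∘ₗ cup R x

lemma lact_tmul (a b : C R x) (t : Bar R x) : lact R x a (b ⊗ₜ t) = cup R x a b ⊗ₜ t := rfl

lemma lact_one (u : ABar R x) : lact R x (one R x) u = u := by
  induction u using TensorProduct.induction_on with
  | zero => exact map_zero _
  | tmul b t => rw [lact_tmul, one_cup]
  | add u w hu hw => rw [map_add, hu, hw]

lemma lact_lact (a b : C R x) (u : ABar R x) :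
    lact R x a (lact R x b u) = lact R x (cup R x a b) u := by
  induction u using TensorProduct.induction_on with
  | zero => simp only [map_zero]
  | tmul c t => rw [lact_tmul, lact_tmul, lact_tmul, cup_assoc]
  | add u w hu hw => simp only [map_add, hu, hw]

variable (R x) in
/-- `cv` with values in the acyclic bar construction. -/
def cvA : (Bar R x →ₗ[R] C R x) →ₗ[R] (Bar R x →ₗ[R] Bar R x) →ₗ[R] (Bar R x →ₗ[R] ABar R x) :=
  cv (TensorProduct.mk R (C R x) (Bar R x))

variable (R x) in
/-- Multiplication of words without coefficient by an element, in terms of tensors. -/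
def wordMul : C R x →ₗ[R] Bar R x →ₗ[R] (Bar R x →ₗ[R] ABar R x) :=
  LinearMap.mk₂ R (fun b y => cvA R x (opF (partC R x 0 b)) (rmul y)
      + cvA R x (opF (partC R x 1 b)) (rmul y ∘ₗ (signBar R x).toLinearMap))
    (fun b b' y => by
      simp only [opF, map_add, LinearMap.add_apply]
      abel)
    (fun r b y => by simp only [opF, map_smul, LinearMap.smul_apply, smul_add])
    (fun b y y' => by
      simp only [rmul_add, LinearMap.add_comp, map_add]
      abel)
    (fun r b y => by simp only [rmul_smul, LinearMap.smul_comp, map_smul, smul_add])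

lemma opF_zero : opF (0 : C R x) = 0 := map_zero _

/-- The sign depends on the parity of b only, which is why a definition by parity parts is linear in
b and has the expected values. -/
lemma wordMul_of_homog {q : ℕ} {b : C R x} (hb : IsHomog q b.1) (y : Bar R x) :
    wordMul R x b y = cvA R x (opF b) (rmul y ∘ₗ sgn R x q) := by
  change cvA R x (opF (partC R x 0 b)) (rmul y)
      + cvA R x (opF (partC R x 1 b)) (rmul y ∘ₗ (signBar R x).toLinearMap) = _
  rw [partC_of_homog hb, partC_of_homog hb]
  rcases Nat.mod_two_eq_zero_or_one q with h | h
  · rw [sgn_of_even h, if_pos (show q % 2 = (0 : Fin 2) from h),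
      if_neg (show ¬q % 2 = (1 : Fin 2) by rw [h]; simp), opF_zero, map_zero,
      LinearMap.zero_apply, add_zero, LinearMap.comp_id]
  · rw [sgn_of_odd h, if_neg (show ¬q % 2 = (0 : Fin 2) by rw [h]; simp),
      if_pos (show q % 2 = (1 : Fin 2) from h), opF_zero, map_zero,
      LinearMap.zero_apply, zero_add]

variable (R x) in
/-- The multiplication of words without coefficient by an element. -/
def wordMulA : ABar R x →ₗ[R] (Bar R x →ₗ[R] ABar R x) := TensorProduct.lift (wordMul R x)

variable (R x) in
/-- The product of the acyclic bar construction. -/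
def mulA : ABar R x →ₗ[R] ABar R x →ₗ[R] ABar R x :=
  TensorProduct.lift (LinearMap.mk₂ R
    (fun a t => lact R x a ∘ₗ (wordMulA R x).flip t)
    (fun a a' t => by rw [map_add, LinearMap.add_comp])
    (fun r a t => by rw [map_smul, LinearMap.smul_comp])
    (fun a t t' => by rw [map_add, LinearMap.comp_add])
    (fun r a t => by rw [map_smul, LinearMap.comp_smul]))

lemma mulA_tmul (a : C R x) (t : Bar R x) (u : ABar R x) :
    mulA R x (a ⊗ₜ t) u = lact R x a (wordMulA R x u t) := rfl

lemma wordMulA_tmul (b : C R x) (y : Bar R x) : wordMulA R x (b ⊗ₜ y) = wordMul R x b y := rfl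

lemma mulA_lact (a : C R x) (u w : ABar R x) :
    mulA R x (lact R x a u) w = lact R x a (mulA R x u w) := by
  induction u using TensorProduct.induction_on with
  | zero => simp only [map_zero, LinearMap.zero_apply]
  | tmul c t => rw [lact_tmul, mulA_tmul, mulA_tmul, lact_lact]
  | add u w hu hw => simp only [map_add, LinearMap.add_apply, hu, hw]

lemma mulA_one_tmul (t : Bar R x) (u : ABar R x) :
    mulA R x (one R x ⊗ₜ t) u = wordMulA R x u t := by
  rw [mulA_tmul, lact_one]

/-- Induction over tensors of a homogeneous cochain and a homogeneous word. -/
lemma ABar_induction {P : ABar R x → Prop} (zero : P 0) (add : ∀ u w, P u → P w → P (u + w))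
    (smul : ∀ (r : R) u, P u → P (r • u))
    (homog : ∀ q (a : C R x) (L : List (HLetter R x)), IsHomog q a.1 → P (a ⊗ₜ hword L))
    (u : ABar R x) : P u := by
  induction u using TensorProduct.induction_on with
  | zero => exact zero
  | add u w hu hw => exact add _ _ hu hw
  | tmul a t =>
    induction a using C_induction with
    | zero => rw [TensorProduct.zero_tmul]; exact zero
    | add a b ha hb => rw [TensorProduct.add_tmul]; exact add _ _ ha hb
    | homog q a ha =>
      induction mem_span_hword t using Submodule.span_induction with
      | mem z hz => obtain ⟨L, rfl⟩ := hz; exact homog q a L ha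
      | zero => rw [TensorProduct.tmul_zero]; exact zero
      | add y z _ _ hy hz => rw [TensorProduct.tmul_add]; exact add _ _ hy hz
      | smul r y _ hy => rw [TensorProduct.tmul_smul]; exact smul _ _ hy

lemma wordMul_hword {q : ℕ} {b : C R x} (hb : IsHomog q b.1) (y : Bar R x)
    (L : List (HLetter R x)) : wordMul R x b y (hword L)
      = ∑ i ∈ Finset.range (L.length + 1),
        opF b (hword (L.take i)) ⊗ₜ rmul y (sgn R x q (hword (L.drop i))) := by
  rw [wordMul_of_homog hb]
  exact cv_hword _ _ _ L

variable (hX : ∀ e : X _⦋1⦌, e = constSimplex X x 1)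

include hX

lemma one_mulA (u : ABar R x) : mulA R x (one R x ⊗ₜ 1) u = u := by
  rw [mulA_one_tmul]
  induction u using ABar_induction with
  | zero => simp only [map_zero, LinearMap.zero_apply]
  | add u w hu hw => rw [map_add, LinearMap.add_apply, hu, hw]
  | smul r u hu => rw [map_smul, LinearMap.smul_apply, hu]
  | homog q b L hb =>
    have h := wordMul_hword hb (hword L) []
    rw [wordMulA_tmul]
    simp only [hword_nil, List.length_nil, zero_add, Finset.sum_range_one, List.take_nil,
      List.drop_nil, sgn_one, rmul_apply_one hX, opF_apply, opC_one_left hX] at h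
    exact h

lemma mulA_one (u : ABar R x) : mulA R x u (one R x ⊗ₜ 1) = u := by
  have h1 : IsHomog 0 (one R x).1 := fun n hn => funext fun σ => if_neg hn
  induction u using ABar_induction with
  | zero => simp only [map_zero, LinearMap.zero_apply]
  | add u w hu hw => rw [map_add, LinearMap.add_apply, hu, hw]
  | smul r u hu => rw [map_smul, LinearMap.smul_apply, hu]
  | homog q a L ha =>
    rw [mulA_tmul, wordMulA_tmul, wordMul_of_homog h1, cvA, cv_unit_left]
    · rw [rmul_one, LinearMap.id_comp, opF_apply, opC_one_right hX, map_one, one_smul,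
        LinearMap.comp_apply, TensorProduct.mk_apply, lact_tmul, cup_one, sgn_zero]
    · intro m y
      rw [opF_apply, opC_one_right hX, counit_cons, zero_smul]

end AcyclicBar

end

/-! ### Associativity on the acyclic bar construction -/

noncomputable section

namespace AcyclicBar

universe u v

variable {R : Type v} [CommRing R] {X : SSet.{u}} {x : X _⦋0⦌} {N : ℕ}

lemma mulA_comp_cvA (u : ABar R x) (f : Bar R x →ₗ[R] C R x) (g : Bar R x →ₗ[R] Bar R x) :
    (mulA R x).flip u ∘ₗ cvA R x f g = cv (lact R x) f (wordMulA R x u ∘ₗ g) := by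
  rw [cvA, comp_cv]
  exact cv_congr_map _ _ fun _ _ => rfl

lemma cv_lact_cvA (f h : Bar R x →ₗ[R] C R x) (g : Bar R x →ₗ[R] Bar R x) :
    cv (lact R x) f (cvA R x h g) = cvA R x (cv (cup R x) f h) g :=
  (cv_assoc (fun _ _ _ => rfl) f h g).symm

variable (hX : ∀ e : X _⦋1⦌, e = constSimplex X x 1)

include hX

lemma opF_comp_rmul (c : C R x) (y : Bar R x) : opF c ∘ₗ rmul y = opF (opF c y) :=
  LinearMap.ext fun z => opC_barMul hX y z c

lemma wordMul_comp_rmul {q : ℕ} {c : C R x} (hc : IsHomog q c.1) (z : Bar R x)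
    (l : List (HLetter R x)) : wordMul R x c z ∘ₗ rmul (hword l)
      = ∑ i ∈ Finset.range (l.length + 1), cvA R x (opF (opF c (hword (l.take i))))
        (rmul (rmul z (sgn R x q (hword (l.drop i)))) ∘ₗ sgn R x (q + hdeg (l.take i))) := by
  rw [wordMul_of_homog hc, cvA, cv_rmul]
  refine Finset.sum_congr rfl fun i _ => ?_
  rw [opF_comp_rmul hX, splitR, LinearMap.comp_assoc, ← LinearMap.comp_assoc _ _ (sgn R x q),
    sgn_comp_rmul hX, LinearMap.comp_assoc, sgn_comp, ← LinearMap.comp_assoc, rmul_comp_rmul hX]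

/-- Expanding both sides over the cuts of the word l matches them term by term: `opF_cup` treats the
coefficient, `opC_barMul` and associativity of the bar product treat the words. -/
lemma mulA_comp_wordMul {p q : ℕ} {b c : C R x} (hb : IsHomog p b.1) (hc : IsHomog q c.1)
    (l : List (HLetter R x)) (z : Bar R x) : (mulA R x).flip (c ⊗ₜ z) ∘ₗ wordMul R x b (hword l)
      = wordMulA R x (mulA R x (b ⊗ₜ hword l) (c ⊗ₜ z)) := by
  rw [mulA_tmul, wordMulA_tmul, wordMul_hword hc, map_sum, map_sum, wordMul_of_homog hb,
    mulA_comp_cvA, wordMulA_tmul, ← LinearMap.comp_assoc, wordMul_comp_rmul hX hc,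
    sum_comp_linear, map_sum]
  refine Finset.sum_congr rfl fun i _ => ?_
  have hh : IsHomog (p + (q + hdeg (l.take i))) (cup R x b (opF c (hword (l.take i)))).1 :=
    isHomog_cup hb (isHomog_opF hX hc _)
  rw [lact_tmul, wordMulA_tmul, wordMul_of_homog hh, opF_cup hX hb, cvA, cv_sgn, ← cvA,
    cv_lact_cvA, LinearMap.comp_assoc, sgn_comp, add_comm p]

lemma mulA_assoc (u v w : ABar R x) :
    mulA R x (mulA R x u v) w = mulA R x u (mulA R x v w) := by
  induction w using ABar_induction with
  | zero => simp only [map_zero]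
  | add w w' hw hw' => simp only [map_add, hw, hw']
  | smul r w hw => simp only [map_smul, hw]
  | homog q c L hc =>
    induction v using ABar_induction with
    | zero => simp only [map_zero, LinearMap.zero_apply]
    | add w w' hw hw' => simp only [map_add, LinearMap.add_apply, hw, hw']
    | smul r w hw => simp only [map_smul, LinearMap.smul_apply, hw]
    | homog p b l hb =>
      induction u using TensorProduct.induction_on with
      | zero => simp only [map_zero, LinearMap.zero_apply]
      | add w w' hw hw' => simp only [map_add, LinearMap.add_apply, hw, hw']
      | tmul a t =>
        rw [mulA_tmul, mulA_lact, mulA_tmul a t, wordMulA_tmul]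
        exact congrArg _ (LinearMap.congr_fun (mulA_comp_wordMul hX hb hc l (hword L)) t)

end AcyclicBar

end

noncomputable section

namespace AcyclicBar

universe u v

section

variable {R M : Type*} [CommRing R] [AddCommGroup M] [Module R M]
  {A B D D' : Type*} [AddCommGroup A] [Module R A] [AddCommGroup B] [Module R B]
  [AddCommGroup D] [Module R D] [AddCommGroup D'] [Module R D']

lemma comp_cv_add_add (β : A →ₗ[R] B →ₗ[R] D) (φ : D →ₗ[R] D') (β₁ β₂ β₃ : A →ₗ[R] B →ₗ[R] D')
    (h : ∀ a b, φ (β a b) = β₁ a b + (β₂ a b + β₃ a b)) (f : TensorAlgebra R M →ₗ[R] A)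
    (g : TensorAlgebra R M →ₗ[R] B) (t : TensorAlgebra R M) :
    φ (cv β f g t) = cv β₁ f g t + (cv β₂ f g t + cv β₃ f g t) := by
  have e : β.compr₂ φ = β₁ + (β₂ + β₃) := LinearMap.ext₂ h
  rw [← LinearMap.comp_apply, comp_cv, e, cv_add_bil, cv_add_bil]
  rfl

end

variable {R : Type v} [CommRing R] {X : SSet.{u}} {x : X _⦋0⦌} {N : ℕ}

/-! ### The differential of the acyclic bar construction -/

variable (R x) in
/-- The twisting term of the differential. -/
def twist : Bar R x →ₗ[R] ABar R x := cvA R x (inv R x ∘ₗ letterC) LinearMap.id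

lemma twist_one : twist R x 1 = 0 := by
  rw [twist, cvA, cv_one]
  have : letterC (1 : Bar R x) = 0 := by rw [letterC, LinearMap.comp_apply, letter_one, map_zero]
  rw [LinearMap.comp_apply, this, map_zero, map_zero, LinearMap.zero_apply]

lemma twist_eq : twist R x
    = cv (TensorProduct.mk R _ _ ∘ₗ inv R x ∘ₗ incl R x) (letter R _) LinearMap.id :=
  cv_congr_map _ _ fun _ _ => rfl

lemma twist_cons (m : Cbar R x) (y : Bar R x) :
    twist R x (TensorAlgebra.ι R m * y) = inv R x (incl R x m) ⊗ₜ y := by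
  rw [twist_eq, cv_letter_cons]
  rfl

lemma twist_capB (m : Cbar R x) (y : Bar R x) :
    twist R x (capB R x m y) = -lact R x (incl R x (invBar R x m)) (twist R x y) := by
  induction y using word_induction with
  | one => rw [capB_one, twist_one, map_zero, map_zero, neg_zero]
  | cons b y _ =>
    have : incl R x (cupBar R x m b) = cup R x (incl R x m) (incl R x b) := rfl
    rw [capB_cons, twist_cons, twist_cons, lact_tmul, this, inv_cup, incl_invBar, map_neg,
      LinearMap.neg_apply, TensorProduct.neg_tmul, neg_neg]
  | add y z hy hz => simp only [map_add, hy, hz, neg_add]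
  | smul r y hy => simp only [map_smul, hy, smul_neg]

lemma dABar_tmul (a : C R x) (y : Bar R x) : dABar R x (a ⊗ₜ y)
    = dC R x a ⊗ₜ y - inv R x a ⊗ₜ barD R x y + lact R x (inv R x a) (twist R x y) := by
  induction y using word_induction with
  | one =>
    rw [twist_one, map_zero]
    simp [dABar, uncons_one]
  | cons m y _ => rw [dABar_cons, twist_cons, lact_tmul]
  | add y z hy hz =>
    simp only [TensorProduct.tmul_add, map_add, hy, hz]
    abel
  | smul r y hy => simp only [TensorProduct.tmul_smul, map_smul, hy, smul_sub, smul_add]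

lemma dABar_one_tmul (y : Bar R x) :
    dABar R x (one R x ⊗ₜ y) = twist R x y - one R x ⊗ₜ barD R x y := by
  rw [dABar_tmul, dC_one, inv_one, lact_one, TensorProduct.zero_tmul]
  abel

/-- The twist multiplies the coefficient from the right, so it commutes with the left action; this
leaves the Leibniz rule for cochains. -/
lemma dABar_lact (a : C R x) (u : ABar R x) : dABar R x (lact R x a u)
    = lact R x (dC R x a) u + lact R x (inv R x a) (dABar R x u) := by
  induction u using TensorProduct.induction_on with
  | zero => simp only [map_zero, add_zero]
  | tmul b y =>
    rw [lact_tmul, dABar_tmul, dABar_tmul, map_add, map_sub, lact_tmul, lact_tmul, lact_tmul,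
      lact_lact, dC_cup, inv_cup, TensorProduct.add_tmul]
    abel
  | add u w hu hw =>
    simp only [map_add, hu, hw]
    abel

lemma tmul_eq_lact (a : C R x) (t : Bar R x) :
    a ⊗ₜ[R] t = lact R x a (one R x ⊗ₜ t) := by rw [lact_tmul, cup_one]

/-- The twisting equation: the first two letters are multiplied by d on the one side and by the bar
differential on the other. -/
lemma dABar_twist (y : Bar R x) :
    dABar R x (twist R x y) = twist R x (barD R x y) := by
  induction y using word_induction with
  | one => rw [twist_one, barD_one, map_zero, map_zero]
  | cons m y _ =>
    have : incl R x (dCbar R x m) = dC R x (incl R x m) := rfl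
    rw [twist_cons, dABar_tmul, barD_cons_cap, map_sub, map_add, map_neg, twist_cons, twist_cons,
      twist_capB, invBar_invBar, incl_invBar, this, inv_inv, inv_dC, map_neg, inv_inv,
      TensorProduct.neg_tmul, TensorProduct.neg_tmul]
    abel
  | add y z hy hz => simp only [map_add, hy, hz]
  | smul r y hy => simp only [map_smul, hy]

/-- By `dABar_lact` only 1 ⊗ t has to be considered, where `dABar_twist` and the square of the bar
differential suffice. -/
lemma dABar_dABar (u : ABar R x) : dABar R x (dABar R x u) = 0 := by
  induction u using TensorProduct.induction_on with
  | zero => simp only [map_zero]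
  | tmul a t =>
    rw [tmul_eq_lact, dABar_lact, map_add, dABar_lact, dABar_lact, dABar_one_tmul, map_sub,
      map_sub (dABar R x), dABar_twist, dABar_one_tmul, barD_barD, dC_dC, inv_dC, TensorProduct.tmul_zero]
    simp only [map_zero, LinearMap.zero_apply, map_neg, LinearMap.neg_apply, map_sub, sub_zero,
      sub_self]
    abel
  | add u w hu hw => simp only [map_add, hu, hw, add_zero]

variable (R x) in
/-- Multiplication by `(-1)^i` on elements of degree `i`. -/
def signA : ABar R x →ₗ[R] ABar R x :=
  TensorProduct.map (inv R x) (signBar R x).toLinearMap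

lemma cvA_neg (f : Bar R x →ₗ[R] C R x) (g : Bar R x →ₗ[R] Bar R x) (t : Bar R x) :
    cvA R x (-f) g t = -cvA R x f g t := by
  refine eq_neg_of_add_eq_zero_left ?_
  rw [← LinearMap.add_apply, ← LinearMap.add_apply, ← map_add, neg_add_cancel, map_zero,
    LinearMap.zero_apply, LinearMap.zero_apply]

lemma cvA_sub (f f' : Bar R x →ₗ[R] C R x) (g : Bar R x →ₗ[R] Bar R x) (t : Bar R x) :
    cvA R x (f - f') g t = cvA R x f g t - cvA R x f' g t := by
  rw [sub_eq_add_neg, map_add, LinearMap.add_apply, LinearMap.add_apply, cvA_neg, sub_eq_add_neg]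

lemma dABar_cvA (f : Bar R x →ₗ[R] C R x) (g : Bar R x →ₗ[R] Bar R x) (t : Bar R x) :
    dABar R x (cvA R x f g t) = cvA R x (dC R x ∘ₗ f) g t
      - cvA R x (inv R x ∘ₗ f) (barD R x ∘ₗ g) t
      + cv (lact R x) (inv R x ∘ₗ f) (twist R x ∘ₗ g) t := by
  have h1 : cv (TensorProduct.mk R _ _ ∘ₗ dC R x) f g = cvA R x (dC R x ∘ₗ f) g :=
    cv_congr_map _ _ fun _ _ => rfl
  have h2 : cv ((TensorProduct.mk R _ _).compl₁₂ (-inv R x) (barD R x)) f g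
      = cvA R x (-(inv R x ∘ₗ f)) (barD R x ∘ₗ g) := cv_congr_map _ _ fun _ _ => rfl
  have h3 : cv ((lact R x).compl₁₂ (inv R x) (twist R x)) f g
      = cv (lact R x) (inv R x ∘ₗ f) (twist R x ∘ₗ g) := cv_congr_map _ _ fun _ _ => rfl
  have h := comp_cv_add_add (TensorProduct.mk R _ _) (dABar R x) (TensorProduct.mk R _ _ ∘ₗ dC R x)
    ((TensorProduct.mk R _ _).compl₁₂ (-inv R x) (barD R x))
    ((lact R x).compl₁₂ (inv R x) (twist R x)) (fun a y => by
      refine (dABar_tmul a y).trans ?_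
      rw [sub_eq_add_neg, add_assoc, ← TensorProduct.neg_tmul]
      rfl) f g t
  rw [h1, h2, h3, cvA_neg] at h
  rw [sub_eq_add_neg, add_assoc]
  exact h

lemma mulA_comp_twist (w : ABar R x) : (mulA R x).flip w ∘ₗ twist R x
    = cv (lact R x) (inv R x ∘ₗ letterC) (wordMulA R x w) := by
  rw [twist, mulA_comp_cvA, LinearMap.comp_id]

variable (hX : ∀ e : X _⦋1⦌, e = constSimplex X x 1)

include hX

lemma inv_comp_opF (b : C R x) :
    inv R x ∘ₗ opF b = opF (inv R x b) ∘ₗ (signBar R x).toLinearMap :=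
  LinearMap.ext fun z => inv_opC hX z b

end AcyclicBar

end

/-! ### The Leibniz rule on the acyclic bar construction -/

noncomputable section

namespace AcyclicBar

universe u v

variable {R : Type v} [CommRing R] {X : SSet.{u}} {x : X _⦋0⦌} {N : ℕ}

lemma cvA_add (f f' : Bar R x →ₗ[R] C R x) (g : Bar R x →ₗ[R] Bar R x) (t : Bar R x) :
    cvA R x (f + f') g t = cvA R x f g t + cvA R x f' g t := by
  rw [map_add]
  rfl

lemma cvA_add_right (f : Bar R x →ₗ[R] C R x) (g g' : Bar R x →ₗ[R] Bar R x) (t : Bar R x) :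
    cvA R x f (g + g') t = cvA R x f g t + cvA R x f g' t := by
  rw [map_add]
  rfl

lemma cv_lact_add (f : Bar R x →ₗ[R] C R x) (g g' : Bar R x →ₗ[R] ABar R x) (t : Bar R x) :
    cv (lact R x) f (g + g') t = cv (lact R x) f g t + cv (lact R x) f g' t :=
  LinearMap.congr_fun (map_add (cv (lact R x) f) g g') t

lemma mulA_add_left (u u' w : ABar R x) : mulA R x (u + u') w = mulA R x u w + mulA R x u' w := by
  rw [map_add, LinearMap.add_apply]
lemma mulA_sub_left (u u' w : ABar R x) : mulA R x (u - u') w = mulA R x u w - mulA R x u' w := by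
  rw [map_sub, LinearMap.sub_apply]
lemma wordMulA_sub (u u' : ABar R x) (t : Bar R x) :
    wordMulA R x (u - u') t = wordMulA R x u t - wordMulA R x u' t := by
  rw [map_sub]; rfl
lemma wordMulA_add (u u' : ABar R x) (t : Bar R x) :
    wordMulA R x (u + u') t = wordMulA R x u t + wordMulA R x u' t := by
  rw [map_add]; rfl

lemma inv_comp_cv (f g : Bar R x →ₗ[R] C R x) : inv R x ∘ₗ cv (cup R x) f g
    = cv (cup R x) (inv R x ∘ₗ f) (inv R x ∘ₗ g) := by
  rw [comp_cv]
  exact cv_congr_map _ _ fun _ _ => inv_cup _ _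

lemma cvA_comp_sgn (q : ℕ) (f : Bar R x →ₗ[R] C R x) (g : Bar R x →ₗ[R] Bar R x) :
    cvA R x f g ∘ₗ sgn R x q = cvA R x (f ∘ₗ sgn R x q) (g ∘ₗ sgn R x q) := cv_sgn _ _ _ _

lemma cvA_signBar (f : Bar R x →ₗ[R] C R x) (g : Bar R x →ₗ[R] Bar R x) (t : Bar R x) :
    cvA R x f g (signBar R x t)
      = cvA R x (f ∘ₗ (signBar R x).toLinearMap) (g ∘ₗ (signBar R x).toLinearMap) t :=
  LinearMap.congr_fun (cv_signBar (TensorProduct.mk R (C R x) (Bar R x)) f g) t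

lemma twist_comp_rmul_cons (c : HLetter R x) (l : List (HLetter R x)) :
    twist R x ∘ₗ rmul (hword (c :: l))
      = cvA R x (inv R x ∘ₗ opF (incl R x c.val)) (rmul (hword l) ∘ₗ sgn R x c.deg)
        + cvA R x (inv R x ∘ₗ letterC) (rmul (hword (c :: l))) := by
  rw [twist_eq, cv_letter_rmul, opF_incl]
  exact congrArg₂ _ (cv_congr_map _ _ fun _ _ => rfl) (cv_congr_map _ _ fun _ _ => rfl)

variable (hX : ∀ e : X _⦋1⦌, e = constSimplex X x 1)

include hX

lemma wordMul_signBar {q : ℕ} {b : C R x} (hb : IsHomog q b.1) (y t : Bar R x) :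
    wordMul R x b y (signBar R x t) = cvA R x (inv R x ∘ₗ opF (inv R x b))
      ((rmul y ∘ₗ (signBar R x).toLinearMap) ∘ₗ sgn R x q) t := by
  have e : (rmul y ∘ₗ sgn R x q) ∘ₗ (signBar R x).toLinearMap
      = (rmul y ∘ₗ (signBar R x).toLinearMap) ∘ₗ sgn R x q :=
    LinearMap.ext fun z => congrArg (rmul y) (sgn_signBar q z)
  rw [wordMul_of_homog hb, cvA_signBar, inv_comp_opF hX, inv_inv, e]

/-- The twist of the product moves out its first letter. If that letter is an operation on the first
letter c of l, `opF_cup` combines it with the operation on b into one on bc, the twist of the right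
factor. If it is a letter of t, the remaining term arises. -/
lemma cv_lact_twist {q : ℕ} {b : C R x} (hb : IsHomog q b.1) (l : List (HLetter R x))
    (t : Bar R x) : cv (lact R x) (inv R x ∘ₗ opF b)
        (twist R x ∘ₗ (rmul (hword l) ∘ₗ sgn R x q)) t
      = wordMulA R x (lact R x (inv R x b) (twist R x (hword l))) (signBar R x t)
        + cvA R x (cv (cup R x) (inv R x ∘ₗ opF b) (inv R x ∘ₗ letterC ∘ₗ sgn R x q))
          (rmul (hword l) ∘ₗ sgn R x q) t := by
  cases l with
  | nil =>
    rw [hword_nil, twist_one, map_zero, map_zero, LinearMap.zero_apply, zero_add, rmul_one,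
      LinearMap.id_comp, twist, cvA_comp_sgn, cv_lact_cvA]
    rfl
  | cons c l =>
    have hc : IsHomog (q + (c.deg + 1)) (cup R x b (incl R x c.val)).1 :=
      isHomog_cup hb c.homog
    have h1 : wordMulA R x (lact R x (inv R x b) (twist R x (hword (c :: l)))) (signBar R x t)
        = cvA R x (cv (cup R x) (inv R x ∘ₗ opF b)
          ((inv R x ∘ₗ opF (incl R x c.val)) ∘ₗ sgn R x q))
          ((rmul (hword l) ∘ₗ sgn R x c.deg) ∘ₗ sgn R x q) t := by
      have e : (rmul (hword l) ∘ₗ (signBar R x).toLinearMap) ∘ₗ sgn R x (q + (c.deg + 1))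
          = (rmul (hword l) ∘ₗ sgn R x c.deg) ∘ₗ sgn R x q := by
        rw [LinearMap.comp_assoc, LinearMap.comp_assoc, sgn_comp]
        refine congrArg _ (LinearMap.ext fun z => ?_)
        rw [LinearMap.comp_apply, ← add_assoc, sgn_succ, AlgHom.toLinearMap_apply,
          signBar_signBar, add_comm]
      rw [hword_cons, twist_cons, lact_tmul, wordMulA_tmul, ← inv_cup,
        wordMul_signBar hX (isHomog_inv hc), inv_inv, opF_cup hX hb, inv_comp_cv, e]
      rfl
    have h2 : twist R x ∘ₗ (rmul (hword (c :: l)) ∘ₗ sgn R x q)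
        = cvA R x ((inv R x ∘ₗ opF (incl R x c.val)) ∘ₗ sgn R x q)
            ((rmul (hword l) ∘ₗ sgn R x c.deg) ∘ₗ sgn R x q)
          + cvA R x (inv R x ∘ₗ letterC ∘ₗ sgn R x q) (rmul (hword (c :: l)) ∘ₗ sgn R x q) :=
      LinearMap.ext fun z => (LinearMap.congr_fun (twist_comp_rmul_cons c l) (sgn R x q z)).trans
        (congrArg₂ HAdd.hAdd (LinearMap.congr_fun (cvA_comp_sgn q _ _) z)
          (LinearMap.congr_fun (cvA_comp_sgn q _ _) z))
    refine (congrArg (fun P => cv (lact R x) (inv R x ∘ₗ opF b) P t) h2).trans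
      ((cv_lact_add _ _ _ t).trans (congrArg₂ HAdd.hAdd ?_ ?_))
    · rw [h1, cv_lact_cvA]
    · rw [cv_lact_cvA]

/-- The coefficient is differentiated by `dC_opF`, the word by `barD_comp_rmul_hword`, and the twist
is `cv_lact_twist`. The first-letter term of `dC_opF` is the twist of the left factor (`h1`); its
last-letter term cancels the remaining term of `cv_lact_twist`. -/
lemma dABar_wordMul {q : ℕ} {b : C R x} (hb : IsHomog q b.1) (l : List (HLetter R x))
    (t : Bar R x) : dABar R x (wordMul R x b (hword l) t)
      = mulA R x (dABar R x (one R x ⊗ₜ t)) (b ⊗ₜ hword l)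
        + wordMulA R x (dABar R x (b ⊗ₜ hword l)) (signBar R x t) := by
  have h1 : mulA R x (twist R x t) (b ⊗ₜ hword l)
      = cvA R x (cv (cup R x) (inv R x ∘ₗ letterC) (opF b)) (rmul (hword l) ∘ₗ sgn R x q) t := by
    have := LinearMap.congr_fun (mulA_comp_twist (R := R) (b ⊗ₜ hword l)) t
    rw [wordMulA_tmul, wordMul_of_homog hb, cv_lact_cvA] at this
    exact this
  have h2 : wordMul R x b (hword l) (barD R x t)
      = cvA R x (opF b ∘ₗ barD R x) (rmul (hword l) ∘ₗ sgn R x q) t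
        + cvA R x (inv R x ∘ₗ opF b) ((rmul (hword l) ∘ₗ barD R x) ∘ₗ sgn R x q) t := by
    have e1 : (rmul (hword l) ∘ₗ sgn R x q) ∘ₗ barD R x
        = (-1 : R) ^ q • (rmul (hword l) ∘ₗ barD R x) ∘ₗ sgn R x q := LinearMap.ext fun z => by
      simp only [LinearMap.comp_apply, LinearMap.smul_apply, sgn_barD, map_smul]
    have e2 : inv R x ∘ₗ opF b = (-1 : R) ^ q • opF b ∘ₗ (signBar R x).toLinearMap := by
      rw [inv_comp_opF hX, inv_of_homog hb]
      unfold opF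
      rw [map_smul]
      rfl
    have h := LinearMap.congr_fun (cv_barD (TensorProduct.mk R (C R x) (Bar R x)) (opF b)
      (rmul (hword l) ∘ₗ sgn R x q)) t
    have e3 : cvA R x (inv R x ∘ₗ opF b) ((rmul (hword l) ∘ₗ barD R x) ∘ₗ sgn R x q)
        = cvA R x (opF b ∘ₗ (signBar R x).toLinearMap)
          ((rmul (hword l) ∘ₗ sgn R x q) ∘ₗ barD R x) := by
      rw [e1, e2, map_smul, map_smul, LinearMap.smul_apply]
    rw [e3, wordMul_of_homog hb]
    exact h
  have h3 : wordMul R x (dC R x b) (hword l) (signBar R x t)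
      = cvA R x (opF (dC R x b) ∘ₗ (signBar R x).toLinearMap) (rmul (hword l) ∘ₗ sgn R x q) t := by
    have hd : IsHomog (q + 1) (dC R x b).1 := isHomog_coboundary hb
    rw [wordMul_of_homog hd, cvA_signBar, LinearMap.comp_assoc, sgn_succ_comp_signBar]
  have h4 : wordMul R x (inv R x b) (barD R x (hword l)) (signBar R x t)
      = cvA R x (inv R x ∘ₗ opF b)
        ((rmul (barD R x (hword l)) ∘ₗ (signBar R x).toLinearMap) ∘ₗ sgn R x q) t := by
    rw [wordMul_signBar hX (isHomog_inv hb), inv_inv]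
  have h5 : barD R x ∘ₗ (rmul (hword l) ∘ₗ sgn R x q) = (rmul (hword l) ∘ₗ barD R x) ∘ₗ sgn R x q
      + (rmul (barD R x (hword l)) ∘ₗ (signBar R x).toLinearMap) ∘ₗ sgn R x q := by
    rw [← LinearMap.comp_assoc, barD_comp_rmul_hword hX, LinearMap.add_comp]
  have h6 := cv_lact_twist hX hb l t
  have h7 : mulA R x (dABar R x (one R x ⊗ₜ t)) (b ⊗ₜ hword l)
      = mulA R x (twist R x t) (b ⊗ₜ hword l) - wordMul R x b (hword l) (barD R x t) := by
    rw [dABar_one_tmul, mulA_sub_left, mulA_one_tmul, wordMulA_tmul]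
  have h8 : wordMulA R x (dABar R x (b ⊗ₜ hword l)) (signBar R x t)
      = wordMul R x (dC R x b) (hword l) (signBar R x t)
        - wordMul R x (inv R x b) (barD R x (hword l)) (signBar R x t)
        + wordMulA R x (lact R x (inv R x b) (twist R x (hword l))) (signBar R x t) := by
    rw [dABar_tmul, wordMulA_add, wordMulA_sub, wordMulA_tmul, wordMulA_tmul]
  have h9 : dABar R x (wordMul R x b (hword l) t)
      = dABar R x (cvA R x (opF b) (rmul (hword l) ∘ₗ sgn R x q) t) := by rw [wordMul_of_homog hb]
  have h10 := h7.trans (congrArg₂ HSub.hSub h1 h2)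
  have h11 := h8.trans (congrArg₂ HAdd.hAdd (congrArg₂ HSub.hSub h3 h4) rfl)
  refine Eq.trans ?_ (congrArg₂ HAdd.hAdd h10 h11).symm
  refine (h9.trans ((dABar_cvA _ _ t).trans (congrArg₂ HAdd.hAdd rfl h6))).trans ?_
  have h12 := (congrArg (fun f => cvA R x f (rmul (hword l) ∘ₗ sgn R x q) t) (dC_opF hX hb)).trans
    ((cvA_sub _ _ _ t).trans (congrArg₂ HSub.hSub ((cvA_add _ _ _ t).trans
      (congrArg₂ HAdd.hAdd (cvA_sub _ _ _ t) rfl)) rfl))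
  have h13 := (congrArg (fun g => cvA R x (inv R x ∘ₗ opF b) g t) h5).trans
    (cvA_add_right _ _ _ t)
  refine (congrArg₂ HAdd.hAdd (congrArg₂ HSub.hSub h12 h13) rfl).trans ?_
  abel

lemma dABar_mulA (u w : ABar R x) : dABar R x (mulA R x u w)
    = mulA R x (dABar R x u) w + mulA R x (signA R x u) (dABar R x w) := by
  induction w using ABar_induction with
  | zero => simp only [map_zero, add_zero]
  | add w w' hw hw' =>
    simp only [map_add, hw, hw']
    abel
  | smul r w hw => simp only [map_smul, hw, smul_add]
  | homog q b l hb =>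
    induction u using TensorProduct.induction_on with
    | zero => simp only [map_zero, LinearMap.zero_apply, add_zero]
    | add w w' hw hw' =>
      simp only [map_add, LinearMap.add_apply, hw, hw']
      abel
    | tmul a t =>
      have h1 : mulA R x (a ⊗ₜ t) (b ⊗ₜ hword l)
          = lact R x a (wordMul R x b (hword l) t) := rfl
      have h2 : signA R x (a ⊗ₜ t) = inv R x a ⊗ₜ signBar R x t := rfl
      rw [h2, h1, mulA_tmul (inv R x a), dABar_lact, dABar_wordMul hX hb, tmul_eq_lact a t, dABar_lact, map_add,
        mulA_add_left, mulA_lact, mulA_lact, mulA_one_tmul, wordMulA_tmul, add_assoc]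

end AcyclicBar

end

noncomputable section

namespace AcyclicBar

universe u v

variable {R : Type v} [CommRing R] {X : SSet.{u}} {x : X _⦋0⦌} {N : ℕ}

/-! ### Degrees -/

lemma hdeg_append (l l' : List (HLetter R x)) : hdeg (l ++ l') = hdeg l + hdeg l' := by
  simp [hdeg]

lemma hdeg_take_add_drop (l : List (HLetter R x)) (i : ℕ) :
    hdeg (l.take i) + hdeg (l.drop i) = hdeg l := by
  rw [← hdeg_append, List.take_append_drop]

lemma hword_eq_tprod_of_get (l : List (HLetter R x)) {n : ℕ} (hn : l.length = n)
    (a : Fin n → Cbar R x) (ha : ∀ i : Fin n, a i = (l[i]'(by omega)).val) :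
    hword l = TensorAlgebra.tprod R _ n a := by
  subst hn
  rw [hword_eq_tprod]
  exact congrArg _ (funext fun i => (ha i).symm)

lemma hdeg_eq_sum_of_get (l : List (HLetter R x)) {n : ℕ} (hn : l.length = n)
    (p : Fin n → ℕ) (hp : ∀ i : Fin n, p i = (l[i]'(by omega)).deg) : hdeg l = ∑ i, p i := by
  subst hn
  rw [Finset.sum_congr rfl fun i _ => hp i, hdeg, ← List.sum_ofFn]
  congr 1
  exact List.ext_getElem (by simp) fun i h1 h2 => by simp

/-- The list of the given homogeneous letters. -/
def letters {n : ℕ} {p : Fin n → ℕ} {a : Fin n → Cbar R x}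
    (h : ∀ i, IsHomog (p i + 1) (a i).1) : List (HLetter R x) :=
  List.ofFn fun i => ⟨p i, a i, h i⟩

lemma length_letters {n : ℕ} {p : Fin n → ℕ} {a : Fin n → Cbar R x}
    (h : ∀ i, IsHomog (p i + 1) (a i).1) : (letters h).length = n := List.length_ofFn

lemma hword_letters {n : ℕ} {p : Fin n → ℕ} {a : Fin n → Cbar R x}
    (h : ∀ i, IsHomog (p i + 1) (a i).1) : hword (letters h) = TensorAlgebra.tprod R _ n a :=
  hword_eq_tprod_of_get _ (length_letters h) _ fun i => by simp [letters]

lemma hdeg_letters {n : ℕ} {p : Fin n → ℕ} {a : Fin n → Cbar R x}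
    (h : ∀ i, IsHomog (p i + 1) (a i).1) : hdeg (letters h) = ∑ i, p i :=
  hdeg_eq_sum_of_get _ (length_letters h) _ fun i => by simp [letters]

variable (R x) in
/-- The words of degree `n`. -/
def gradeBar (n : ℕ) : Submodule R (Bar R x) := Submodule.span R {y | ∃ l, hdeg l = n ∧ hword l = y}

lemma hword_mem (l : List (HLetter R x)) : hword l ∈ gradeBar R x (hdeg l) :=
  Submodule.subset_span ⟨l, rfl, rfl⟩

lemma ι_mul_mem {q n : ℕ} {v : Cbar R x} (hv : IsHomog (q + 1) v.1) {y : Bar R x}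
    (hy : y ∈ gradeBar R x n) : TensorAlgebra.ι R v * y ∈ gradeBar R x (q + n) := by
  induction hy using Submodule.span_induction with
  | mem z hz =>
    obtain ⟨l, rfl, rfl⟩ := hz
    exact Submodule.subset_span ⟨⟨q, v, hv⟩ :: l, hdeg_cons _ _, hword_cons _ _⟩
  | zero => rw [mul_zero]; exact Submodule.zero_mem _
  | add y z _ _ hy hz => rw [mul_add]; exact Submodule.add_mem _ hy hz
  | smul r y _ hy => rw [mul_smul_comm]; exact Submodule.smul_mem _ _ hy

lemma tmul_hword_mem {q : ℕ} {a : C R x} (ha : IsHomog q a.1) (l : List (HLetter R x)) :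
    a ⊗ₜ hword l ∈ gradeABar R x (q + hdeg l) :=
  Submodule.subset_span ⟨q, l.length, fun i => (l.get i).deg, a, fun i => (l.get i).val, ha,
    fun i => (l.get i).homog,
    congrArg _ (hdeg_eq_sum_of_get l rfl _ fun _ => rfl).symm,
    congrArg _ (hword_eq_tprod l)⟩

lemma tmul_mem {q n : ℕ} {a : C R x} (ha : IsHomog q a.1) {y : Bar R x}
    (hy : y ∈ gradeBar R x n) : a ⊗ₜ y ∈ gradeABar R x (q + n) := by
  induction hy using Submodule.span_induction with
  | mem z hz =>
    obtain ⟨l, rfl, rfl⟩ := hz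
    exact tmul_hword_mem ha l
  | zero => rw [TensorProduct.tmul_zero]; exact Submodule.zero_mem _
  | add y z _ _ hy hz => rw [TensorProduct.tmul_add]; exact Submodule.add_mem _ hy hz
  | smul r y _ hy => rw [TensorProduct.tmul_smul]; exact Submodule.smul_mem _ _ hy

lemma gradeABar_induction {N : ℕ} {P : ABar R x → Prop} (zero : P 0)
    (add : ∀ u w, P u → P w → P (u + w)) (smul : ∀ (r : R) u, P u → P (r • u))
    (homog : ∀ q (a : C R x) (l : List (HLetter R x)), IsHomog q a.1 → q + hdeg l = N →
      P (a ⊗ₜ hword l)) {u : ABar R x} (hu : u ∈ gradeABar R x N) : P u := by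
  induction hu using Submodule.span_induction with
  | mem z hz =>
    obtain ⟨q, n, p, a₀, a, h₀, h, hN, rfl⟩ := hz
    rw [← hword_letters h]
    exact homog q a₀ _ h₀ (by rw [hdeg_letters h, hN])
  | zero => exact zero
  | add u w _ _ hu hw => exact add _ _ hu hw
  | smul r u _ hu => exact smul _ _ hu

lemma signA_of_mem {N : ℕ} {u : ABar R x} (hu : u ∈ gradeABar R x N) :
    signA R x u = (-1 : R) ^ N • u := by
  refine gradeABar_induction (P := fun u => signA R x u = (-1 : R) ^ N • u) ?_ (fun u w hu hw => ?_)
    (fun r u hu => ?_) (fun q a l ha h => ?_) hu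
  · rw [map_zero, smul_zero]
  · rw [map_add, hu, hw, smul_add]
  · rw [map_smul, hu, smul_comm]
  · have e : signA R x (a ⊗ₜ hword l) = inv R x a ⊗ₜ signBar R x (hword l) := rfl
    rw [e, inv_of_homog ha, signBar_hword, TensorProduct.smul_tmul_smul, ← pow_add, h]

lemma isHomog_one : IsHomog 0 (one R x).1 := fun _ hn => funext fun _ => if_neg hn

lemma capB_hword_mem {p : ℕ} {v : Cbar R x} (hv : IsHomog (p + 1) v.1) (l : List (HLetter R x)) :
    capB R x v (hword l) ∈ gradeBar R x (p + hdeg l + 1) := by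
  cases l with
  | nil => rw [hword_nil, capB_one]; exact Submodule.zero_mem _
  | cons b l =>
    rw [hword_cons, capB_cons, hdeg_cons]
    have h : IsHomog (p + b.deg + 1 + 1) (cupBar R x v b.val).1 := by
      have := isHomog_cup hv b.homog
      rwa [show p + 1 + (b.deg + 1) = p + b.deg + 1 + 1 by ring] at this
    have := ι_mul_mem h (hword_mem l)
    rwa [show p + (b.deg + hdeg l) + 1 = p + b.deg + 1 + hdeg l by ring]

lemma neg_add_sub_mem {R A : Type*} [CommRing R] [Ring A] [Algebra R A] (S : Submodule R A)
    {a b c : A} (ha : a ∈ S) (hb : b ∈ S) (hc : c ∈ S) : -a + b - c ∈ S :=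
  S.sub_mem (S.add_mem (S.neg_mem ha) hb) hc

lemma barD_hword_mem (l : List (HLetter R x)) :
    barD R x (hword l) ∈ gradeBar R x (hdeg l + 1) := by
  induction l with
  | nil => rw [hword_nil, barD_one]; exact Submodule.zero_mem _
  | cons b l ih =>
    have h1 := ι_mul_mem (v := dCbar R x b.val) (isHomog_coboundary b.homog) (hword_mem l)
    rw [add_right_comm] at h1
    rw [hword_cons, barD_cons_cap, hdeg_cons]
    have h2 := ι_mul_mem (v := invBar R x b.val) (isHomog_invBar b.homog) ih
    have h3 := capB_hword_mem (v := invBar R x b.val) (isHomog_invBar b.homog) l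
    exact neg_add_sub_mem _ h1 h2 h3

lemma dABar_mem {N : ℕ} {u : ABar R x} (hu : u ∈ gradeABar R x N) :
    dABar R x u ∈ gradeABar R x (N + 1) := by
  refine gradeABar_induction (P := fun u => dABar R x u ∈ gradeABar R x (N + 1)) ?_
    (fun u w hu hw => ?_) (fun r u hu => ?_) (fun q a l ha h => ?_) hu
  · rw [map_zero]; exact Submodule.zero_mem _
  · rw [map_add]; exact Submodule.add_mem _ hu hw
  · rw [map_smul]; exact Submodule.smul_mem _ _ hu
  · subst h
    have h1 := tmul_mem (a := dC R x a) (isHomog_coboundary ha) (hword_mem l)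
    rw [add_right_comm] at h1
    have h2 := tmul_mem (isHomog_inv ha) (barD_hword_mem l)
    have h3 : lact R x (inv R x a) (twist R x (hword l)) ∈ gradeABar R x (q + hdeg l + 1) := by
      cases l with
      | nil => rw [hword_nil, twist_one, map_zero]; exact Submodule.zero_mem _
      | cons b l =>
        rw [hword_cons, twist_cons, lact_tmul, hdeg_cons]
        have hb : IsHomog (b.deg + 1) (incl R x b.val).1 := b.homog
        have := tmul_hword_mem (a := cup R x (inv R x a) (inv R x (incl R x b.val)))
          (isHomog_cup (isHomog_inv ha) (isHomog_inv hb)) l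
        rwa [show q + (b.deg + hdeg l) + 1 = q + (b.deg + 1) + hdeg l by ring]
    rw [dABar_tmul]
    exact Submodule.add_mem _ (Submodule.sub_mem _ h1 h2) h3

variable (hX : ∀ e : X _⦋1⦌, e = constSimplex X x 1)

include hX

/-- Each summand in `rmul_hword_cons` has the right degree because operations add bar degrees
(`isHomog_opL`). -/
lemma rmul_hword_mem (l L : List (HLetter R x)) :
    rmul (hword l) (hword L) ∈ gradeBar R x (hdeg L + hdeg l) := by
  induction l generalizing L with
  | nil =>
    rw [hword_nil, rmul_one]
    exact hword_mem L
  | cons b l ih =>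
    induction L with
    | nil =>
      rw [hword_nil, rmul_apply_one hX, hdeg_nil, zero_add]
      exact hword_mem _
    | cons e L ihL =>
      rw [hword_cons b, rmul_hword_cons]
      refine Submodule.add_mem _ (Submodule.sum_mem _ fun i _ => ?_) ?_
      · have h1 := isHomog_opL hX b.homog ((e :: L).take i)
        have h2 := ih ((e :: L).drop i)
        have h3 := ι_mul_mem h1 (Submodule.smul_mem _ ((-1 : R) ^ (b.deg * hdeg ((e :: L).drop i))) h2)
        rw [← map_smul, ← sgn_hword] at h3
        have := hdeg_take_add_drop (e :: L) i
        rw [hdeg_cons b]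
        rwa [show b.deg + hdeg ((e :: L).take i) + (hdeg ((e :: L).drop i) + hdeg l)
          = hdeg (e :: L) + (b.deg + hdeg l) by omega] at h3
      · rw [hdeg_cons e, add_assoc, ← hword_cons b]
        exact ι_mul_mem e.homog ihL

lemma mulA_mem {i j : ℕ} {u w : ABar R x} (hu : u ∈ gradeABar R x i) (hw : w ∈ gradeABar R x j) :
    mulA R x u w ∈ gradeABar R x (i + j) := by
  refine gradeABar_induction (P := fun w => mulA R x u w ∈ gradeABar R x (i + j)) ?_
    (fun w w' hw hw' => ?_) (fun r w hw => ?_) (fun q b l hb hj => ?_) hw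
  · rw [map_zero]; exact Submodule.zero_mem _
  · rw [map_add]; exact Submodule.add_mem _ hw hw'
  · rw [map_smul]; exact Submodule.smul_mem _ _ hw
  · refine gradeABar_induction (P := fun u => mulA R x u (b ⊗ₜ hword l) ∈ gradeABar R x (i + j)) ?_
      (fun w w' hw hw' => ?_) (fun r w hw => ?_) (fun p a L ha hi => ?_) hu
    · rw [map_zero, LinearMap.zero_apply]; exact Submodule.zero_mem _
    · rw [mulA_add_left]; exact Submodule.add_mem _ hw hw'
    · rw [map_smul, LinearMap.smul_apply]; exact Submodule.smul_mem _ _ hw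
    · subst hi hj
      rw [mulA_tmul, wordMulA_tmul, wordMul_hword hb, map_sum]
      refine Submodule.sum_mem _ fun i _ => ?_
      rw [lact_tmul, sgn_hword, map_smul]
      have h := tmul_mem (a := cup R x a (opF b (hword (L.take i)))) (isHomog_cup ha (isHomog_opF hX hb (L.take i)))
        (Submodule.smul_mem _ ((-1 : R) ^ (q * hdeg (L.drop i))) (rmul_hword_mem hX l (L.drop i)))
      have := hdeg_take_add_drop L i
      rwa [show p + (q + hdeg (L.take i)) + (hdeg (L.drop i) + hdeg l)
        = p + hdeg L + (q + hdeg l) by omega] at h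

end AcyclicBar

end

/-! ### The product formula, uniqueness and the theorem -/

noncomputable section

namespace AcyclicBar

universe u v

variable {R : Type v} [CommRing R] {X : SSet.{u}} {x : X _⦋0⦌} {N : ℕ}

lemma mulA_tmul_tprod {n : ℕ} {p : Fin n → ℕ} {q : ℕ} (a₀ : C R x) {a : Fin n → Cbar R x}
    {b₀ : C R x} (h : ∀ i, IsHomog (p i + 1) (a i).1) (hb : IsHomog q b₀.1) (y : Bar R x)
    (hl : ∀ (k : Fin (n + 1)) (i : Fin k), (i : ℕ) < n)
    (hr : ∀ (k : Fin (n + 1)) (i : Fin (n - k)), (k + i : ℕ) < n) :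
    mulA R x (a₀ ⊗ₜ TensorAlgebra.tprod R _ n a) (b₀ ⊗ₜ y) =
      ∑ k : Fin (n + 1),
        (-1 : R) ^ (q * ∑ i : Fin (n - k), p ⟨k + i, hr k i⟩) •
          (cup R x a₀ (opE R x k (fun i : Fin k => a ⟨i, hl k i⟩) b₀) ⊗ₜ
            barMul R x
              (TensorAlgebra.tprod R _ (n - k) fun i : Fin (n - k) => a ⟨k + i, hr k i⟩) y) := by
  rw [mulA_tmul, wordMulA_tmul, ← hword_letters h, wordMul_hword hb, map_sum, length_letters,
    Finset.sum_range]
  refine Finset.sum_congr rfl fun k _ => ?_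
  have hk : (k : ℕ) ≤ n := Nat.lt_succ_iff.mp k.2
  have h1 : hword ((letters h).take k)
      = TensorAlgebra.tprod R _ k fun i : Fin k => a ⟨i, hl k i⟩ :=
    hword_eq_tprod_of_get _ (by rw [List.length_take, length_letters, min_eq_left hk]) _
      fun i => by simp [letters]
  have h2 : hword ((letters h).drop k)
      = TensorAlgebra.tprod R _ (n - k) fun i : Fin (n - k) => a ⟨k + i, hr k i⟩ :=
    hword_eq_tprod_of_get _ (by rw [List.length_drop, length_letters]) _
      fun i => by simp [letters]
  have h3 : hdeg ((letters h).drop k) = ∑ i : Fin (n - k), p ⟨k + i, hr k i⟩ :=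
    hdeg_eq_sum_of_get _ (by rw [List.length_drop, length_letters]) _
      fun i => by simp [letters]
  rw [lact_tmul, sgn_hword, map_smul, TensorProduct.tmul_smul, rmul_apply, opF_apply, h1, h2, h3,
    opC_tprod]

/-- A bilinear map on the acyclic bar construction is determined by its values on tensors of
homogeneous elements. -/
lemma ABar_bilin_ext {μ ν : ABar R x →ₗ[R] ABar R x →ₗ[R] ABar R x}
    (h : ∀ (q : ℕ) (a b : C R x) (L l : List (HLetter R x)), IsHomog q b.1 →
      μ (a ⊗ₜ hword L) (b ⊗ₜ hword l) = ν (a ⊗ₜ hword L) (b ⊗ₜ hword l)) : μ = ν := by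
  refine LinearMap.ext fun u => LinearMap.ext fun w => ?_
  refine ABar_induction (P := fun u => μ u w = ν u w) ?_ (fun u u' hu hu' => ?_)
    (fun r u hu => ?_) (fun _ a L _ => ?_) u
  · rw [map_zero, map_zero]
  · rw [map_add, map_add, LinearMap.add_apply, LinearMap.add_apply, hu, hu']
  · rw [map_smul, map_smul, LinearMap.smul_apply, LinearMap.smul_apply, hu]
  · refine ABar_induction (P := fun w => μ (a ⊗ₜ hword L) w = ν (a ⊗ₜ hword L) w) ?_
      (fun w w' hw hw' => ?_) (fun r w hw => ?_) (fun q b l hb => h q a b L l hb) w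
    · rw [map_zero, map_zero]
    · rw [map_add, map_add, hw, hw']
    · rw [map_smul, map_smul, hw]

lemma isDGA_mulA (hX : ∀ e : X _⦋1⦌, e = constSimplex X x 1) :
    IsDGA (gradeABar R x) (dABar R x) (one R x ⊗ₜ 1) (mulA R x) where
  one_mem := tmul_hword_mem isHomog_one []
  mul_mem := mulA_mem hX
  one_mul := one_mulA hX
  mul_one := mulA_one hX
  mul_assoc := mulA_assoc hX
  d_mem := dABar_mem
  d_d := dABar_dABar
  leibniz b ha := by
    rw [dABar_mulA hX, signA_of_mem ha, map_smul, LinearMap.smul_apply]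

/-- The condition defining the subcomplex, applied to the identity of the 1-simplex. -/
lemma singOne_eq_constSimplex {Y : Type u} [TopologicalSpace Y] (y : Y) (e : (singOne Y y) _⦋1⦌) :
    e = constSimplex (singOne Y y) (singOneBase Y y) 1 := by
  obtain ⟨σ, h⟩ := e
  refine Subtype.ext ?_
  have := h (𝟙 ⦋1⦌)
  rw [op_id, Functor.map_id_apply] at this
  exact this

end AcyclicBar

end

/-- The acyclic bar construction of the cochains of a based space carries a unique bilinear product
given by the explicit formula below; it is strictly associative and makes the acyclic bar
construction a differential graded algebra. -/
theorem mainTheorem8 {R : Type*} [CommRing R] {Y : Type*} [TopologicalSpace Y] (y : Y) :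
    ∃! μ : AcyclicBar.ABar R (AcyclicBar.singOneBase Y y) →ₗ[R]
        AcyclicBar.ABar R (AcyclicBar.singOneBase Y y) →ₗ[R]
        AcyclicBar.ABar R (AcyclicBar.singOneBase Y y),
      (∀ (n m : ℕ) (p : Fin n → ℕ) (q : ℕ)
        (a₀ : AcyclicBar.C R (AcyclicBar.singOneBase Y y))
        (a : Fin n → AcyclicBar.Cbar R (AcyclicBar.singOneBase Y y))
        (b₀ : AcyclicBar.C R (AcyclicBar.singOneBase Y y))
        (b : Fin m → AcyclicBar.Cbar R (AcyclicBar.singOneBase Y y)),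
        (∀ i, AcyclicBar.IsHomog (p i + 1) (a i).1) → AcyclicBar.IsHomog q b₀.1 →
        μ (a₀ ⊗ₜ TensorAlgebra.tprod R _ n a) (b₀ ⊗ₜ TensorAlgebra.tprod R _ m b) =
          ∑ k : Fin (n + 1),
            (-1 : R) ^ (q * ∑ i : Fin (n - k), p ⟨k + i, by omega⟩) •
              (AcyclicBar.cup R _ a₀
                  (AcyclicBar.opE R _ k (fun i : Fin k => a ⟨i, by omega⟩) b₀) ⊗ₜ
                AcyclicBar.barMul R _
                  (TensorAlgebra.tprod R _ (n - k) fun i : Fin (n - k) => a ⟨k + i, by omega⟩)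
                  (TensorAlgebra.tprod R _ m b))) ∧
      AcyclicBar.IsDGA (AcyclicBar.gradeABar R (AcyclicBar.singOneBase Y y))
        (AcyclicBar.dABar R (AcyclicBar.singOneBase Y y))
        (AcyclicBar.one R (AcyclicBar.singOneBase Y y) ⊗ₜ 1) μ := by
  refine ⟨AcyclicBar.mulA R _, ⟨?_, ?_⟩, fun ν hν => ?_⟩
  · intro n m p q a₀ a b₀ b h hb
    exact AcyclicBar.mulA_tmul_tprod a₀ h hb _ (fun k i => by omega) fun k i => by omega
  · exact AcyclicBar.isDGA_mulA (AcyclicBar.singOne_eq_constSimplex y)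
  -- Only the product formula for ν is used: it fixes the values on words with homogeneous letters,
  -- and these determine a bilinear map.
  · refine AcyclicBar.ABar_bilin_ext fun q a b L l hb => ?_
    have h := hν.1 _ _ _ q a _ b (fun i => (l.get i).val) (fun i => (L.get i).homog) hb
    rw [AcyclicBar.hword_eq_tprod L, AcyclicBar.hword_eq_tprod l]
    exact h.trans (AcyclicBar.mulA_tmul_tprod a (fun i => (L.get i).homog) hb _
      (fun k i => by omega) fun k i => by omega).symm
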